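/- **Notation.** Let $b>j\ge 1$ be integers. Let $\mathcal P_b$ be the set of probability distributions $p=(p_1,\dots,p_b)$ on $b$ symbols, and for $p,q\in\mathcal P_b$ let $$\Psi(p,q)=\frac1{(b-j-1)!}\sum_{\sigma\in S_b}\Big(p_{\sigma(1)}\cdots p_{\sigma(j)}\,q_{\sigma(j+1)}+q_{\sigma(1)}\cdots q_{\sigma(j)}\,p_{\sigma(j+1)}\Big).$$ Throughout $j=k-2$. For a parameter $\epsilon>0$, consider two partitions of $\mathcal P_b$ into a balanced cluster $\mathcal P_b^0$ and $b$ unbalanced clusters $\mathcal P_b^1,\dots,\mathcal P_b^b$. - *Maximum-based partition* ($\epsilon<1/(b-1)$): $\mathcal P_b^0=\{p: p_i\le 1-\epsilon\ \forall i\}$ and $\mathcal P_b^i=\{p: p_i>1-\epsilon\}$ for $1\le i\le b$. - *Minimum-based partition* ($\epsilon<1/b$): $\mathcal P_b^0=\{p: p_i\ge\epsilon\ \forall i\}$ and $\mathcal P_b^i=\{p: p_i<\epsilon,\ p_h\ge p_i\ \forall h,\ p_h>p_i\ \forall h<i\}$ for $1\le i\le b$. For $i\ne h$ in $\{1,\dots,b\}$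 put $$M_1=\sup_{p,q\in\mathcal P_b^0}\Psi(p,q),\quad M_2=\sup_{p\in\mathcal P_b^0,\,q\in\mathcal P_b^i}\Psi(p,q),\quad M_3=\sup_{p,q\in\mathcal P_b^i}\Psi(p,q),\quad M_4=\sup_{p\in\mathcal P_b^i,\,q\in\mathcal P_b^h}\Psi(p,q),$$ and let $M$ be the maximum, over all probability distributions $\eta=(\eta_0,\dots,\eta_b)$, of $$\eta_0^2M_1+2\eta_0\sum_{i>0}\eta_iM_2+\sum_{i>0}\eta_i^2M_3+2\sum_{0<i<h}\eta_i\eta_hM_4 .$$ **Theorem.** In each case below, $M$ is one number, the same for every choice of $i\neq h$ in the definition of $M_2,M_3,M_4$. 1. With the maximum-based partition, up to an error of at most $10^{-7}$: - $M\approx 0.0861594$ for $(b,k,\epsilon)=(7,7,\tfrac9{100})$; - $M\approx 0.0388599$ for $(8,8,\tfrac3{25})$; - $M\approx 0.0758830$ for $(9,8,\tfrac1{10})$; - $M\approx 0.0363565$ for $(10,9,\tfrac1{15})$; - $M\approx 0.0170049$ for $(11,10,\tfrac1{11})$. 2. With the minimum-based partition: - for $(b,k,\epsilon)=(5,5,\tfrac{4+\sqrt5}{44})$: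 $0.3873676-4\cdot10^{-4}\le M\le 0.3873676$. Moreover $M_3\le 0.374759$, and when $M_3$ is replaced by this upper bound $0.374759$ in the quadratic form, its maximum over $\eta$ equals $0.3873676$ up to an error of at most $10^{-7}$; - for $(6,5,\tfrac1{10})$: $0.5567010-5\cdot10^{-6}\le M\le 0.5567010$; - for $(6,6,\tfrac1{20})$: $M=\tfrac5{27}$ exactly. -/

import Mathlib

open Finset

/-- The set `𝒫_b` of probability distributions on `b` symbols. -/
abbrev ProbDist (b : ℕ) : Set (Fin b → ℝ) := stdSimplex ℝ (Fin b)

/-- The polynomial `Ψ(p, q)` on `b` symbols with parameter `j` (meant for `j < b`):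
`1 / (b-j-1)!` times the sum over all permutations `σ` of the symbols of
`p_{σ(1)} ⋯ p_{σ(j)} q_{σ(j+1)} + q_{σ(1)} ⋯ q_{σ(j)} p_{σ(j+1)}`.
Positions are numbered from `0`, so the first `j` positions are those with value `< j`, and
the position `j+1` is the only one with value `j`. -/
noncomputable def Psi (b j : ℕ) (p q : Fin b → ℝ) : ℝ :=
  (1 / ((b - j - 1).factorial : ℝ)) *
    ∑ σ : Equiv.Perm (Fin b),
      ((∏ s : Fin b with s.val < j, p (σ s)) * (∏ s : Fin b with s.val = j, q (σ s)) +
       (∏ s : Fin b with s.val < j, q (σ s)) * (∏ s : Fin b with s.val = j, p (σ s)))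

/-- The supremum of `Ψ(p, q)` over `p ∈ A`, `q ∈ B`. -/
noncomputable def supPsi (b j : ℕ) (A B : Set (Fin b → ℝ)) : ℝ :=
  sSup {x : ℝ | ∃ p ∈ A, ∃ q ∈ B, x = Psi b j p q}

/-- Maximum-based partition: balanced distributions, all entries at most `1 - ε`. -/
def maxBalanced (b : ℕ) (ε : ℝ) : Set (Fin b → ℝ) :=
  {p | p ∈ ProbDist b ∧ ∀ i, p i ≤ 1 - ε}

/-- Maximum-based partition: distributions with more than `1 - ε` on the symbol `i`. -/
def maxUnbalanced (b : ℕ) (ε : ℝ) (i : Fin b) : Set (Fin b → ℝ) :=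
  {p | p ∈ ProbDist b ∧ 1 - ε < p i}

/-- Minimum-based partition: balanced distributions, all entries at least `ε`. -/
def minBalanced (b : ℕ) (ε : ℝ) : Set (Fin b → ℝ) :=
  {p | p ∈ ProbDist b ∧ ∀ i, ε ≤ p i}

/-- Minimum-based partition: distributions whose smallest entry is smaller than `ε` and is
attained for the first time at the symbol `i`. -/
def minUnbalanced (b : ℕ) (ε : ℝ) (i : Fin b) : Set (Fin b → ℝ) :=
  {p | p ∈ ProbDist b ∧ p i < ε ∧ (∀ h, p i ≤ p h) ∧ ∀ h, h < i → p i < p h}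

/-- The quadratic form
`η₀² M₁ + 2 η₀ ∑_{i>0} η_i M₂ + ∑_{i>0} η_i² M₃ + 2 ∑_{0<i<h} η_i η_h M₄`
in the weights `η₀, η₁, …, η_b` of the `b + 1` clusters. -/
noncomputable def clusterForm (b : ℕ) (M₁ M₂ M₃ M₄ : ℝ) (η : Fin (b + 1) → ℝ) : ℝ :=
  η 0 ^ 2 * M₁ + 2 * (η 0 * ∑ i : Fin b, η i.succ * M₂) + ∑ i : Fin b, η i.succ ^ 2 * M₃ +
    2 * ∑ i : Fin b, ∑ h : Fin b with i < h, η i.succ * η h.succ * M₄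

/-- `M` is the maximum of the cluster form over all probability distributions `η` on the
`b + 1` clusters. -/
def IsClusterMax (b : ℕ) (M₁ M₂ M₃ M₄ M : ℝ) : Prop :=
  IsGreatest (clusterForm b M₁ M₂ M₃ M₄ '' stdSimplex ℝ (Fin (b + 1))) M

/-- `M` is the maximum of the cluster form for the partition of `𝒫_b` with balanced cluster
`B` and unbalanced clusters `U i`; the coefficients `M₁, …, M₄` are the suprema of `Ψ` over
pairs of clusters, and `M` is the same whichever symbols `i ≠ h` are used to define them. -/
def IsPartitionMax (b j : ℕ) (B : Set (Fin b → ℝ)) (U : Fin b → Set (Fin b → ℝ)) (M : ℝ) :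
    Prop :=
  ∀ i h : Fin b, i ≠ h →
    IsClusterMax b (supPsi b j B B) (supPsi b j B (U i)) (supPsi b j (U i) (U i))
      (supPsi b j (U i) (U h)) M

/-- `M` for `(b, k)`, `j = k - 2`, with the maximum-based partition with parameter `ε`. -/
def IsMaxPartitionM (b k : ℕ) (ε M : ℝ) : Prop :=
  IsPartitionMax b (k - 2) (maxBalanced b ε) (maxUnbalanced b ε) M

/-- `M` for `(b, k)`, `j = k - 2`, with the minimum-based partition with parameter `ε`. -/
def IsMinPartitionM (b k : ℕ) (ε M : ℝ) : Prop :=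
  IsPartitionMax b (k - 2) (minBalanced b ε) (minUnbalanced b ε) M

/-!
Up to the factor `j!`, the polynomial `Ψ` is the polarised elementary symmetric polynomial `phi`
(`Psi_eq`): the sum of the derivative of `e_{j+1}` at `p` in the direction `q` and the one with `p`
and `q` exchanged. By continuity and symmetry the four coefficients are the suprema of `phi` over
closed sets, for one fixed pair of symbols (`supPsi_min_eq`, `isPartitionMax_of`). For a given total
weight `x` of the unbalanced clusters an even distribution is optimal, so the cluster form becomes a
quadratic polynomial in `x`, and two-sided bounds for the coefficients give two-sided bounds for its
maximum (`IsClusterMax.le`, `IsClusterMax.le_of_le`). The lower bounds for the coefficients come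
from explicit distributions (`Psi_vec`); the work is in the upper bounds.

*Pairs of distributions with bounded entries.* As a function of the entries at two symbols, `phi` is
affine in the two sums and has nonnegative coefficients at the products (`phi_insert_insert`). Hence
at a maximising pair with smallest sum of squares, two symbols below the cap have equal entries
unless `p` and `q` order them oppositely with one of the entries zero, and the symbols form at most
three blocks with entries `(a, a')`, `(β, 0)`, `(0, γ)` (`IsExtremal.exists_isBlocks`). This leaves
finitely many families with few parameters, to which a branch and bound procedure on natural numbers
applies, proved sound in `covers_sound` and `BlockBound.test_sound` and evaluated by the kernel. If an
entry is large, Maclaurin's inequality bounds both summands of `phi` (`exists_dsym_le`,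
`esym_erase_le_tailBound`); for seven and eight symbols the range next to the cap needs the
block structure once more (`IsExtremal.exists_two_blocks`). The result is that the pair of uniform
distributions is optimal among the balanced ones (`phi_le_capped_seven` and its analogues), while a
vertex and the uniform distribution on the other symbols give the second coefficient
(`phi_le_of_near_vertex`). This settles the maximum-based partitions and, with one more
branch and bound, the minimum-based partition with `(b, k) = (6, 6)`.

*The case `j = 3`.* With the mean `c` and half the difference `r` of `p` and `q`,
`phi = 8 (e₄(c) - e₄(r))` (`phi_add_sub`). Since the entries of `r` have sum zero,
`-8 e₄(r) = 2 ∑ r⁴ - (∑ r²)²`, which is at most a constant times the fourth power of the largest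
difference, with a correction for unequal other differences (`sum_pow_four_add_le`). By Maclaurin's
inequality `e₄(c)` is bounded in terms of one or two entries of `c`. The difference at a symbol is
bounded in terms of the mean there, so that each coefficient for `(b, k) = (5, 5)` and `(6, 5)` is
bounded by a polynomial in one or two variables. Only the coefficient `M₄` for `(6, 5)` needs
the correction (`Psi_le_six_of_small`).
-/

/-! ### Elementary symmetric polynomials and their derivatives -/

/-- The elementary symmetric polynomial of degree `k` in the values `x i`, `i ∈ s`. -/
noncomputable def esym {ι : Type*} (s : Finset ι) (k : ℕ) (x : ι → ℝ) : ℝ :=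
  ∑ t ∈ s.powersetCard k, ∏ i ∈ t, x i

/-- The derivative of the elementary symmetric polynomial of degree `k + 1` at `x` in the
direction `y`: a polynomial of degree `k` in `x` and of degree one in `y`. -/
noncomputable def dsym {ι : Type*} [DecidableEq ι] (s : Finset ι) (k : ℕ) (x y : ι → ℝ) : ℝ :=
  ∑ i ∈ s, y i * esym (s.erase i) k x

/-- The symmetric form of `Ψ`, without the factor `j!`. -/
noncomputable def phi {ι : Type*} [DecidableEq ι] (s : Finset ι) (j : ℕ) (p q : ι → ℝ) : ℝ :=
  dsym s j p q + dsym s j q p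

section Algebra

variable {ι : Type*}

@[simp] lemma esym_zero (s : Finset ι) (x : ι → ℝ) : esym s 0 x = 1 := by simp [esym]

lemma esym_empty_succ (k : ℕ) (x : ι → ℝ) : esym ∅ (k + 1) x = 0 := by
  rw [esym, powersetCard_eq_empty.2 (by simp), sum_empty]

lemma esym_eq_zero {s : Finset ι} {k : ℕ} (h : s.card < k) (x : ι → ℝ) : esym s k x = 0 := by
  rw [esym, Finset.powersetCard_eq_empty.2 h, sum_empty]

lemma esym_congr {s : Finset ι} {k : ℕ} {x y : ι → ℝ} (h : ∀ i ∈ s, x i = y i) :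
    esym s k x = esym s k y :=
  sum_congr rfl fun _ ht => prod_congr rfl fun i hi => h i ((mem_powersetCard.1 ht).1 hi)

lemma esym_nonneg {s : Finset ι} {x : ι → ℝ} (k : ℕ) (h : ∀ i ∈ s, 0 ≤ x i) :
    0 ≤ esym s k x :=
  sum_nonneg fun _ ht => prod_nonneg fun i hi => h i ((mem_powersetCard.1 ht).1 hi)

lemma esym_const {s : Finset ι} {x : ι → ℝ} {a : ℝ} (k : ℕ) (h : ∀ i ∈ s, x i = a) :
    esym s k x = s.card.choose k * a ^ k := by
  rw [esym, ← card_powersetCard, ← nsmul_eq_mul, ← sum_const]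
  refine sum_congr rfl fun t ht => ?_
  obtain ⟨h1, h2⟩ := mem_powersetCard.1 ht
  rw [prod_congr rfl fun i hi => h i (h1 hi), prod_const, h2]

lemma esym_one (s : Finset ι) (x : ι → ℝ) : esym s 1 x = ∑ i ∈ s, x i := by
  simp [esym, powersetCard_one]

variable [DecidableEq ι]

lemma esym_insert {s : Finset ι} {i : ι} (hi : i ∉ s) (k : ℕ) (x : ι → ℝ) :
    esym (insert i s) (k + 1) x = esym s (k + 1) x + x i * esym s k x := by
  have hnot : ∀ t ∈ s.powersetCard k, i ∉ t := fun t ht h => hi ((mem_powersetCard.1 ht).1 h)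
  rw [esym, powersetCard_succ_insert hi, sum_union, sum_image, esym, esym, mul_sum]
  · congr 1
    exact sum_congr rfl fun t ht => prod_insert (hnot t ht)
  · intro t ht u hu h
    rw [← erase_insert (hnot t ht), ← erase_insert (hnot u hu), h]
  · rw [disjoint_left]
    intro t ht hu
    obtain ⟨u, _, rfl⟩ := mem_image.1 hu
    exact hi ((mem_powersetCard.1 ht).1 (mem_insert_self i u))

lemma esym_erase {s : Finset ι} {i : ι} (hi : i ∈ s) (k : ℕ) (x : ι → ℝ) :
    esym s (k + 1) x = esym (s.erase i) (k + 1) x + x i * esym (s.erase i) k x := by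
  conv_lhs => rw [← insert_erase hi]
  exact esym_insert (notMem_erase i s) k x

lemma dsym_congr {s : Finset ι} {k : ℕ} {x y x' y' : ι → ℝ} (h : ∀ i ∈ s, x i = x' i)
    (h' : ∀ i ∈ s, y i = y' i) : dsym s k x y = dsym s k x' y' :=
  sum_congr rfl fun i hi => by
    rw [h' i hi, esym_congr fun l hl => h l (mem_of_mem_erase hl)]

lemma dsym_nonneg {s : Finset ι} {x y : ι → ℝ} (k : ℕ) (hx : ∀ i ∈ s, 0 ≤ x i)
    (hy : ∀ i ∈ s, 0 ≤ y i) : 0 ≤ dsym s k x y :=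
  sum_nonneg fun i hi => mul_nonneg (hy i hi)
    (esym_nonneg _ fun l hl => hx l (mem_of_mem_erase hl))

lemma dsym_empty (k : ℕ) (x y : ι → ℝ) : dsym ∅ k x y = 0 := by simp [dsym]

lemma dsym_zero (s : Finset ι) (x y : ι → ℝ) : dsym s 0 x y = ∑ i ∈ s, y i := by simp [dsym]

lemma dsym_insert {s : Finset ι} {i : ι} (hi : i ∉ s) (k : ℕ) (x y : ι → ℝ) :
    dsym (insert i s) (k + 1) x y =
      dsym s (k + 1) x y + x i * dsym s k x y + y i * esym s (k + 1) x := by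
  rw [dsym, sum_insert hi, erase_insert hi, dsym, dsym, mul_sum, ← sum_add_distrib, add_comm]
  congr 1
  refine sum_congr rfl fun h hh => ?_
  have hne : i ≠ h := fun e => hi (e ▸ hh)
  rw [erase_insert_of_ne hne, esym_insert fun h' => hi (mem_of_mem_erase h')]
  ring

lemma phi_comm (s : Finset ι) (j : ℕ) (p q : ι → ℝ) : phi s j p q = phi s j q p := by
  rw [phi, phi, add_comm]

lemma phi_insert {s : Finset ι} {i : ι} (hi : i ∉ s) (k : ℕ) (p q : ι → ℝ) :
    phi (insert i s) (k + 1) p q =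
      (dsym s (k + 1) p q + p i * dsym s k p q + q i * esym s (k + 1) p) +
      (dsym s (k + 1) q p + q i * dsym s k q p + p i * esym s (k + 1) q) := by
  rw [phi, dsym_insert hi, dsym_insert hi]

/-- The dependence of `phi` on the entries at two symbols: it is affine in the two sums and in
the three products of entries at different symbols, and the coefficients of the products are
nonnegative for nonnegative vectors. -/
lemma phi_insert_insert {s : Finset ι} {i h : ι} (hih : i ≠ h) (hi : i ∉ s) (hh : h ∉ s) (k : ℕ)
    (p q : ι → ℝ) :
    phi (insert i (insert h s)) (k + 2) p q =
      phi s (k + 2) p q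
      + (p i + p h) * (dsym s (k + 1) p q + esym s (k + 2) q)
      + (q i + q h) * (dsym s (k + 1) q p + esym s (k + 2) p)
      + p i * p h * dsym s k p q + q i * q h * dsym s k q p
      + (p i * q h + p h * q i) * (esym s (k + 1) p + esym s (k + 1) q) := by
  have hi' : i ∉ insert h s := by simp [hih, hi]
  rw [phi_insert hi', dsym_insert hh, dsym_insert hh, dsym_insert hh, dsym_insert hh,
    esym_insert hh, esym_insert hh, phi]
  ring

end Algebra

/-! ### The sum over permutations -/

section Permutations

variable {ι : Type*} [Fintype ι] [DecidableEq ι]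

/-- The number of permutations that send a given finset `J` to `S` and a given `l ∉ J` to `i`
does not depend on `S` and `i`. -/
lemma card_perm_fiber {J S : Finset ι} {l i : ι} (hl : l ∉ J) (hi : i ∉ S)
    (hc : J.card = S.card) :
    (univ.filter fun σ : Equiv.Perm ι => σ l = i ∧ J.map σ.toEmbedding = S).card =
      (univ.filter fun σ : Equiv.Perm ι => σ l = l ∧ J.map σ.toEmbedding = J).card := by
  obtain ⟨τ, hτl, hτ⟩ : ∃ τ : Equiv.Perm ι, τ l = i ∧ ∀ x, τ x ∈ S ↔ x ∈ J := by
    obtain ⟨τ, rfl⟩ := Equiv.Perm.exists_map_finset_eq J S hc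
    refine ⟨Equiv.swap (τ l) i * τ, by simp, fun x => ?_⟩
    have hmem : ∀ y, Equiv.swap (τ l) i y ∈ J.map τ.toEmbedding ↔ y ∈ J.map τ.toEmbedding := by
      intro y
      have h1 : τ l ∉ J.map τ.toEmbedding := by simpa using hl
      rcases eq_or_ne y (τ l) with rfl | h2
      · simp only [Equiv.swap_apply_left]; tauto
      · rcases eq_or_ne y i with rfl | h3
        · simp only [Equiv.swap_apply_right]; tauto
        · rw [Equiv.swap_apply_of_ne_of_ne h2 h3]
    rw [Equiv.Perm.mul_apply, hmem]
    simp
  have hmap : ∀ σ : Equiv.Perm ι, J.map σ.toEmbedding = J ↔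
      J.map (τ * σ).toEmbedding = S := by
    intro σ
    have h1 : J.map (τ * σ).toEmbedding = (J.map σ.toEmbedding).map τ.toEmbedding := by
      rw [map_map]; rfl
    have h2 : S = J.map τ.toEmbedding := by
      ext y
      obtain ⟨x, rfl⟩ := τ.surjective y
      simp [hτ]
    rw [h1, h2, map_inj]
  refine (card_bij' (fun σ _ => τ * σ) (fun σ _ => τ⁻¹ * σ) ?_ ?_ ?_ ?_).symm
  · intro σ hσ
    simp only [mem_filter, mem_univ, true_and] at hσ ⊢
    exact ⟨by rw [Equiv.Perm.mul_apply, hσ.1, hτl], (hmap σ).1 hσ.2⟩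
  · intro σ hσ
    simp only [mem_filter, mem_univ, true_and] at hσ ⊢
    refine ⟨by rw [Equiv.Perm.mul_apply, hσ.1, ← hτl]; simp, ?_⟩
    rw [hmap, mul_inv_cancel_left]
    exact hσ.2
  · intro σ _; simp
  · intro σ _; simp

/-- Every pair of a symbol and a disjoint set of `#J` symbols comes from the same number of
permutations. -/
lemma sum_perm_eq_mul_dsym (J : Finset ι) {l : ι} (hl : l ∉ J) (p q : ι → ℝ) :
    ∑ σ : Equiv.Perm ι, (∏ s ∈ J, p (σ s)) * q (σ l) =
      (J.card.factorial * (Fintype.card ι - J.card - 1).factorial : ℝ) *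
        dsym univ J.card p q := by
  set I : Finset (Σ _ : ι, Finset ι) :=
    univ.sigma fun i => (univ.erase i).powersetCard J.card with hI
  set N := (univ.filter fun σ : Equiv.Perm ι => σ l = l ∧ J.map σ.toEmbedding = J).card with hN
  have hmaps : ∀ σ ∈ (univ : Finset (Equiv.Perm ι)),
      (⟨σ l, J.map σ.toEmbedding⟩ : Σ _ : ι, Finset ι) ∈ I := by
    intro σ _
    simp only [hI, mem_sigma, mem_univ, true_and, mem_powersetCard, card_map, and_true]
    intro x hx
    obtain ⟨y, hy, rfl⟩ := mem_map.1 hx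
    simp only [Equiv.coe_toEmbedding, mem_erase, ne_eq, EmbeddingLike.apply_eq_iff_eq, mem_univ,
      and_true]
    exact ne_of_mem_of_not_mem hy hl
  have key : ∀ g : (Σ _ : ι, Finset ι) → ℝ,
      ∑ σ : Equiv.Perm ι, g ⟨σ l, J.map σ.toEmbedding⟩ = N * ∑ a ∈ I, g a := by
    intro g
    rw [← sum_fiberwise_of_maps_to hmaps, mul_sum]
    refine sum_congr rfl fun a ha => ?_
    obtain ⟨i, S⟩ := a
    simp only [hI, mem_sigma, mem_univ, true_and, mem_powersetCard] at ha
    have hi : i ∉ S := fun h => by simpa using ha.1 h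
    rw [sum_congr rfl (g := fun _ => g ⟨i, S⟩) fun σ hσ => by rw [(mem_filter.1 hσ).2],
      sum_const, nsmul_eq_mul]
    congr 2
    rw [hN, ← card_perm_fiber hl hi ha.2.symm]
    congr 1
    ext σ
    simp
  have hcard : (Fintype.card ι).factorial =
      N * (Fintype.card ι * (Fintype.card ι - 1).choose J.card) := by
    have h := key fun _ => 1
    simp only [sum_const, nsmul_eq_mul, mul_one] at h
    rw [card_univ, Fintype.card_perm, hI, card_sigma] at h
    simp only [card_powersetCard, card_erase_of_mem (mem_univ _), card_univ, sum_const,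
      smul_eq_mul] at h
    exact_mod_cast h
  have hJ : J.card + 1 ≤ Fintype.card ι := by
    rw [← card_insert_of_notMem hl]; exact card_le_univ _
  have hNval : N = J.card.factorial * (Fintype.card ι - J.card - 1).factorial := by
    have h1 := Nat.choose_mul_factorial_mul_factorial (n := Fintype.card ι - 1) (k := J.card)
      (by omega)
    have h2 : (Fintype.card ι).factorial = Fintype.card ι * (Fintype.card ι - 1).factorial :=
      (Nat.mul_factorial_pred (by omega)).symm
    have h3 : 0 < Fintype.card ι * (Fintype.card ι - 1).choose J.card :=
      Nat.mul_pos (by omega) (Nat.choose_pos (by omega))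
    rw [show Fintype.card ι - J.card - 1 = Fintype.card ι - 1 - J.card by omega]
    refine Nat.eq_of_mul_eq_mul_right h3 ?_
    rw [← hcard, h2, ← h1]
    ring
  have h := key fun a => (∏ x ∈ a.2, p x) * q a.1
  simp only [prod_map, Equiv.coe_toEmbedding] at h
  rw [h, hNval, hI, sum_sigma, dsym]
  push_cast
  congr 1
  refine sum_congr rfl fun i _ => ?_
  rw [esym, mul_sum]
  exact sum_congr rfl fun S _ => mul_comm _ _

end Permutations

lemma Psi_eq {b j : ℕ} (hj : j < b) (p q : Fin b → ℝ) :
    Psi b j p q = j.factorial * phi univ j p q := by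
  have hcard : (univ.filter fun s : Fin b => s.val < j).card = j := by
    rw [Fin.card_filter_val_lt]; omega
  have hsing : (univ.filter fun s : Fin b => s.val = j) = {⟨j, hj⟩} := by
    ext s; simp [Fin.ext_iff]
  have hl : (⟨j, hj⟩ : Fin b) ∉ univ.filter fun s : Fin b => s.val < j := by simp
  have h := sum_perm_eq_mul_dsym _ hl
  rw [hcard, Fintype.card_fin] at h
  simp only [Psi, hsing, prod_singleton, sum_add_distrib, h, phi]
  have : ((b - j - 1).factorial : ℝ) ≠ 0 := by positivity
  field_simp

/-! ### Maclaurin's inequality -/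

section Maclaurin

/-- The tangent line of `w ↦ w ^ (m + 1)` at `w₀`, in homogeneous form. -/
lemma pow_mul_sub_le (m : ℕ) {w w₀ : ℝ} (hw : 0 ≤ w) (hw₀ : 0 ≤ w₀) :
    w ^ m * ((m + 1) * w₀ - m * w) ≤ w₀ ^ (m + 1) := by
  rcases hw.eq_or_lt with rfl | hw
  · rcases m with _ | m
    · simp
    · simp; positivity
  have h := one_add_mul_le_pow (a := w₀ / w - 1) (by linarith [div_nonneg hw₀ hw.le]) (m + 1)
  have h2 : w ^ (m + 1) * (1 + ((m + 1 : ℕ) : ℝ) * (w₀ / w - 1)) ≤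
      w ^ (m + 1) * (1 + (w₀ / w - 1)) ^ (m + 1) := mul_le_mul_of_nonneg_left h (by positivity)
  rw [← mul_pow] at h2
  have e1 : w * (1 + (w₀ / w - 1)) = w₀ := by field_simp; ring
  have e2 : w ^ (m + 1) * (1 + ((m + 1 : ℕ) : ℝ) * (w₀ / w - 1)) =
      w ^ m * ((m + 1) * w₀ - m * w) := by push_cast; field_simp; ring
  rwa [e1, e2] at h2

/-- The maximum of `(A - B w) w ^ m`. -/
lemma sub_mul_pow_le (m : ℕ) (hm : 0 < m) {A B w : ℝ} (hA : 0 ≤ A) (hB : 0 < B) (hw : 0 ≤ w) :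
    (A - B * w) * w ^ m ≤ A ^ (m + 1) * m ^ m / (B ^ m * (m + 1) ^ (m + 1)) := by
  have hm' : (0 : ℝ) < m := by exact_mod_cast hm
  have h := pow_mul_sub_le m hw (w₀ := A * m / (B * (m + 1))) (by positivity)
  have h2 := mul_le_mul_of_nonneg_left h (by positivity : 0 ≤ B / m)
  refine le_trans (le_of_eq ?_) (h2.trans (le_of_eq ?_))
  · field_simp
  · rw [div_pow, mul_pow, mul_pow]
    field_simp
    ring

/-- Maclaurin's inequality between an elementary symmetric polynomial and the mean. -/
lemma esym_le {ι : Type*} [DecidableEq ι] (s : Finset ι) (k : ℕ) {x : ι → ℝ}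
    (hx : ∀ i ∈ s, 0 ≤ x i) : esym s k x ≤ s.card.choose k * ((∑ i ∈ s, x i) / s.card) ^ k := by
  induction s using Finset.induction_on generalizing k with
  | empty => rcases k with _ | k <;> simp [esym_empty_succ]
  | insert i s hi ih =>
    rcases k with _ | k
    · simp
    have hx' : ∀ h ∈ s, 0 ≤ x h := fun h hh => hx h (mem_insert_of_mem hh)
    have hxi : 0 ≤ x i := hx i (mem_insert_self i s)
    rcases s.eq_empty_or_nonempty with rfl | hne
    · rcases k with _ | k
      · simp [esym_one]
      · rw [esym_eq_zero (by simp)]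
        simp only [sum_insert hi, sum_empty, add_zero]
        positivity
    rw [esym_insert hi, card_insert_of_notMem hi, sum_insert hi]
    set n := s.card with hn
    set S := ∑ i ∈ s, x i with hS
    have hS0 : 0 ≤ S := sum_nonneg hx'
    have h1 := ih (k + 1) hx'
    have h2 := mul_le_mul_of_nonneg_left (ih k hx') hxi
    have hn0 : (0 : ℝ) < n := by exact_mod_cast card_pos.2 hne
    set w := S / n with hw
    have hw0 : 0 ≤ w := by positivity
    have hSw : S = n * w := by rw [hw]; field_simp
    have h3 := pow_mul_sub_le k hw0 (w₀ := (x i + S) / (n + 1)) (by positivity)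
    have c1 : ((n + 1).choose (k + 1) : ℝ) * (k + 1) = (n + 1) * n.choose k := by
      exact_mod_cast (Nat.add_one_mul_choose_eq n k).symm
    have c2 : ((n + 1).choose (k + 1) : ℝ) = n.choose k + n.choose (k + 1) := by
      exact_mod_cast Nat.choose_succ_succ n k
    have h4 := mul_le_mul_of_nonneg_left h3 (Nat.cast_nonneg (α := ℝ) ((n + 1).choose (k + 1)))
    have e : ((n + 1).choose (k + 1) : ℝ) * (w ^ k * ((k + 1) * ((x i + S) / (n + 1)) - k * w)) =
        n.choose (k + 1) * w ^ (k + 1) + x i * (n.choose k * w ^ k) := by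
      have : ((n + 1).choose (k + 1) : ℝ) * (k + 1) * ((x i + S) / (n + 1)) =
          n.choose k * (x i + n * w) := by rw [c1, hSw]; field_simp
      have e3 : ((n + 1).choose (k + 1) : ℝ) * k =
          (n + 1) * n.choose k - (n.choose k + n.choose (k + 1)) := by
        rw [← c2]; linarith
      calc _ = w ^ k * (((n + 1).choose (k + 1) : ℝ) * (k + 1) * ((x i + S) / (n + 1)) -
            ((n + 1).choose (k + 1) : ℝ) * k * w) := by ring
        _ = _ := by rw [this, e3]; ring
    push_cast
    linarith [e]

/-- Maclaurin's inequality applied to all entries but one. -/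
lemma esym_le_of_mem {ι : Type*} [DecidableEq ι] {s : Finset ι} {i : ι} (hi : i ∈ s) (k : ℕ)
    {x : ι → ℝ} (hx : ∀ i ∈ s, 0 ≤ x i) {n : ℕ} (hn : s.card = n + 1) {v : ℝ} (hv : x i ≤ v) :
    esym s (k + 1) x ≤ n.choose (k + 1) * ((∑ i ∈ s, x i - x i) / n) ^ (k + 1) +
      v * (n.choose k * ((∑ i ∈ s, x i - x i) / n) ^ k) := by
  have hc : (s.erase i).card = n := by rw [card_erase_of_mem hi, hn]; rfl
  have hx' : ∀ l ∈ s.erase i, 0 ≤ x l := fun l hl => hx l (mem_of_mem_erase hl)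
  have hsum : ∑ l ∈ s.erase i, x l = ∑ l ∈ s, x l - x i := by
    rw [← add_sum_erase s x hi]; ring
  have h1 := esym_le (s.erase i) (k + 1) hx'
  have h2 := esym_le (s.erase i) k hx'
  rw [hc, hsum] at h1 h2
  rw [esym_erase hi]
  have h3 : x i * esym (s.erase i) k x ≤ v * esym (s.erase i) k x :=
    mul_le_mul_of_nonneg_right hv (esym_nonneg k hx')
  have h4 := mul_le_mul_of_nonneg_left h2 ((hx i hi).trans hv)
  linarith

end Maclaurin

/-! ### Extremal pairs -/

section Extremal

variable {ι : Type*}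

/-- Pairs of probability distributions with entries bounded by `u`. -/
def cappedPairs [Fintype ι] (u : ι → ℝ) : Set ((ι → ℝ) × (ι → ℝ)) :=
  {z | z.1 ∈ stdSimplex ℝ ι ∧ z.2 ∈ stdSimplex ℝ ι ∧ ∀ i, z.1 i ≤ u i ∧ z.2 i ≤ u i}

lemma isCompact_cappedPairs [Fintype ι] (u : ι → ℝ) : IsCompact (cappedPairs u) := by
  have h1 : IsCompact (stdSimplex ℝ ι ×ˢ stdSimplex ℝ ι) :=
    (isCompact_stdSimplex ℝ ι).prod (isCompact_stdSimplex ℝ ι)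
  have h2 : IsClosed {z : (ι → ℝ) × (ι → ℝ) | ∀ i, z.1 i ≤ u i ∧ z.2 i ≤ u i} := by
    simp only [Set.ofPred_forall]
    refine isClosed_iInter fun i => ?_
    have e1 : IsClosed {z : (ι → ℝ) × (ι → ℝ) | z.1 i ≤ u i} :=
      isClosed_le (by fun_prop) continuous_const
    have e2 : IsClosed {z : (ι → ℝ) × (ι → ℝ) | z.2 i ≤ u i} :=
      isClosed_le (by fun_prop) continuous_const
    exact e1.inter e2
  convert h1.inter_right h2 using 1
  ext z
  simp [cappedPairs, and_assoc]

variable [DecidableEq ι]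

/-- Scale the difference of the entries at `i` and `h` by `c`, keeping their sum: `c = 1` changes
nothing, `c = 0` replaces both entries by their mean. -/
noncomputable def pairScale (i h : ι) (c : ℝ) (x : ι → ℝ) (l : ι) : ℝ :=
  if l = i then (x i + x h) / 2 + c * ((x i - x h) / 2)
  else if l = h then (x i + x h) / 2 - c * ((x i - x h) / 2) else x l

lemma pairScale_left (i h : ι) (c : ℝ) (x : ι → ℝ) :
    pairScale i h c x i = (x i + x h) / 2 + c * ((x i - x h) / 2) := by simp [pairScale]

lemma pairScale_right {i h : ι} (hih : i ≠ h) (c : ℝ) (x : ι → ℝ) :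
    pairScale i h c x h = (x i + x h) / 2 - c * ((x i - x h) / 2) := by
  simp [pairScale, hih.symm]

lemma pairScale_of_ne {i h l : ι} (h1 : l ≠ i) (h2 : l ≠ h) (c : ℝ) (x : ι → ℝ) :
    pairScale i h c x l = x l := by simp [pairScale, h1, h2]

lemma pairScale_one (i h : ι) (x : ι → ℝ) : pairScale i h 1 x = x := by
  ext l
  simp only [pairScale]
  split_ifs with h1 h2
  · subst h1; ring
  · subst h2; ring
  · rfl

variable [Fintype ι]

/-- `(p, q)` maximises `phi` on `K` and, among all maximisers, has the smallest sum of squares. -/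
def IsExtremal (j : ℕ) (K : Set ((ι → ℝ) × (ι → ℝ))) (p q : ι → ℝ) : Prop :=
  (p, q) ∈ K ∧ ∀ z ∈ K, phi univ j z.1 z.2 ≤ phi univ j p q ∧
    (phi univ j z.1 z.2 = phi univ j p q →
      ∑ i, (p i ^ 2 + q i ^ 2) ≤ ∑ i, (z.1 i ^ 2 + z.2 i ^ 2))

lemma continuous_phi (j : ℕ) :
    Continuous fun z : (ι → ℝ) × (ι → ℝ) => phi univ j z.1 z.2 := by
  unfold phi dsym esym
  fun_prop

lemma exists_isExtremal (j : ℕ) {K : Set ((ι → ℝ) × (ι → ℝ))} (hK : IsCompact K)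
    (hne : K.Nonempty) : ∃ p q, IsExtremal j K p q := by
  obtain ⟨z, hz, hmax⟩ := hK.exists_isMaxOn hne (continuous_phi j).continuousOn
  have hK' : IsCompact (K ∩ {y | phi univ j y.1 y.2 = phi univ j z.1 z.2}) :=
    hK.inter_right (isClosed_eq (continuous_phi j) continuous_const)
  have hcont : Continuous fun y : (ι → ℝ) × (ι → ℝ) => ∑ i, (y.1 i ^ 2 + y.2 i ^ 2) := by fun_prop
  obtain ⟨w, hw, hmin⟩ := hK'.exists_isMinOn ⟨z, hz, rfl⟩ hcont.continuousOn
  have hwz : phi univ j w.1 w.2 = phi univ j z.1 z.2 := hw.2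
  refine ⟨w.1, w.2, hw.1, fun y hy => ⟨hwz ▸ hmax hy, fun h => ?_⟩⟩
  exact hmin ⟨hy, h.trans hwz⟩

lemma univ_eq_insert_insert {i h : ι} (hih : i ≠ h) :
    (univ : Finset ι) = insert i (insert h ((univ.erase i).erase h)) := by
  rw [insert_erase (mem_erase.2 ⟨hih.symm, mem_univ _⟩), insert_erase (mem_univ _)]

lemma sum_pairScale {i h : ι} (hih : i ≠ h) (c : ℝ) (f : ℝ → ℝ) (x : ι → ℝ) :
    ∑ l, f (pairScale i h c x l) = f (pairScale i h c x i) + f (pairScale i h c x h) +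
      ∑ l ∈ (univ.erase i).erase h, f (x l) := by
  conv_lhs => rw [univ_eq_insert_insert hih]
  rw [sum_insert (by simp [hih]), sum_insert (by simp), add_assoc]
  congr 2
  refine sum_congr rfl fun l hl => ?_
  simp only [mem_erase, mem_univ, and_true] at hl
  rw [pairScale_of_ne hl.2 hl.1]

lemma sum_pairScale_id {i h : ι} (hih : i ≠ h) (c : ℝ) (x : ι → ℝ) :
    ∑ l, pairScale i h c x l = ∑ l, x l := by
  have h1 := sum_pairScale hih c id x
  have h2 := sum_pairScale hih 1 id x
  simp only [id, pairScale_one] at h1 h2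
  rw [h1, h2, pairScale_left, pairScale_right hih]
  ring

lemma sum_sq_pairScale {i h : ι} (hih : i ≠ h) (c : ℝ) (x : ι → ℝ) :
    ∑ l, pairScale i h c x l ^ 2 = ∑ l, x l ^ 2 + (c ^ 2 - 1) * ((x i - x h) ^ 2 / 2) := by
  have h1 := sum_pairScale hih c (· ^ 2) x
  have h2 := sum_pairScale hih 1 (· ^ 2) x
  simp only [pairScale_one] at h1 h2
  rw [h1, h2, pairScale_left, pairScale_right hih]
  ring

/-- Along the scaling of the entries at two symbols, `phi` is a constant minus `c ^ 2` times a
quadratic form with nonnegative coefficients in the two differences. -/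
lemma exists_phi_pairScale {i h : ι} (hih : i ≠ h) (k : ℕ) {p q : ι → ℝ} (hp : ∀ l, 0 ≤ p l)
    (hq : ∀ l, 0 ≤ q l) : ∃ A C₁ C₂ C₃ : ℝ, 0 ≤ C₁ ∧ 0 ≤ C₂ ∧ 0 ≤ C₃ ∧ ∀ c : ℝ,
      phi univ (k + 2) (pairScale i h c p) (pairScale i h c q) = A - c ^ 2 *
        (C₁ * (p i - p h) ^ 2 + C₂ * ((p i - p h) * (q i - q h)) + C₃ * (q i - q h) ^ 2) := by
  set s := (univ.erase i).erase h with hs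
  have hi : i ∉ s := by simp [hs]
  have hh : h ∉ s := by simp [hs]
  have hsame : ∀ (c : ℝ) (x : ι → ℝ), ∀ l ∈ s, pairScale i h c x l = x l := by
    intro c x l hl
    simp only [hs, mem_erase, mem_univ, and_true] at hl
    exact pairScale_of_ne hl.2 hl.1 c x
  refine ⟨phi s (k + 2) p q + (p i + p h) * (dsym s (k + 1) p q + esym s (k + 2) q)
      + (q i + q h) * (dsym s (k + 1) q p + esym s (k + 2) p)
      + (p i + p h) ^ 2 / 4 * dsym s k p q + (q i + q h) ^ 2 / 4 * dsym s k q p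
      + (p i + p h) * (q i + q h) / 2 * (esym s (k + 1) p + esym s (k + 1) q),
    dsym s k p q / 4, (esym s (k + 1) p + esym s (k + 1) q) / 2, dsym s k q p / 4, ?_, ?_, ?_, ?_⟩
  · have := dsym_nonneg (s := s) k (fun l _ => hp l) (fun l _ => hq l); positivity
  · have := esym_nonneg (s := s) (k + 1) (fun l _ => hp l)
    have := esym_nonneg (s := s) (k + 1) (fun l _ => hq l)
    positivity
  · have := dsym_nonneg (s := s) k (fun l _ => hq l) (fun l _ => hp l); positivity
  intro c
  rw [univ_eq_insert_insert hih, ← hs, phi_insert_insert hih hi hh, pairScale_left, pairScale_left,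
    pairScale_right hih, pairScale_right hih, phi, phi]
  simp only [dsym_congr (hsame c p) (hsame c q), dsym_congr (hsame c q) (hsame c p),
    esym_congr (hsame c p), esym_congr (hsame c q)]
  ring

/-- At an extremal pair, two symbols whose entries can be averaged are either equal or ordered
oppositely by the two vectors. -/
lemma IsExtremal.eq_of_average {k : ℕ} {K : Set ((ι → ℝ) × (ι → ℝ))} {p q : ι → ℝ}
    (hext : IsExtremal (k + 2) K p q) (hp : ∀ l, 0 ≤ p l) (hq : ∀ l, 0 ≤ q l) {i h : ι}
    (hih : i ≠ h) (hK : (pairScale i h 0 p, pairScale i h 0 q) ∈ K)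
    (hord : 0 ≤ (p i - p h) * (q i - q h)) : p i = p h ∧ q i = q h := by
  obtain ⟨A, C₁, C₂, C₃, h1, h2, h3, hphi⟩ := exists_phi_pairScale hih k hp hq
  have e0 := hphi 0
  have e1 := hphi 1
  rw [pairScale_one, pairScale_one] at e1
  obtain ⟨hle, hmin⟩ := hext.2 _ hK
  have hW : 0 ≤ C₁ * (p i - p h) ^ 2 + C₂ * ((p i - p h) * (q i - q h)) +
      C₃ * (q i - q h) ^ 2 := by positivity
  have hsq := hmin (by simp only at hle ⊢; linarith)
  simp only [sum_add_distrib, sum_sq_pairScale hih] at hsq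
  have hX : (p i - p h) ^ 2 = 0 := by nlinarith [sq_nonneg (p i - p h), sq_nonneg (q i - q h)]
  have hY : (q i - q h) ^ 2 = 0 := by nlinarith [sq_nonneg (p i - p h), sq_nonneg (q i - q h)]
  exact ⟨by linarith [pow_eq_zero_iff (two_ne_zero) |>.1 hX],
    by linarith [pow_eq_zero_iff (two_ne_zero) |>.1 hY]⟩

/-- At an extremal pair, two symbols have equal entries if the difference of their entries can
be both shrunk and stretched. -/
lemma IsExtremal.eq_of_scale {k : ℕ} {K : Set ((ι → ℝ) × (ι → ℝ))} {p q : ι → ℝ}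
    (hext : IsExtremal (k + 2) K p q) (hp : ∀ l, 0 ≤ p l) (hq : ∀ l, 0 ≤ q l) {i h : ι}
    (hih : i ≠ h) {t : ℝ} (ht : 0 < t) (ht1 : t < 1)
    (hK : (pairScale i h (1 - t) p, pairScale i h (1 - t) q) ∈ K)
    (hK' : (pairScale i h (1 + t) p, pairScale i h (1 + t) q) ∈ K) :
    p i = p h ∧ q i = q h := by
  obtain ⟨A, C₁, C₂, C₃, -, -, -, hphi⟩ := exists_phi_pairScale hih k hp hq
  have e0 := hphi (1 - t)
  have e1 := hphi 1
  have e2 := hphi (1 + t)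
  rw [pairScale_one, pairScale_one] at e1
  obtain ⟨hle, hmin⟩ := hext.2 _ hK
  obtain ⟨hle', -⟩ := hext.2 _ hK'
  simp only at hle hle' hmin
  generalize C₁ * (p i - p h) ^ 2 + C₂ * ((p i - p h) * (q i - q h)) + C₃ * (q i - q h) ^ 2 = W
    at e0 e1 e2
  have ht2 : 0 < 1 - (1 - t) ^ 2 := by nlinarith
  have ht3 : 0 < (1 + t) ^ 2 - 1 := by nlinarith
  have hW : 0 ≤ W := by
    by_contra! hneg
    linarith [mul_pos ht3 (neg_pos.2 hneg)]
  have hsq := hmin (le_antisymm hle (by linarith [mul_nonneg ht2.le hW]))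
  simp only [sum_add_distrib, sum_sq_pairScale hih] at hsq
  have hX : (p i - p h) ^ 2 = 0 := by nlinarith [sq_nonneg (p i - p h), sq_nonneg (q i - q h)]
  have hY : (q i - q h) ^ 2 = 0 := by nlinarith [sq_nonneg (p i - p h), sq_nonneg (q i - q h)]
  exact ⟨by linarith [pow_eq_zero_iff (two_ne_zero) |>.1 hX],
    by linarith [pow_eq_zero_iff (two_ne_zero) |>.1 hY]⟩

/-- At an extremal pair of capped distributions, two symbols with a common cap have equal entries
unless the two distributions order them strictly oppositely: averaging would not decrease `phi`, and
would decrease the sum of squares. -/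
lemma IsExtremal.opposite {k : ℕ} {u p q : ι → ℝ}
    (hext : IsExtremal (k + 2) (cappedPairs u) p q) {i h : ι} (hu : u i = u h)
    (hord : 0 ≤ (p i - p h) * (q i - q h)) : p i = p h ∧ q i = q h := by
  rcases eq_or_ne i h with rfl | hih
  · simp
  obtain ⟨⟨hp, hp1⟩, ⟨hq, hq1⟩, hcap⟩ := hext.1
  refine hext.eq_of_average hp hq hih ⟨⟨?_, ?_⟩, ⟨?_, ?_⟩, ?_⟩ hord
  · intro l
    simp only [pairScale]
    split_ifs
    · linarith [hp i, hp h]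
    · linarith [hp i, hp h]
    · exact hp l
  · rw [sum_pairScale_id hih]; exact hp1
  · intro l
    simp only [pairScale]
    split_ifs
    · linarith [hq i, hq h]
    · linarith [hq i, hq h]
    · exact hq l
  · rw [sum_pairScale_id hih]; exact hq1
  · intro l
    have := hcap i
    have := hcap h
    simp only at this
    simp only [pairScale]
    split_ifs with h1 h2
    · subst h1; constructor <;> linarith [(hcap l).1, (hcap l).2]
    · subst h2; constructor <;> linarith [(hcap i).1, (hcap i).2]
    · exact hcap l

/-- A difference of two entries strictly inside an interval can be scaled by all factors near
one. -/
lemma exists_scale_mem {x y u v : ℝ} (h : x ≠ y → (0 < x ∧ x < u) ∧ 0 < y ∧ y < v) (hx : 0 ≤ x)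
    (hy : 0 ≤ y) (hxu : x ≤ u) (hyv : y ≤ v) : ∃ T : ℝ, 0 < T ∧ ∀ c : ℝ, |c - 1| ≤ T →
      (0 ≤ (x + y) / 2 + c * ((x - y) / 2) ∧ (x + y) / 2 + c * ((x - y) / 2) ≤ u) ∧
      0 ≤ (x + y) / 2 - c * ((x - y) / 2) ∧ (x + y) / 2 - c * ((x - y) / 2) ≤ v := by
  rcases eq_or_ne x y with rfl | hxy
  · exact ⟨1, one_pos, fun c _ => ⟨⟨by linarith, by linarith⟩, by linarith, by linarith⟩⟩
  obtain ⟨⟨h1, h2⟩, h3, h4⟩ := h hxy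
  obtain ⟨m, hm, hm1, hm2, hm3, hm4⟩ : ∃ m : ℝ, 0 < m ∧ m ≤ x ∧ m ≤ u - x ∧ m ≤ y ∧ m ≤ v - y :=
    ⟨min (min x (u - x)) (min y (v - y)), by
      simp only [lt_min_iff]; exact ⟨⟨h1, by linarith⟩, h3, by linarith⟩,
      by simp, by simp, by simp, by simp⟩
  have hpos : 0 < |(x - y) / 2| := abs_pos.2 (by intro h0; apply hxy; linarith)
  refine ⟨m / |(x - y) / 2|, by positivity, fun c hc => ?_⟩
  have hb : |(c - 1) * ((x - y) / 2)| ≤ m := by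
    rw [abs_mul]
    exact (le_div_iff₀ hpos).1 hc
  obtain ⟨hb1, hb2⟩ := abs_le.1 hb
  refine ⟨⟨?_, ?_⟩, ?_, ?_⟩ <;> nlinarith

/-- At an extremal pair of capped distributions, two symbols have equal entries if all their entries
that differ lie strictly between `0` and the cap. -/
lemma IsExtremal.eq_of_interior {k : ℕ} {u p q : ι → ℝ}
    (hext : IsExtremal (k + 2) (cappedPairs u) p q) {i h : ι}
    (hpi : p i ≠ p h → (0 < p i ∧ p i < u i) ∧ 0 < p h ∧ p h < u h)
    (hqi : q i ≠ q h → (0 < q i ∧ q i < u i) ∧ 0 < q h ∧ q h < u h) :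
    p i = p h ∧ q i = q h := by
  rcases eq_or_ne i h with rfl | hih
  · simp
  obtain ⟨⟨hp, hp1⟩, ⟨hq, hq1⟩, hcap⟩ := hext.1
  simp only at hp hp1 hq hq1 hcap
  obtain ⟨T₁, hT₁, H₁⟩ := exists_scale_mem hpi (hp i) (hp h) (hcap i).1 (hcap h).1
  obtain ⟨T₂, hT₂, H₂⟩ := exists_scale_mem hqi (hq i) (hq h) (hcap i).2 (hcap h).2
  set t := min (1 / 2) (min T₁ T₂) with ht
  have ht0 : 0 < t := by positivity
  have ht1 : t ≤ 1 / 2 := min_le_left _ _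
  have ht2 : t ≤ T₁ := (min_le_right _ _).trans (min_le_left _ _)
  have ht3 : t ≤ T₂ := (min_le_right _ _).trans (min_le_right _ _)
  have key : ∀ c : ℝ, |c - 1| ≤ t → (pairScale i h c p, pairScale i h c q) ∈ cappedPairs u := by
    intro c hc
    have a1 := H₁ c (hc.trans ht2)
    have a2 := H₂ c (hc.trans ht3)
    refine ⟨⟨fun l => ?_, by simp only [sum_pairScale_id hih, hp1]⟩,
      ⟨fun l => ?_, by simp only [sum_pairScale_id hih, hq1]⟩, fun l => ?_⟩
    · simp only [pairScale]
      split_ifs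
      exacts [a1.1.1, a1.2.1, hp l]
    · simp only [pairScale]
      split_ifs
      exacts [a2.1.1, a2.2.1, hq l]
    · simp only [pairScale]
      split_ifs with h1 h2
      · subst h1; exact ⟨a1.1.2, a2.1.2⟩
      · subst h2; exact ⟨a1.2.2, a2.2.2⟩
      · exact hcap l
  exact hext.eq_of_scale hp hq hih ht0 (by linarith)
    (key _ (by rw [show 1 - t - 1 = -t by ring, abs_neg, abs_of_pos ht0]))
    (key _ (by rw [show 1 + t - 1 = t by ring, abs_of_pos ht0]))

end Extremal

/-! ### Pairs of vectors that are constant on three blocks -/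

section Blocks

/-- The elementary symmetric polynomial of degree `k` in `n₂` entries `β` and `n₁` entries `a`. -/
def bsym : ℕ → ℕ → ℕ → ℝ → ℝ → ℝ
  | 0, n₁, k, _, a => n₁.choose k * a ^ k
  | _ + 1, _, 0, _, _ => 1
  | n₂ + 1, n₁, k + 1, β, a => bsym n₂ n₁ (k + 1) β a + β * bsym n₂ n₁ k β a

/-- The value of `dsym` for `n₁` symbols with entries `(a, a')`, some symbols with entries `(β, 0)`,
whose number is `n₂`, and `n₃` symbols with entries `(0, γ)`. -/
noncomputable def bdsym (n₁ n₂ n₃ k : ℕ) (a β a' γ : ℝ) : ℝ :=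
  n₁ * a' * bsym n₂ (n₁ - 1) k β a + n₃ * γ * bsym n₂ n₁ k β a

/-- The value of `phi` in degree `k + 1` for one symbol with entries `(z, z')` and three blocks
of symbols with entries `(a, a')`, `(β, 0)` and `(0, γ)`. -/
noncomputable def bphi (n₁ n₂ n₃ k : ℕ) (z z' a β a' γ : ℝ) : ℝ :=
  (bdsym n₁ n₂ n₃ (k + 1) a β a' γ + z * bdsym n₁ n₂ n₃ k a β a' γ + z' * bsym n₂ n₁ (k + 1) β a) +
  (bdsym n₁ n₃ n₂ (k + 1) a' γ a β + z' * bdsym n₁ n₃ n₂ k a' γ a β + z * bsym n₃ n₁ (k + 1) γ a')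

lemma bsym_nonneg (n₂ n₁ k : ℕ) {β a : ℝ} (hβ : 0 ≤ β) (ha : 0 ≤ a) : 0 ≤ bsym n₂ n₁ k β a := by
  induction n₂ generalizing k with
  | zero => simp only [bsym]; positivity
  | succ n₂ ih =>
    rcases k with _ | k
    · simp [bsym]
    · have := ih k; have := ih (k + 1); simp only [bsym]; positivity

lemma bsym_mono (n₂ n₁ k : ℕ) {β a β' a' : ℝ} (hβ : 0 ≤ β) (ha : 0 ≤ a) (hβ' : β ≤ β')
    (ha' : a ≤ a') : bsym n₂ n₁ k β a ≤ bsym n₂ n₁ k β' a' := by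
  induction n₂ generalizing k with
  | zero => simp only [bsym]; gcongr
  | succ n₂ ih =>
    rcases k with _ | k
    · simp [bsym]
    · have := bsym_nonneg n₂ n₁ k hβ ha
      simp only [bsym]
      have h1 := ih k
      have h2 := ih (k + 1)
      have := hβ.trans hβ'
      gcongr

lemma bdsym_mono (n₁ n₂ n₃ k : ℕ) {a β c γ a' β' c' γ' : ℝ} (ha : 0 ≤ a) (hβ : 0 ≤ β)
    (hc : 0 ≤ c) (hγ : 0 ≤ γ) (ha' : a ≤ a') (hβ' : β ≤ β') (hc' : c ≤ c') (hγ' : γ ≤ γ') :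
    bdsym n₁ n₂ n₃ k a β c γ ≤ bdsym n₁ n₂ n₃ k a' β' c' γ' := by
  have h1 := bsym_nonneg n₂ (n₁ - 1) k hβ ha
  have h2 := bsym_nonneg n₂ n₁ k hβ ha
  have h3 := bsym_mono n₂ (n₁ - 1) k hβ ha hβ' ha'
  have h4 := bsym_mono n₂ n₁ k hβ ha hβ' ha'
  have := hc.trans hc'
  have := hγ.trans hγ'
  unfold bdsym
  gcongr

lemma bdsym_nonneg (n₁ n₂ n₃ k : ℕ) {a β c γ : ℝ} (ha : 0 ≤ a) (hβ : 0 ≤ β)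
    (hc : 0 ≤ c) (hγ : 0 ≤ γ) : 0 ≤ bdsym n₁ n₂ n₃ k a β c γ := by
  have h1 := bsym_nonneg n₂ (n₁ - 1) k hβ ha
  have h2 := bsym_nonneg n₂ n₁ k hβ ha
  unfold bdsym
  positivity

lemma bphi_mono (n₁ n₂ n₃ k : ℕ) {y z a β c γ y' z' a' β' c' γ' : ℝ} (hy : 0 ≤ y) (hz : 0 ≤ z)
    (ha : 0 ≤ a) (hβ : 0 ≤ β) (hc : 0 ≤ c) (hγ : 0 ≤ γ) (hy' : y ≤ y') (hz' : z ≤ z')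
    (ha' : a ≤ a') (hβ' : β ≤ β') (hc' : c ≤ c') (hγ' : γ ≤ γ') :
    bphi n₁ n₂ n₃ k y z a β c γ ≤ bphi n₁ n₂ n₃ k y' z' a' β' c' γ' := by
  have h1 := bdsym_mono n₁ n₂ n₃ (k + 1) ha hβ hc hγ ha' hβ' hc' hγ'
  have h2 := bdsym_mono n₁ n₂ n₃ k ha hβ hc hγ ha' hβ' hc' hγ'
  have h3 := bdsym_mono n₁ n₃ n₂ (k + 1) hc hγ ha hβ hc' hγ' ha' hβ'
  have h4 := bdsym_mono n₁ n₃ n₂ k hc hγ ha hβ hc' hγ' ha' hβ'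
  have h5 := bsym_mono n₂ n₁ (k + 1) hβ ha hβ' ha'
  have h6 := bsym_mono n₃ n₁ (k + 1) hγ hc hγ' hc'
  have h7 := bdsym_nonneg n₁ n₂ n₃ k ha hβ hc hγ
  have h8 := bdsym_nonneg n₁ n₃ n₂ k hc hγ ha hβ
  have h9 := bsym_nonneg n₂ n₁ (k + 1) hβ ha
  have h10 := bsym_nonneg n₃ n₁ (k + 1) hγ hc
  have := hy.trans hy'
  have := hz.trans hz'
  unfold bphi
  gcongr

variable {ι : Type*} [DecidableEq ι]

lemma esym_union_zero {s t : Finset ι} (k : ℕ) {x : ι → ℝ} (hst : Disjoint s t)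
    (ht : ∀ i ∈ t, x i = 0) : esym (s ∪ t) k x = esym s k x := by
  induction t using Finset.induction_on generalizing k with
  | empty => simp
  | insert i t hi ih =>
    have hst' := (disjoint_insert_right.1 hst)
    rcases k with _ | k
    · simp
    rw [union_insert, esym_insert (by simp [hi, hst'.1]), ht i (mem_insert_self i t), zero_mul,
      add_zero, ih _ hst'.2 fun l hl => ht l (mem_insert_of_mem hl)]

lemma esym_union_const {s t : Finset ι} (k : ℕ) {x : ι → ℝ} {a β : ℝ} (hst : Disjoint s t)
    (hs : ∀ i ∈ s, x i = a) (ht : ∀ i ∈ t, x i = β) :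
    esym (s ∪ t) k x = bsym t.card s.card k β a := by
  induction t using Finset.induction_on generalizing k with
  | empty => simp [bsym, esym_const k hs]
  | insert i t hi ih =>
    have hst' := (disjoint_insert_right.1 hst)
    have ih' := fun k => ih k hst'.2 fun l hl => ht l (mem_insert_of_mem hl)
    rw [card_insert_of_notMem hi]
    rcases k with _ | k
    · simp [bsym]
    rw [union_insert, esym_insert (by simp [hi, hst'.1]), ht i (mem_insert_self i t), ih', ih']
    rfl

/-- The vectors `p, q` have constant entries `(a, a')`, `(β, 0)`, `(0, γ)` on three disjoint blocks
with union `s`. -/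
structure IsBlocks (s A B C : Finset ι) (p q : ι → ℝ) (a β a' γ : ℝ) : Prop where
  union : s = A ∪ B ∪ C
  disjAB : Disjoint A B
  disjAC : Disjoint A C
  disjBC : Disjoint B C
  pA : ∀ i ∈ A, p i = a
  qA : ∀ i ∈ A, q i = a'
  pB : ∀ i ∈ B, p i = β
  qB : ∀ i ∈ B, q i = 0
  pC : ∀ i ∈ C, p i = 0
  qC : ∀ i ∈ C, q i = γ

variable {s A B C : Finset ι} {p q : ι → ℝ} {a β a' γ : ℝ}

lemma IsBlocks.symm (h : IsBlocks s A B C p q a β a' γ) : IsBlocks s A C B q p a' γ a β where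
  union := by rw [h.union, union_assoc, union_assoc, union_comm B C]
  disjAB := h.disjAC
  disjAC := h.disjAB
  disjBC := h.disjBC.symm
  pA := h.qA
  qA := h.pA
  pB := h.qC
  qB := h.pC
  pC := h.qB
  qC := h.pB

lemma IsBlocks.esym_eq (h : IsBlocks s A B C p q a β a' γ) (k : ℕ) :
    esym s k p = bsym B.card A.card k β a := by
  rw [h.union, esym_union_zero k (disjoint_union_left.2 ⟨h.disjAC, h.disjBC⟩) h.pC,
    esym_union_const k h.disjAB h.pA h.pB]

lemma IsBlocks.card_eq (h : IsBlocks s A B C p q a β a' γ) :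
    s.card = A.card + B.card + C.card := by
  rw [h.union, card_union_of_disjoint (disjoint_union_left.2 ⟨h.disjAC, h.disjBC⟩),
    card_union_of_disjoint h.disjAB]

lemma IsBlocks.sum_eq (h : IsBlocks s A B C p q a β a' γ) (f : ι → ℝ) :
    ∑ i ∈ s, f i = ∑ i ∈ A, f i + ∑ i ∈ B, f i + ∑ i ∈ C, f i := by
  rw [h.union, sum_union (disjoint_union_left.2 ⟨h.disjAC, h.disjBC⟩), sum_union h.disjAB]

lemma IsBlocks.sum_left (h : IsBlocks s A B C p q a β a' γ) :
    ∑ i ∈ s, p i = A.card * a + B.card * β := by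
  rw [h.sum_eq, sum_congr rfl h.pA, sum_congr rfl h.pB, sum_congr rfl h.pC]
  simp

lemma IsBlocks.dsym_eq (h : IsBlocks s A B C p q a β a' γ) (k : ℕ) :
    dsym s k p q = bdsym A.card B.card C.card k a β a' γ := by
  have hA : ∀ i ∈ A, q i * esym (s.erase i) k p = a' * bsym B.card (A.card - 1) k β a := by
    intro i hi
    have hB : IsBlocks (s.erase i) (A.erase i) B C p q a β a' γ :=
      { h with
        union := by
          rw [h.union, erase_union_distrib, erase_union_distrib,
            erase_eq_of_notMem (disjoint_left.1 h.disjAB hi),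
            erase_eq_of_notMem (disjoint_left.1 h.disjAC hi)]
        disjAB := h.disjAB.mono_left (erase_subset _ _)
        disjAC := h.disjAC.mono_left (erase_subset _ _)
        pA := fun l hl => h.pA l (mem_of_mem_erase hl)
        qA := fun l hl => h.qA l (mem_of_mem_erase hl) }
    rw [hB.esym_eq, h.qA i hi, card_erase_of_mem hi]
  have hC : ∀ i ∈ C, q i * esym (s.erase i) k p = γ * bsym B.card A.card k β a := by
    intro i hi
    have hB : IsBlocks (s.erase i) A B (C.erase i) p q a β a' γ :=
      { h with
        union := by
          rw [h.union, erase_union_distrib, erase_union_distrib,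
            erase_eq_of_notMem (disjoint_right.1 h.disjAC hi),
            erase_eq_of_notMem (disjoint_right.1 h.disjBC hi)]
        disjAC := h.disjAC.mono_right (erase_subset _ _)
        disjBC := h.disjBC.mono_right (erase_subset _ _)
        pC := fun l hl => h.pC l (mem_of_mem_erase hl)
        qC := fun l hl => h.qC l (mem_of_mem_erase hl) }
    rw [hB.esym_eq, h.qC i hi]
  have hB : ∀ i ∈ B, q i * esym (s.erase i) k p = 0 := fun i hi => by rw [h.qB i hi, zero_mul]
  rw [dsym, h.sum_eq, sum_congr rfl hA, sum_congr rfl hB, sum_congr rfl hC]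
  simp only [sum_const, nsmul_eq_mul, mul_zero, add_zero, bdsym]
  ring

lemma IsBlocks.phi_eq (h : IsBlocks s A B C p q a β a' γ) (k : ℕ) :
    phi s (k + 1) p q = bphi A.card B.card C.card k 0 0 a β a' γ := by
  rw [phi, h.dsym_eq, h.symm.dsym_eq, bphi]
  ring

lemma IsBlocks.phi_insert_eq (h : IsBlocks s A B C p q a β a' γ) {l : ι} (hl : l ∉ s) (k : ℕ) :
    phi (insert l s) (k + 1) p q = bphi A.card B.card C.card k (p l) (q l) a β a' γ := by
  rw [phi_insert hl, h.dsym_eq, h.dsym_eq, h.symm.dsym_eq, h.symm.dsym_eq, h.esym_eq,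
    h.symm.esym_eq, bphi]

/-- At an extremal pair of capped distributions, the symbols with a common cap that no entry
attains fall into three blocks with constant entries. -/
lemma IsExtremal.exists_isBlocks [Fintype ι] {k : ℕ} {u p q : ι → ℝ} {v : ℝ} {s : Finset ι}
    (hext : IsExtremal (k + 2) (cappedPairs u) p q) (hu : ∀ i ∈ s, u i = v)
    (hlt : ∀ i ∈ s, p i < v ∧ q i < v) (hpos : ∃ i ∈ s, 0 < p i ∨ 0 < q i) :
    ∃ A B C a β a' γ, 0 ≤ a ∧ 0 ≤ β ∧ 0 ≤ a' ∧ 0 ≤ γ ∧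
      (A = ∅ → a = 0 ∧ a' = 0) ∧ (B = ∅ → β = 0) ∧ (C = ∅ → γ = 0) ∧
      IsBlocks s A B C p q a β a' γ := by
  obtain ⟨⟨hp, hp1⟩, ⟨hq, hq1⟩, hcap⟩ := hext.1
  simp only at hp hp1 hq hq1 hcap
  have hint : ∀ i ∈ s, ∀ h ∈ s, (p i ≠ p h → 0 < p i ∧ 0 < p h) →
      (q i ≠ q h → 0 < q i ∧ 0 < q h) → p i = p h ∧ q i = q h := by
    intro i hi h hh h1 h2
    refine hext.eq_of_interior (fun h3 => ?_) (fun h3 => ?_)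
    · rw [hu i hi, hu h hh]
      exact ⟨⟨(h1 h3).1, (hlt i hi).1⟩, (h1 h3).2, (hlt h hh).1⟩
    · rw [hu i hi, hu h hh]
      exact ⟨⟨(h2 h3).1, (hlt i hi).2⟩, (h2 h3).2, (hlt h hh).2⟩
  have hnz : ∀ i ∈ s, 0 < p i ∨ 0 < q i := by
    intro i hi
    by_contra! h0
    have hp0 : p i = 0 := le_antisymm h0.1 (hp i)
    have hq0 : q i = 0 := le_antisymm h0.2 (hq i)
    obtain ⟨h, hh, h1⟩ := hpos
    have h2 := hext.opposite (i := h) (h := i) (by rw [hu h hh, hu i hi])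
      (by rw [hp0, hq0]; simpa using mul_nonneg (hp h) (hq h))
    rcases h1 with h1 | h1
    · linarith
    · linarith
  have hconst : ∀ (D : Finset ι) (x : ι → ℝ), (∀ i, 0 ≤ x i) →
      (∀ i ∈ D, ∀ h ∈ D, x i = x h) → ∃ c, 0 ≤ c ∧ (D = ∅ → c = 0) ∧ ∀ i ∈ D, x i = c := by
    intro D x hx hD
    rcases D.eq_empty_or_nonempty with rfl | ⟨i, hi⟩
    · exact ⟨0, le_rfl, fun _ => rfl, by simp⟩
    · exact ⟨x i, hx i, fun h => absurd hi (by simp [h]), fun h hh => hD h hh i hi⟩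
  set A := s.filter fun i => 0 < p i ∧ 0 < q i with hA
  set B := s.filter fun i => 0 < p i ∧ ¬ 0 < q i with hB
  set C := s.filter fun i => ¬ 0 < p i with hC
  have hAeq : ∀ i ∈ A, ∀ h ∈ A, p i = p h ∧ q i = q h := by
    intro i hi h hh
    simp only [hA, mem_filter] at hi hh
    exact hint i hi.1 h hh.1 (fun _ => ⟨hi.2.1, hh.2.1⟩) fun _ => ⟨hi.2.2, hh.2.2⟩
  have hqB : ∀ i ∈ B, q i = 0 := fun i hi => le_antisymm (not_lt.1 (mem_filter.1 hi).2.2) (hq i)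
  have hpC : ∀ i ∈ C, p i = 0 := fun i hi => le_antisymm (not_lt.1 (mem_filter.1 hi).2) (hp i)
  have hBeq : ∀ i ∈ B, ∀ h ∈ B, p i = p h := by
    intro i hi h hh
    refine (hint i (mem_filter.1 hi).1 h (mem_filter.1 hh).1
      (fun _ => ⟨(mem_filter.1 hi).2.1, (mem_filter.1 hh).2.1⟩) fun h1 => ?_).1
    exact absurd (by rw [hqB i hi, hqB h hh]) h1
  have hCeq : ∀ i ∈ C, ∀ h ∈ C, q i = q h := by
    intro i hi h hh
    have h1 := (hnz i (mem_filter.1 hi).1).resolve_left (mem_filter.1 hi).2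
    have h2 := (hnz h (mem_filter.1 hh).1).resolve_left (mem_filter.1 hh).2
    exact (hint i (mem_filter.1 hi).1 h (mem_filter.1 hh).1
      (fun h3 => absurd (by rw [hpC i hi, hpC h hh]) h3) fun _ => ⟨h1, h2⟩).2
  obtain ⟨a, ha, ha0, hpA⟩ := hconst A p hp fun i hi h hh => (hAeq i hi h hh).1
  obtain ⟨a', ha', ha0', hqA⟩ := hconst A q hq fun i hi h hh => (hAeq i hi h hh).2
  obtain ⟨β, hβ, hβ0, hpB⟩ := hconst B p hp hBeq
  obtain ⟨γ, hγ, hγ0, hqC⟩ := hconst C q hq hCeq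
  refine ⟨A, B, C, a, β, a', γ, ha, hβ, ha', hγ, fun h => ⟨ha0 h, ha0' h⟩, hβ0, hγ0, ?_⟩
  refine ⟨?_, ?_, ?_, ?_, hpA, hqA, hpB, hqB, hpC, hqC⟩
  · ext i
    simp only [hA, hB, hC, mem_union, mem_filter]
    tauto
  · rw [disjoint_left]; intro i h1 h2
    exact (mem_filter.1 h2).2.2 (mem_filter.1 h1).2.2
  · rw [disjoint_left]; intro i h1 h2
    exact (mem_filter.1 h2).2 (mem_filter.1 h1).2.1
  · rw [disjoint_left]; intro i h1 h2
    exact (mem_filter.1 h2).2 (mem_filter.1 h1).2.1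

end Blocks

/-! ### Branch and bound over boxes -/

section Covering

/-- A box is a list of intervals `[lo, lo + width]`, given as the pairs `(lo, width)`. The first one
of width `m` is halved; `m` is meant to be the largest width. -/
def halve (m : ℕ) : List (ℕ × ℕ) → List (ℕ × ℕ) × List (ℕ × ℕ)
  | [] => ([], [])
  | c :: l =>
    if c.2 = m then ((c.1, c.2 / 2) :: l, (c.1 + c.2 / 2, c.2 - c.2 / 2) :: l)
    else (c :: (halve m l).1, c :: (halve m l).2)

/-- The largest width of the intervals of a box. -/
def maxWidth : List (ℕ × ℕ) → ℕ
  | [] => 0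
  | c :: l => max c.2 (maxWidth l)

/-- Branch and bound: the box passes the test, or it can be cut, at most `fuel` times in a row,
into boxes that pass it. -/
def covers (test : List (ℕ × ℕ) → Bool) : ℕ → List (ℕ × ℕ) → Bool
  | 0, c => test c
  | fuel + 1, c => test c ||
    (covers test fuel (halve (maxWidth c) c).1 && covers test fuel (halve (maxWidth c) c).2)

/-- The point `v` lies in the box `c`. -/
def InBox (c : List (ℕ × ℕ)) (v : List ℝ) : Prop :=
  List.Forall₂ (fun (i : ℕ × ℕ) (x : ℝ) => (i.1 : ℝ) ≤ x ∧ x ≤ (i.1 : ℝ) + i.2) c v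

lemma InBox.halve (m : ℕ) {c : List (ℕ × ℕ)} {v : List ℝ} (h : InBox c v) :
    InBox (halve m c).1 v ∨ InBox (halve m c).2 v := by
  unfold InBox at *
  induction h with
  | nil => left; exact List.Forall₂.nil
  | @cons i x c v hix hcv ih =>
    simp only [_root_.halve]
    split_ifs with hm
    · have hcast : ((i.2 - i.2 / 2 : ℕ) : ℝ) = i.2 - (i.2 / 2 : ℕ) :=
        Nat.cast_sub (Nat.div_le_self _ _)
      rcases le_total x (i.1 + (i.2 / 2 : ℕ)) with h1 | h1
      · left; exact List.Forall₂.cons ⟨hix.1, h1⟩ hcv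
      · right
        refine List.Forall₂.cons ⟨by push_cast at h1 ⊢; exact h1, ?_⟩ hcv
        rw [hcast]
        push_cast
        linarith [hix.2]
    · rcases ih with ih | ih
      · left; exact List.Forall₂.cons hix ih
      · right; exact List.Forall₂.cons hix ih

lemma covers_sound {test : List (ℕ × ℕ) → Bool} {P : List ℝ → Prop}
    (htest : ∀ c v, test c = true → InBox c v → P v) (fuel : ℕ) {c : List (ℕ × ℕ)} {v : List ℝ}
    (hc : covers test fuel c = true) (hv : InBox c v) : P v := by
  induction fuel generalizing c with
  | zero => exact htest c v hc hv
  | succ fuel ih =>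
    simp only [covers, Bool.or_eq_true, Bool.and_eq_true] at hc
    rcases hc with hc | ⟨h1, h2⟩
    · exact htest c v hc hv
    · rcases hv.halve (maxWidth c) with h | h
      exacts [ih h1 h, ih h2 h]

/-- `bsym` on natural numbers. -/
def bsymN : ℕ → ℕ → ℕ → ℕ → ℕ → ℕ
  | 0, n₁, k, _, a => n₁.choose k * a ^ k
  | _ + 1, _, 0, _, _ => 1
  | n₂ + 1, n₁, k + 1, β, a => bsymN n₂ n₁ (k + 1) β a + β * bsymN n₂ n₁ k β a

/-- `bdsym` on natural numbers. -/
def bdsymN (n₁ n₂ n₃ k a β a' γ : ℕ) : ℕ :=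
  n₁ * a' * bsymN n₂ (n₁ - 1) k β a + n₃ * γ * bsymN n₂ n₁ k β a

/-- `bphi` on natural numbers. -/
def bphiN (n₁ n₂ n₃ k z z' a β a' γ : ℕ) : ℕ :=
  (bdsymN n₁ n₂ n₃ (k + 1) a β a' γ + z * bdsymN n₁ n₂ n₃ k a β a' γ +
    z' * bsymN n₂ n₁ (k + 1) β a) +
  (bdsymN n₁ n₃ n₂ (k + 1) a' γ a β + z' * bdsymN n₁ n₃ n₂ k a' γ a β +
    z * bsymN n₃ n₁ (k + 1) γ a')

lemma cast_bsymN (n₂ n₁ k β a : ℕ) : (bsymN n₂ n₁ k β a : ℝ) = bsym n₂ n₁ k β a := by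
  induction n₂ generalizing k with
  | zero => simp [bsym, bsymN]
  | succ n₂ ih =>
    rcases k with _ | k
    · simp [bsym, bsymN]
    · simp [bsym, bsymN, ih]

lemma cast_bphiN (n₁ n₂ n₃ k z z' a β a' γ : ℕ) :
    (bphiN n₁ n₂ n₃ k z z' a β a' γ : ℝ) = bphi n₁ n₂ n₃ k z z' a β a' γ := by
  simp only [bphiN, bdsymN, bphi, bdsym]
  push_cast
  simp only [cast_bsymN]

lemma bsym_mul (n₂ n₁ k : ℕ) (β a c : ℝ) :
    bsym n₂ n₁ k (c * β) (c * a) = c ^ k * bsym n₂ n₁ k β a := by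
  induction n₂ generalizing k with
  | zero => simp only [bsym]; ring
  | succ n₂ ih =>
    rcases k with _ | k
    · simp [bsym]
    · simp only [bsym, ih]; ring

lemma bphi_mul (n₁ n₂ n₃ k : ℕ) (z z' a β a' γ c : ℝ) :
    bphi n₁ n₂ n₃ k (c * z) (c * z') (c * a) (c * β) (c * a') (c * γ) =
      c ^ (k + 2) * bphi n₁ n₂ n₃ k z z' a β a' γ := by
  simp only [bphi, bdsym, bsym_mul]
  ring

/-- The data of a bound for `bphi`: the numbers of symbols in the blocks, the degree, the common
denominator `N` of the coordinates, an upper bound `cap` for `β` and `γ`, and the bound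
`target` to be proved; a pair of natural numbers stands for their quotient. -/
structure BlockBound where
  n₁ : ℕ
  n₂ : ℕ
  n₃ : ℕ
  k : ℕ
  N : ℕ
  cap : ℕ × ℕ
  target : ℕ × ℕ

/-- The test of a box for the coordinates `N z`, `N z'`, `N x`, `N y`, where the special symbol has
the entries `(z, z')`, and `x` and `y` are the shares of the first block in the remaining
masses `1 - z` and `1 - z'`. The box passes if it violates one of the bounds for `β` and `γ`, or if
`bphi` is at most the target when every argument is replaced by its maximum over the box. -/
def BlockBound.test (D : BlockBound) : List (ℕ × ℕ) → Bool
  | [P, Q, X, Y] =>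
    (D.n₂ != 0 && Nat.blt (D.cap.1 * (D.N * D.N * D.n₂))
      (D.cap.2 * ((D.N - (P.1 + P.2)) * (D.N - (X.1 + X.2))))) ||
    ((D.n₃ != 0 && Nat.blt (D.cap.1 * (D.N * D.N * D.n₃))
      (D.cap.2 * ((D.N - (Q.1 + Q.2)) * (D.N - (Y.1 + Y.2))))) ||
    Nat.ble (D.target.2 * bphiN D.n₁ D.n₂ D.n₃ D.k
        ((P.1 + P.2) * (D.N * (max 1 D.n₁ * max 1 D.n₂ * max 1 D.n₃)))
        ((Q.1 + Q.2) * (D.N * (max 1 D.n₁ * max 1 D.n₂ * max 1 D.n₃)))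
        ((D.N - P.1) * (X.1 + X.2) * (max 1 D.n₂ * max 1 D.n₃))
        ((D.N - P.1) * (D.N - X.1) * (max 1 D.n₁ * max 1 D.n₃))
        ((D.N - Q.1) * (Y.1 + Y.2) * (max 1 D.n₂ * max 1 D.n₃))
        ((D.N - Q.1) * (D.N - Y.1) * (max 1 D.n₁ * max 1 D.n₂)))
      (D.target.1 * (D.N * D.N * (max 1 D.n₁ * max 1 D.n₂ * max 1 D.n₃)) ^ (D.k + 2)))
  | _ => false

/-- The scaled bound for the common value of the entries of a block. -/
lemma scaled_block_le {n : ℕ} {N a μ ν s t : ℝ} (h0 : n = 0 → a = 0) (h : n * a = μ * ν)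
    (hN : 0 ≤ N) (hμ : 0 ≤ μ) (hν : 0 ≤ ν) (hs : N * μ ≤ s) (ht : N * ν ≤ t) :
    N * N * ((max 1 n : ℕ) : ℝ) * a ≤ s * t := by
  have hst : N * μ * (N * ν) ≤ s * t :=
    mul_le_mul hs ht (by positivity) ((mul_nonneg hN hμ).trans hs)
  rcases Nat.eq_zero_or_pos n with hn | hn
  · rw [h0 hn, mul_zero]
    exact (by positivity : 0 ≤ N * μ * (N * ν)).trans hst
  · rw [max_eq_right hn]
    calc N * N * (n : ℝ) * a = N * N * (n * a) := by ring
      _ = N * μ * (N * ν) := by rw [h]; ring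
      _ ≤ _ := hst

/-- Soundness of the test of a box. -/
lemma BlockBound.test_sound (D : BlockBound) (hN : 0 < D.N) {z z' x y a β a' γ : ℝ}
    (hz : 0 ≤ z) (hz1 : z ≤ 1) (hz' : 0 ≤ z') (hz1' : z' ≤ 1) (hx : 0 ≤ x) (hx1 : x ≤ 1)
    (hy : 0 ≤ y) (hy1 : y ≤ 1) (ha : 0 ≤ a) (hβ : 0 ≤ β) (ha' : 0 ≤ a') (hγ : 0 ≤ γ)
    (h₁ : D.n₁ = 0 → a = 0 ∧ a' = 0) (h₂ : D.n₂ = 0 → β = 0) (h₃ : D.n₃ = 0 → γ = 0)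
    (ea : D.n₁ * a = (1 - z) * x) (eβ : D.n₂ * β = (1 - z) * (1 - x))
    (ea' : D.n₁ * a' = (1 - z') * y) (eγ : D.n₃ * γ = (1 - z') * (1 - y))
    (capβ : β * D.cap.2 ≤ D.cap.1) (capγ : γ * D.cap.2 ≤ D.cap.1)
    (c : List (ℕ × ℕ)) (v : List ℝ)
    (hc : D.test c = true) (hv : InBox c v)
    (hvz : v = [D.N * z, D.N * z', D.N * x, D.N * y]) :
    D.target.2 * bphi D.n₁ D.n₂ D.n₃ D.k z z' a β a' γ ≤ D.target.1 := by
  subst hvz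
  obtain ⟨n₁, n₂, n₃, k, N, cap, target⟩ := D
  simp only at *
  have hNr : (0 : ℝ) < N := by exact_mod_cast hN
  unfold InBox at hv
  cases hv with
  | cons hP hv =>
  cases hv with
  | cons hQ hv =>
  cases hv with
  | cons hX hv =>
  cases hv with
  | cons hY hv =>
  cases hv with
  | nil =>
  rename_i P Q X Y
  obtain ⟨P, dP⟩ := P
  obtain ⟨Q, dQ⟩ := Q
  obtain ⟨X, dX⟩ := X
  obtain ⟨Y, dY⟩ := Y
  simp only at hP hQ hX hY
  have hPN : P ≤ N := by
    have : (P : ℝ) ≤ N := hP.1.trans (mul_le_of_le_one_right hNr.le hz1)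
    exact_mod_cast this
  have hQN : Q ≤ N := by
    have : (Q : ℝ) ≤ N := hQ.1.trans (mul_le_of_le_one_right hNr.le hz1')
    exact_mod_cast this
  have hXN : X ≤ N := by
    have : (X : ℝ) ≤ N := hX.1.trans (mul_le_of_le_one_right hNr.le hx1)
    exact_mod_cast this
  have hYN : Y ≤ N := by
    have : (Y : ℝ) ≤ N := hY.1.trans (mul_le_of_le_one_right hNr.le hy1)
    exact_mod_cast this
  have hsub : ∀ (A B : ℕ) (t : ℝ), N * t ≤ A + B → 0 ≤ t → t ≤ 1 →
      ((N - (A + B) : ℕ) : ℝ) ≤ N * (1 - t) := by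
    intro A B t h1 h2 h3
    rcases le_total (A + B) N with h | h
    · rw [Nat.cast_sub h]; push_cast; linarith
    · rw [Nat.sub_eq_zero_of_le h]
      have : 0 ≤ (N : ℝ) * (1 - t) := mul_nonneg hNr.le (by linarith)
      simpa using this
  have z1 : (0 : ℝ) ≤ 1 - z := by linarith
  have z1' : (0 : ℝ) ≤ 1 - z' := by linarith
  have x1 : (0 : ℝ) ≤ 1 - x := by linarith
  have y1 : (0 : ℝ) ≤ 1 - y := by linarith
  simp only [BlockBound.test, Bool.or_eq_true, Bool.and_eq_true, bne_iff_ne, ne_eq,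
    Nat.blt_eq, Nat.ble_eq] at hc
  rcases hc with ⟨-, hc⟩ | ⟨-, hc⟩ | hc
  · exfalso
    have hc' : (cap.1 : ℝ) * (N * N * n₂) <
        cap.2 * (((N - (P + dP) : ℕ) : ℝ) * ((N - (X + dX) : ℕ) : ℝ)) := by exact_mod_cast hc
    have h1 := mul_le_mul (hsub P dP z hP.2 hz hz1) (hsub X dX x hX.2 hx hx1) (Nat.cast_nonneg _)
      (mul_nonneg hNr.le z1)
    have h2 : (N * (1 - z)) * (N * (1 - x)) = N * N * (n₂ * β) := by rw [eβ]; ring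
    have h3 := mul_le_mul_of_nonneg_left (h1.trans_eq h2) (Nat.cast_nonneg (α := ℝ) cap.2)
    have h4 := mul_le_mul_of_nonneg_left capβ
      (by positivity : (0 : ℝ) ≤ N * N * n₂)
    linarith
  · exfalso
    have hc' : (cap.1 : ℝ) * (N * N * n₃) <
        cap.2 * (((N - (Q + dQ) : ℕ) : ℝ) * ((N - (Y + dY) : ℕ) : ℝ)) := by exact_mod_cast hc
    have h1 := mul_le_mul (hsub Q dQ z' hQ.2 hz' hz1') (hsub Y dY y hY.2 hy hy1)
      (Nat.cast_nonneg _) (mul_nonneg hNr.le z1')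
    have h2 : (N * (1 - z')) * (N * (1 - y)) = N * N * (n₃ * γ) := by rw [eγ]; ring
    have h3 := mul_le_mul_of_nonneg_left (h1.trans_eq h2) (Nat.cast_nonneg (α := ℝ) cap.2)
    have h4 := mul_le_mul_of_nonneg_left capγ
      (by positivity : (0 : ℝ) ≤ N * N * n₃)
    linarith
  · set m₁ := max 1 n₁
    set m₂ := max 1 n₂
    set m₃ := max 1 n₃
    have hm₁ : (1 : ℝ) ≤ m₁ := by exact_mod_cast le_max_left 1 n₁
    have hm₂ : (1 : ℝ) ≤ m₂ := by exact_mod_cast le_max_left 1 n₂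
    have hm₃ : (1 : ℝ) ≤ m₃ := by exact_mod_cast le_max_left 1 n₃
    have hE : (0 : ℝ) < N * N * (m₁ * m₂ * m₃) := by positivity
    set E : ℝ := N * N * (m₁ * m₂ * m₃) with hEdef
    have hNz : N * (1 - z) ≤ N - P := by linarith [hP.1]
    have hNz' : N * (1 - z') ≤ N - Q := by linarith [hQ.1]
    have hNx : N * (1 - x) ≤ N - X := by linarith [hX.1]
    have hNy : N * (1 - y) ≤ N - Y := by linarith [hY.1]
    have ba := scaled_block_le (fun h => (h₁ h).1) ea hNr.le z1 hx hNz hX.2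
    have bβ := scaled_block_le h₂ eβ hNr.le z1 x1 hNz hNx
    have ba' := scaled_block_le (fun h => (h₁ h).2) ea' hNr.le z1' hy hNz' hY.2
    have bγ := scaled_block_le h₃ eγ hNr.le z1' y1 hNz' hNy
    have key := bphi_mono n₁ n₂ n₃ k (y := E * z) (z := E * z') (a := E * a) (β := E * β)
      (c := E * a') (γ := E * γ)
      (y' := ((P + dP) * (N * (m₁ * m₂ * m₃)) : ℕ)) (z' := ((Q + dQ) * (N * (m₁ * m₂ * m₃)) : ℕ))
      (a' := ((N - P) * (X + dX) * (m₂ * m₃) : ℕ)) (β' := ((N - P) * (N - X) * (m₁ * m₃) : ℕ))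
      (c' := ((N - Q) * (Y + dY) * (m₂ * m₃) : ℕ)) (γ' := ((N - Q) * (N - Y) * (m₁ * m₂) : ℕ))
      (by positivity) (by positivity) (by positivity) (by positivity) (by positivity)
      (by positivity) ?_ ?_ ?_ ?_ ?_ ?_
    · rw [bphi_mul, ← cast_bphiN] at key
      have hc' : (target.2 : ℝ) * bphiN n₁ n₂ n₃ k ((P + dP) * (N * (m₁ * m₂ * m₃)))
          ((Q + dQ) * (N * (m₁ * m₂ * m₃))) ((N - P) * (X + dX) * (m₂ * m₃))
          ((N - P) * (N - X) * (m₁ * m₃)) ((N - Q) * (Y + dY) * (m₂ * m₃))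
          ((N - Q) * (N - Y) * (m₁ * m₂)) ≤ target.1 * E ^ (k + 2) := by
        rw [hEdef]
        exact_mod_cast hc
      have h1 := mul_le_mul_of_nonneg_left key (Nat.cast_nonneg (α := ℝ) target.2)
      refine le_of_mul_le_mul_left ?_ (pow_pos hE (k + 2))
      linarith
    · push_cast
      have := mul_le_mul_of_nonneg_left hP.2 (by positivity : (0 : ℝ) ≤ N * (m₁ * m₂ * m₃))
      rw [hEdef]
      linarith
    · push_cast
      have := mul_le_mul_of_nonneg_left hQ.2 (by positivity : (0 : ℝ) ≤ N * (m₁ * m₂ * m₃))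
      rw [hEdef]
      linarith
    · push_cast [Nat.cast_sub hPN]
      have := mul_le_mul_of_nonneg_left ba (by positivity : (0 : ℝ) ≤ m₂ * m₃)
      rw [hEdef]
      linarith
    · push_cast [Nat.cast_sub hPN, Nat.cast_sub hXN]
      have := mul_le_mul_of_nonneg_left bβ (by positivity : (0 : ℝ) ≤ m₁ * m₃)
      rw [hEdef]
      linarith
    · push_cast [Nat.cast_sub hQN]
      have := mul_le_mul_of_nonneg_left ba' (by positivity : (0 : ℝ) ≤ m₂ * m₃)
      rw [hEdef]
      linarith
    · push_cast [Nat.cast_sub hQN, Nat.cast_sub hYN]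
      have := mul_le_mul_of_nonneg_left bγ (by positivity : (0 : ℝ) ≤ m₁ * m₂)
      rw [hEdef]
      linarith

end Covering

/-! ### Bounds in terms of the largest entry -/

section OneSided

variable {ι : Type*} [Fintype ι]

lemma le_one_of_mem_stdSimplex {p : ι → ℝ} (hp : p ∈ stdSimplex ℝ ι) (i : ι) : p i ≤ 1 :=
  hp.2 ▸ single_le_sum (fun l _ => hp.1 l) (mem_univ i)

variable [DecidableEq ι]

lemma univ_erase_eq_insert {i h : ι} (hih : i ≠ h) :
    (univ.erase i : Finset ι) = insert h ((univ.erase i).erase h) := by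
  rw [insert_erase (mem_erase.2 ⟨hih.symm, mem_univ _⟩)]

lemma esym_univ_erase {i h : ι} (hih : i ≠ h) (k : ℕ) (x : ι → ℝ) :
    esym (univ.erase i) (k + 1) x = esym ((univ.erase i).erase h) (k + 1) x +
      x h * esym ((univ.erase i).erase h) k x := by
  conv_lhs => rw [univ_erase_eq_insert hih]
  exact esym_insert (notMem_erase _ _) k x

lemma card_erase_erase {n : ℕ} (hn : Fintype.card ι = n + 2) {i h : ι} (hih : i ≠ h) :
    ((univ.erase i).erase h : Finset ι).card = n := by
  rw [card_erase_of_mem (mem_erase.2 ⟨hih.symm, mem_univ _⟩), card_erase_of_mem (mem_univ _),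
    card_univ, hn]
  rfl

lemma sum_erase_erase {i h : ι} (hih : i ≠ h) (x : ι → ℝ) :
    ∑ l ∈ (univ.erase i).erase h, x l = ∑ l, x l - x i - x h := by
  rw [← add_sum_erase univ x (mem_univ i), ← add_sum_erase (univ.erase i) x
    (mem_erase.2 ⟨hih.symm, mem_univ h⟩)]
  ring

/-- If every entry of `p` is at most `1 - δ`, then the average, with weights `p`, of the
elementary symmetric polynomials of the entries of `q` without one of them is at most the value for
weights `1 - δ` and `δ` on the two largest ones. The other `n` entries of `q` may be replaced by
their mean `w`. -/
lemma exists_dsym_le {n : ℕ} (hn : Fintype.card ι = n + 2) (hn0 : 0 < n) (k : ℕ) {p q : ι → ℝ}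
    (hp : p ∈ stdSimplex ℝ ι) (hq : q ∈ stdSimplex ℝ ι) {δ : ℝ} (hδ : δ ≤ 1 / 2)
    (hpδ : ∀ i, p i ≤ 1 - δ) : ∃ w : ℝ, 0 ≤ w ∧ dsym univ (k + 1) q p ≤
      (1 - δ) * (1 - n * w) * (n.choose k * w ^ k) + n.choose (k + 1) * w ^ (k + 1) := by
  have : Nonempty ι := Fintype.card_pos_iff.1 (by omega)
  have hn0' : (0 : ℝ) < n := by exact_mod_cast hn0
  set E : ι → ℝ := fun i => esym (univ.erase i) (k + 1) q with hE
  obtain ⟨a, -, ha⟩ := exists_max_image univ E univ_nonempty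
  have hne : (univ.erase a : Finset ι).Nonempty := by
    rw [← card_pos, card_erase_of_mem (mem_univ _), card_univ, hn]; omega
  obtain ⟨c, hc, hmax⟩ := exists_max_image (univ.erase a) E hne
  have hac : a ≠ c := (mem_erase.1 hc).1.symm
  set s := (univ.erase a).erase c with hs
  have hT : dsym univ (k + 1) q p ≤ p a * E a + (1 - p a) * E c := by
    have h1 : ∑ i ∈ univ.erase a, p i = 1 - p a := by
      rw [← hp.2, ← add_sum_erase univ p (mem_univ a)]; ring
    rw [dsym, ← add_sum_erase univ _ (mem_univ a), ← h1, sum_mul]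
    gcongr with i hi
    · exact hp.1 i
    · exact hmax i hi
  have hT2 : p a * E a + (1 - p a) * E c ≤ (1 - δ) * E a + δ * E c := by
    nlinarith [mul_nonneg (sub_nonneg.2 (hpδ a)) (sub_nonneg.2 (ha c (mem_univ c)))]
  have ea : E a = esym s (k + 1) q + q c * esym s k q := esym_univ_erase hac k q
  have ec : E c = esym s (k + 1) q + q a * esym s k q := by
    simp only [hE, hs]
    rw [esym_univ_erase hac.symm, erase_right_comm]
  have hsum : ∑ l ∈ s, q l = 1 - q a - q c := by rw [hs, sum_erase_erase hac, hq.2]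
  have hcard : s.card = n := card_erase_erase hn hac
  have b1 := esym_le s k (fun i _ => hq.1 i)
  have b2 := esym_le s (k + 1) (fun i _ => hq.1 i)
  have b0 := esym_nonneg (s := s) k (fun i _ => hq.1 i)
  rw [hsum, hcard] at b1 b2
  have hS0 : 0 ≤ 1 - q a - q c := hsum ▸ sum_nonneg fun i _ => hq.1 i
  have e1 : (n : ℝ) * ((1 - q a - q c) / n) = 1 - q a - q c := by field_simp
  have hqa := hq.1 a
  have hqc := hq.1 c
  refine ⟨(1 - q a - q c) / n, by positivity, ?_⟩
  rw [e1]
  have h3 : ((1 - δ) * q c + δ * q a) * esym s k q ≤ (1 - δ) * (q a + q c) * esym s k q := by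
    gcongr
    nlinarith
  have h4 : (1 - δ) * (q a + q c) * esym s k q ≤
      (1 - δ) * (q a + q c) * (n.choose k * ((1 - q a - q c) / n) ^ k) :=
    mul_le_mul_of_nonneg_left b1 (mul_nonneg (by linarith) (by linarith))
  calc _ ≤ (1 - δ) * E a + δ * E c := hT.trans hT2
    _ = ((1 - δ) * q c + δ * q a) * esym s k q + esym s (k + 1) q := by rw [ea, ec]; ring
    _ ≤ (1 - δ) * (q a + q c) * (n.choose k * ((1 - q a - q c) / n) ^ k) +
        n.choose (k + 1) * ((1 - q a - q c) / n) ^ (k + 1) := add_le_add (h3.trans h4) b2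
    _ = _ := by ring

/-- The maximum over `w` of the bound of `exists_dsym_le`. -/
noncomputable def oneSided (n k : ℕ) (δ : ℝ) : ℝ :=
  ((1 - δ) * n.choose k) ^ (k + 1) * k ^ k /
    (((1 - δ) * n * n.choose k - n.choose (k + 1)) ^ k * (k + 1) ^ (k + 1))

lemma le_oneSided {n k : ℕ} (hk : 0 < k) {δ w : ℝ} (hδ : δ ≤ 1)
    (hB : (n.choose (k + 1) : ℝ) < (1 - δ) * n * n.choose k) (hw : 0 ≤ w) :
    (1 - δ) * (1 - n * w) * (n.choose k * w ^ k) + n.choose (k + 1) * w ^ (k + 1) ≤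
      oneSided n k δ := by
  have h := sub_mul_pow_le k hk (A := (1 - δ) * n.choose k)
    (B := (1 - δ) * n * n.choose k - n.choose (k + 1)) (w := w)
    (mul_nonneg (by linarith) (Nat.cast_nonneg _)) (by linarith) hw
  rw [oneSided]
  exact le_trans (le_of_eq (by ring)) h

lemma dsym_le_oneSided {n k : ℕ} (hn : Fintype.card ι = n + 2) (hn0 : 0 < n) (hk : 0 < k)
    {p q : ι → ℝ} (hp : p ∈ stdSimplex ℝ ι) (hq : q ∈ stdSimplex ℝ ι) {δ : ℝ} (hδ : δ ≤ 1 / 2)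
    (hpδ : ∀ i, p i ≤ 1 - δ) (hB : (n.choose (k + 1) : ℝ) < (1 - δ) * n * n.choose k) :
    dsym univ (k + 1) q p ≤ oneSided n k δ := by
  obtain ⟨w, hw, h⟩ := exists_dsym_le hn hn0 k hp hq hδ hpδ
  exact h.trans (le_oneSided hk (by linarith) hB hw)

/-- A bound for the elementary symmetric polynomial of degree `k + 1` of a distribution on `n + 2`
symbols without one of its entries: the largest entry is `m`, and the other ones have the sum
`δ`, spread over `n` symbols. -/
noncomputable def tailBound (n k : ℕ) (m δ : ℝ) : ℝ :=
  m * (n.choose k * (δ / n) ^ k) + n.choose (k + 1) * (δ / n) ^ (k + 1)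

lemma tailBound_mono (n k : ℕ) {m m' δ δ' : ℝ} (hm : 0 ≤ m) (hδ : 0 ≤ δ) (hm' : m ≤ m')
    (hδ' : δ ≤ δ') : tailBound n k m δ ≤ tailBound n k m' δ' := by
  have := hm.trans hm'
  unfold tailBound
  gcongr

lemma tailBound_nonneg (n k : ℕ) {m δ : ℝ} (hm : 0 ≤ m) (hδ : 0 ≤ δ) : 0 ≤ tailBound n k m δ := by
  unfold tailBound
  positivity

lemma esym_erase_le_tailBound {n : ℕ} (hn : Fintype.card ι = n + 2) (k : ℕ)
    {p : ι → ℝ} (hp : p ∈ stdSimplex ℝ ι) {a : ι} (ha : 1 / 2 ≤ p a) (i : ι) :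
    esym (univ.erase i) (k + 1) p ≤ tailBound n k (p a) (1 - p a) := by
  have main : ∀ h l : ι, h ≠ l → p l ≤ p a → p h + p l ≥ p a →
      esym (univ.erase h) (k + 1) p ≤ tailBound n k (p a) (1 - p a) := by
    intro h l hhl hla hsum
    have b1 := esym_le ((univ.erase h).erase l) k (fun i _ => hp.1 i)
    have b2 := esym_le ((univ.erase h).erase l) (k + 1) (fun i _ => hp.1 i)
    have b0 := esym_nonneg (s := (univ.erase h).erase l) k (fun i _ => hp.1 i)
    have hS0 : 0 ≤ 1 - p h - p l := by
      have := sum_erase_erase hhl p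
      rw [hp.2] at this
      exact this ▸ sum_nonneg fun i _ => hp.1 i
    rw [card_erase_erase hn hhl, sum_erase_erase hhl, hp.2] at b1 b2
    rw [esym_univ_erase hhl, tailBound, add_comm]
    have hle : 1 - p h - p l ≤ 1 - p a := by linarith
    have := hp.1 a
    refine add_le_add ((mul_le_mul hla b1 b0 this).trans ?_) (b2.trans ?_) <;> gcongr
  rcases eq_or_ne i a with rfl | hia
  · obtain ⟨c, hc⟩ : ∃ c, c ≠ i := by
      have : Nontrivial ι := Fintype.one_lt_card_iff_nontrivial.1 (by omega)
      exact exists_ne i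
    have h1 : p i + p c ≤ 1 := by
      rw [← hp.2, ← sum_pair hc.symm]
      exact sum_le_univ_sum_of_nonneg hp.1
    exact main i c hc.symm (by linarith) (by linarith [hp.1 c])
  · exact main i a hia le_rfl (by linarith [hp.1 i])

lemma dsym_le_tailBound {n : ℕ} (hn : Fintype.card ι = n + 2) (k : ℕ)
    {p q : ι → ℝ} (hp : p ∈ stdSimplex ℝ ι) (hq : q ∈ stdSimplex ℝ ι) {a : ι}
    (ha : 1 / 2 ≤ p a) : dsym univ (k + 1) p q ≤ tailBound n k (p a) (1 - p a) := by
  calc dsym univ (k + 1) p q ≤ ∑ i, q i * tailBound n k (p a) (1 - p a) :=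
        sum_le_sum fun i _ =>
          mul_le_mul_of_nonneg_left (esym_erase_le_tailBound hn k hp ha i) (hq.1 i)
    _ = _ := by rw [← sum_mul, hq.2, one_mul]

lemma le_of_half_le {p : ι → ℝ} (hp : p ∈ stdSimplex ℝ ι) {a : ι} (ha : 1 / 2 ≤ p a) (i : ι) :
    p i ≤ p a := by
  rcases eq_or_ne i a with rfl | hia
  · exact le_rfl
  have h1 : p i + p a ≤ 1 := by
    rw [← hp.2, ← sum_pair hia]
    exact sum_le_univ_sum_of_nonneg hp.1
  linarith

/-- The bound for `phi` when the largest entry of `p` lies in a window `[1 - δ₁, 1 - δ₀]`. -/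
lemma phi_le_of_window {n k : ℕ} (hn : Fintype.card ι = n + 2) (hn0 : 0 < n) (hk : 0 < k)
    {p q : ι → ℝ} (hp : p ∈ stdSimplex ℝ ι) (hq : q ∈ stdSimplex ℝ ι) {a : ι} {δ₀ δ₁ : ℝ}
    (h₀ : p a ≤ 1 - δ₀) (h₁ : 1 - δ₁ ≤ p a) (hδ₁ : δ₁ ≤ 1 / 2)
    (hB : (n.choose (k + 1) : ℝ) < (1 - δ₀) * n * n.choose k) :
    phi univ (k + 1) p q ≤ tailBound n k (1 - δ₀) δ₁ + oneSided n k δ₀ := by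
  have ha : 1 / 2 ≤ p a := by linarith
  have h1 := le_one_of_mem_stdSimplex hp a
  refine add_le_add ((dsym_le_tailBound hn k hp hq ha).trans
    (tailBound_mono n k (by linarith) (by linarith) h₀ (by linarith))) ?_
  exact dsym_le_oneSided hn hn0 hk hp hq (by linarith)
    (fun i => (le_of_half_le hp ha i).trans h₀) hB

end OneSided

/-! ### Pairs of distributions with bounded entries -/

section Capped

variable {ι : Type*} [Fintype ι] [DecidableEq ι]

lemma bsym_eq_zero {n₂ n₁ k : ℕ} (h : n₁ + n₂ < k) (β a : ℝ) : bsym n₂ n₁ k β a = 0 := by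
  induction n₂ generalizing k with
  | zero => simp [bsym, Nat.choose_eq_zero_of_lt (by omega : n₁ < k)]
  | succ n₂ ih =>
    rcases k with _ | k
    · omega
    · simp [bsym, ih (by omega : n₁ + n₂ < k + 1), ih (by omega : n₁ + n₂ < k)]

lemma bdsym_eq_zero {n₁ n₂ n₃ k : ℕ} (h : n₁ + n₂ < k) (a β a' γ : ℝ) :
    bdsym n₁ n₂ n₃ k a β a' γ = 0 := by
  rw [bdsym, bsym_eq_zero (by omega), bsym_eq_zero h]
  ring

/-- The branch and bound check that `phi` in degree `k + 1` is at most `target` for all pairs of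
distributions on `b` symbols that consist of three blocks, the second and the third with fewer
than `m` symbols, and have entries at most `cap`. -/
def blocksBelow (b k m : ℕ) (cap target : ℕ × ℕ) : Bool :=
  (List.range m).all fun n₂ => (List.range m).all fun n₃ =>
    covers (BlockBound.test ⟨b - n₂ - n₃, n₂, n₃, k, 64, cap, target⟩) 20
      [(0, 0), (0, 0), if n₂ = 0 then (64, 0) else (0, 64), if n₃ = 0 then (64, 0) else (0, 64)]

lemma IsExtremal.symm {j : ℕ} {u p q : ι → ℝ} (h : IsExtremal j (cappedPairs u) p q) :
    IsExtremal j (cappedPairs u) q p := by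
  refine ⟨⟨h.1.2.1, h.1.1, fun i => ⟨(h.1.2.2 i).2, (h.1.2.2 i).1⟩⟩, fun z hz => ?_⟩
  have h2 := h.2 (z.2, z.1) ⟨hz.2.1, hz.1, fun i => ⟨(hz.2.2 i).2, (hz.2.2 i).1⟩⟩
  simp only [phi_comm univ j z.2 z.1, phi_comm univ j p q] at h2
  simpa only [add_comm (q _ ^ 2), add_comm (z.1 _ ^ 2)] using h2

/-- An upper bound for `phi` over pairs of distributions with entries at most `u`. At an extremal
pair either some entry reaches the quotient `cap`, or the entries form three blocks; in the second
case the bound follows by branch and bound, or from the bound for one of the two summands of `phi`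
if the other one vanishes. -/
theorem phi_le_of_capped {n k : ℕ} (hn : Fintype.card ι = n + 2) (hkn : k < n) {u : ℝ}
    {cap target : ℕ × ℕ} (hcap : 0 < cap.2) (htarget : 0 < target.2)
    (hθ : 1 / 2 ≤ (cap.1 / cap.2 : ℝ)) (hθu : (cap.1 / cap.2 : ℝ) ≤ u)
    (hfam : blocksBelow (n + 2) (k + 1) (n + 1 - k) cap target = true)
    (hB : (n.choose (k + 2) : ℝ) < cap.1 / cap.2 * n * n.choose (k + 1))
    (hone : oneSided n (k + 1) (1 - cap.1 / cap.2) ≤ target.1 / target.2)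
    (hbig : ∀ p q : ι → ℝ, IsExtremal (k + 2) (cappedPairs fun _ => u) p q →
      ∀ a, (cap.1 / cap.2 : ℝ) ≤ p a → phi univ (k + 2) p q ≤ target.1 / target.2)
    {p q : ι → ℝ} (hpq : (p, q) ∈ cappedPairs fun _ : ι => u) :
    phi univ (k + 2) p q ≤ target.1 / target.2 := by
  obtain ⟨p', q', hext⟩ := exists_isExtremal (k + 2) (isCompact_cappedPairs fun _ : ι => u) ⟨_, hpq⟩
  refine ((hext.2 _ hpq).1).trans ?_
  clear hpq p q
  rename' p' => p, q' => q
  by_cases hp1 : ∃ a, (cap.1 / cap.2 : ℝ) ≤ p a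
  · obtain ⟨a, ha⟩ := hp1
    exact hbig p q hext a ha
  by_cases hq1 : ∃ a, (cap.1 / cap.2 : ℝ) ≤ q a
  · obtain ⟨a, ha⟩ := hq1
    rw [phi_comm]
    exact hbig q p hext.symm a ha
  push Not at hp1 hq1
  obtain ⟨hp, hq, -⟩ := hext.1
  simp only at hp hq
  have hpos : ∃ i ∈ (univ : Finset ι), 0 < p i ∨ 0 < q i := by
    by_contra! h
    have : ∑ i, p i = 0 := sum_eq_zero fun i hi => le_antisymm (h i hi).1 (hp.1 i)
    rw [hp.2] at this
    exact one_ne_zero this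
  obtain ⟨A, B, C, a, β, a', γ, ha, hβ, ha', hγ, hA0, hB0, hC0, hbl⟩ :=
    hext.exists_isBlocks (s := univ) (fun _ _ => rfl)
      (fun i _ => ⟨(hp1 i).trans_le hθu, (hq1 i).trans_le hθu⟩) hpos
  have hcard := hbl.card_eq
  rw [card_univ, hn] at hcard
  by_cases hC : n + 1 - k ≤ C.card
  · have h0 : dsym univ (k + 2) p q = 0 := by
      rw [hbl.dsym_eq, bdsym_eq_zero (by omega)]
    rw [phi, h0, zero_add]
    refine le_trans (dsym_le_oneSided (k := k + 1) hn (by omega) (by omega) hp hq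
      (δ := 1 - cap.1 / cap.2) (by linarith) (fun i => by linarith [hp1 i]) ?_) hone
    rw [sub_sub_cancel]; exact hB
  by_cases hB' : n + 1 - k ≤ B.card
  · have h0 : dsym univ (k + 2) q p = 0 := by
      rw [hbl.symm.dsym_eq, bdsym_eq_zero (by omega)]
    rw [phi, h0, add_zero]
    refine le_trans (dsym_le_oneSided (k := k + 1) hn (by omega) (by omega) hq hp
      (δ := 1 - cap.1 / cap.2) (by linarith) (fun i => by linarith [hq1 i]) ?_) hone
    rw [sub_sub_cancel]; exact hB
  push Not at hC hB'
  simp only [blocksBelow, List.all_eq_true, List.mem_range] at hfam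
  have hcov := hfam _ hB' _ hC
  have hcap' : (0 : ℝ) < cap.2 := by exact_mod_cast hcap
  have hpsum := hbl.sum_left
  rw [hp.2] at hpsum
  have hqsum := hbl.symm.sum_left
  rw [hq.2] at hqsum
  have hn1 : n + 2 - B.card - C.card = A.card := by omega
  rw [hn1] at hcov
  have hcapβ : ∀ (D : Finset ι) (x : ι → ℝ) (c : ℝ), (D = ∅ → c = 0) → (∀ i ∈ D, x i = c) →
      (∀ i, x i < cap.1 / cap.2) → c * cap.2 ≤ cap.1 := by
    intro D x c h1 h2 h3
    rcases D.eq_empty_or_nonempty with h | ⟨i, hi⟩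
    · rw [h1 h, zero_mul]; positivity
    · rw [← h2 i hi]
      exact ((lt_div_iff₀ hcap').1 (h3 i)).le
  have hx1 : (A.card : ℝ) * a ≤ 1 := by
    rw [hpsum]
    linarith [mul_nonneg (Nat.cast_nonneg (α := ℝ) B.card) hβ]
  have hy1 : (A.card : ℝ) * a' ≤ 1 := by
    rw [hqsum]
    linarith [mul_nonneg (Nat.cast_nonneg (α := ℝ) C.card) hγ]
  have hx0 : 0 ≤ (A.card : ℝ) * a := by positivity
  have hy0 : 0 ≤ (A.card : ℝ) * a' := by positivity
  have hbox : InBox [((0 : ℕ), (0 : ℕ)), (0, 0), if B.card = 0 then (64, 0) else (0, 64),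
      if C.card = 0 then (64, 0) else (0, 64)]
      [((64 : ℕ) : ℝ) * 0, ((64 : ℕ) : ℝ) * 0, ((64 : ℕ) : ℝ) * (A.card * a),
        ((64 : ℕ) : ℝ) * (A.card * a')] := by
    refine List.Forall₂.cons (by simp) (List.Forall₂.cons (by simp) (List.Forall₂.cons ?_
      (List.Forall₂.cons ?_ List.Forall₂.nil)))
    · split_ifs with h
      · rw [h] at hpsum
        push_cast at hpsum ⊢
        constructor <;> linarith
      · push_cast
        constructor <;> linarith
    · split_ifs with h
      · rw [h] at hqsum
        push_cast at hqsum ⊢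
        constructor <;> linarith
      · push_cast
        constructor <;> linarith
  have key := covers_sound (BlockBound.test_sound
    ⟨A.card, B.card, C.card, k + 1, 64, cap, target⟩ (by norm_num)
    (z := 0) (z' := 0) (x := A.card * a) (y := A.card * a') le_rfl zero_le_one le_rfl
    zero_le_one hx0 hx1 hy0 hy1 ha hβ ha' hγ (fun h => hA0 (card_eq_zero.1 h))
    (fun h => hB0 (card_eq_zero.1 h)) (fun h => hC0 (card_eq_zero.1 h)) (by simp)
    (by simp only; linarith) (by simp) (by simp only; linarith)
    (hcapβ B p β hB0 hbl.pB hp1) (hcapβ C q γ hC0 hbl.qC hq1)) 20 hcov hbox rfl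
  simp only at key
  rw [hbl.phi_eq (k + 1), le_div_iff₀ (by exact_mod_cast htarget)]
  linarith

end Capped

/-! ### Large entries, and the cases of six, nine, ten and eleven symbols -/

section Windows

variable {ι : Type*} [Fintype ι] [DecidableEq ι]

/-- The bounds of `phi_le_of_window` for the windows between consecutive members of a list are at
most `t`. -/
def windowsBelow (n k : ℕ) (t : ℝ) : List ℝ → Prop
  | δ₀ :: δ₁ :: l => (δ₁ ≤ 1 / 2 ∧ (n.choose (k + 1) : ℝ) < (1 - δ₀) * n * n.choose k ∧
      tailBound n k (1 - δ₀) δ₁ + oneSided n k δ₀ ≤ t) ∧ windowsBelow n k t (δ₁ :: l)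
  | _ => True

lemma phi_le_of_windowsBelow {n k : ℕ} (hn : Fintype.card ι = n + 2) (hn0 : 0 < n) (hk : 0 < k)
    {p q : ι → ℝ} (hp : p ∈ stdSimplex ℝ ι) (hq : q ∈ stdSimplex ℝ ι) {a : ι} {t : ℝ}
    (δ₀ δ₁ : ℝ) (l : List ℝ) (h : windowsBelow n k t (δ₀ :: δ₁ :: l)) (h₀ : p a ≤ 1 - δ₀)
    (h₁ : 1 - (δ₁ :: l).getLast (List.cons_ne_nil _ _) ≤ p a) : phi univ (k + 1) p q ≤ t := by
  induction l generalizing δ₀ δ₁ with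
  | nil => exact (phi_le_of_window hn hn0 hk hp hq h₀ h₁ h.1.1 h.1.2.1).trans h.1.2.2
  | cons δ₂ l ih =>
    rcases le_total (1 - δ₁) (p a) with h2 | h2
    · exact (phi_le_of_window hn hn0 hk hp hq h₀ h2 h.1.1 h.1.2.1).trans h.1.2.2
    · exact ih δ₁ δ₂ h.2 h2 (by rwa [List.getLast_cons (List.cons_ne_nil _ _)] at h₁)

/-- If one of the distributions is close to a vertex, then `phi` is at most its value for a vertex
and the uniform distribution on the other symbols. For a fixed mean `w` of the small entries, the
bound of `exists_dsym_le` is affine in `δ`. -/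
lemma phi_le_of_near_vertex {n k : ℕ} (hn : Fintype.card ι = n + 2) (hn0 : 0 < n) (hk : 0 < k)
    {p q : ι → ℝ} (hp : p ∈ stdSimplex ℝ ι) (hq : q ∈ stdSimplex ℝ ι) {a : ι} {ε : ℝ}
    (hε : 0 < ε) (hε2 : ε ≤ 1 / 2) (ha : 1 - ε ≤ p a)
    (hB : (n.choose (k + 1) : ℝ) < (1 - ε) * n * n.choose k)
    (hle : oneSided n k ε + tailBound n k 1 ε ≤ oneSided n k 0) :
    phi univ (k + 1) p q ≤ oneSided n k 0 := by
  have ha1 := le_one_of_mem_stdSimplex hp a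
  set t : ℝ := (1 - p a) / ε with ht
  have hδ : 1 - p a = t * ε := by rw [ht]; field_simp
  have ht0 : 0 ≤ t := div_nonneg (by linarith) hε.le
  have ht1 : t ≤ 1 := by rw [ht, div_le_one hε]; linarith
  obtain ⟨w, hw, h⟩ := exists_dsym_le hn hn0 k hp hq (δ := 1 - p a) (by linarith)
    (fun i => by rw [sub_sub_cancel]; exact le_of_half_le hp (by linarith) i)
  have hB0 : (n.choose (k + 1) : ℝ) < (1 - 0) * n * n.choose k := by
    refine hB.trans_le ?_
    gcongr
  have w0 := le_oneSided hk zero_le_one hB0 hw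
  have w1 := le_oneSided hk (by linarith) hB hw
  have h1 : dsym univ (k + 1) q p ≤ (1 - t) * oneSided n k 0 + t * oneSided n k ε := by
    refine h.trans ?_
    rw [hδ]
    calc _ = (1 - t) * ((1 - 0) * (1 - n * w) * (n.choose k * w ^ k) +
          n.choose (k + 1) * w ^ (k + 1)) +
          t * ((1 - ε) * (1 - n * w) * (n.choose k * w ^ k) +
          n.choose (k + 1) * w ^ (k + 1)) := by ring
      _ ≤ _ := add_le_add (mul_le_mul_of_nonneg_left w0 (by linarith))
          (mul_le_mul_of_nonneg_left w1 ht0)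
  have h2 : dsym univ (k + 1) p q ≤ t * tailBound n k 1 ε := by
    refine (dsym_le_tailBound hn k hp hq (a := a) (by linarith)).trans ?_
    refine (tailBound_mono n k (by linarith) (by linarith) ha1 le_rfl).trans ?_
    have pw : ∀ m : ℕ, 0 < m → (t * ε / n) ^ m ≤ t * (ε / n) ^ m := by
      intro m hm
      rw [mul_div_assoc, mul_pow]
      gcongr
      exact pow_le_of_le_one ht0 ht1 hm.ne'
    rw [hδ, tailBound, tailBound, mul_add]
    refine add_le_add ?_ ?_
    · calc _ ≤ 1 * (n.choose k * (t * (ε / n) ^ k)) := by gcongr; exact pw k hk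
        _ = _ := by ring
    · calc _ ≤ (n.choose (k + 1) : ℝ) * (t * (ε / n) ^ (k + 1)) := by
            gcongr; exact pw (k + 1) k.succ_pos
        _ = _ := by ring
  calc phi univ (k + 1) p q ≤ t * tailBound n k 1 ε +
        ((1 - t) * oneSided n k 0 + t * oneSided n k ε) := add_le_add h2 h1
    _ = (1 - t) * oneSided n k 0 + t * (oneSided n k ε + tailBound n k 1 ε) := by ring
    _ ≤ (1 - t) * oneSided n k 0 + t * oneSided n k 0 := by gcongr
    _ = _ := by ring

/-- The bound is the value at the pair of uniform distributions. The same holds for the other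
numbers of symbols; the ends of the windows are chosen such that the bounds suffice. -/
lemma phi_le_capped_nine {ι : Type*} [Fintype ι] [DecidableEq ι] (hn : Fintype.card ι = 9)
    {p q : ι → ℝ} (hpq : (p, q) ∈ cappedPairs fun _ : ι => (9 / 10 : ℝ)) :
    phi univ 6 p q ≤ 2 * 28 / 9 ^ 6 := by
  have h := phi_le_of_capped (n := 7) (k := 4) (cap := (56, 100)) (target := (2 * 28, 9 ^ 6)) hn
    (by norm_num) (by norm_num) (by norm_num) (by norm_num) (by norm_num) (by decide +kernel)
    (by norm_num [Nat.choose]) (by norm_num [oneSided, Nat.choose]) (fun p q hpq a ha => ?_) hpq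
  · exact_mod_cast h
  · exact phi_le_of_windowsBelow (k := 5) hn (by norm_num) (by norm_num) hpq.1.1 hpq.1.2.1 (a := a)
      (1 / 10) (355 / 1000) [44 / 100]
      (by norm_num [windowsBelow, tailBound, oneSided, Nat.choose])
      ((hpq.1.2.2 a).1.trans (by norm_num)) (by norm_num at ha ⊢; exact ha)

lemma phi_le_capped_ten {ι : Type*} [Fintype ι] [DecidableEq ι] (hn : Fintype.card ι = 10)
    {p q : ι → ℝ} (hpq : (p, q) ∈ cappedPairs fun _ : ι => (14 / 15 : ℝ)) :
    phi univ 7 p q ≤ 2 * 36 / 10 ^ 7 := by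
  have h := phi_le_of_capped (n := 8) (k := 5) (cap := (56, 100)) (target := (2 * 36, 10 ^ 7)) hn
    (by norm_num) (by norm_num) (by norm_num) (by norm_num) (by norm_num) (by decide +kernel)
    (by norm_num [Nat.choose]) (by norm_num [oneSided, Nat.choose]) (fun p q hpq a ha => ?_) hpq
  · exact_mod_cast h
  · exact phi_le_of_windowsBelow (k := 6) hn (by norm_num) (by norm_num) hpq.1.1 hpq.1.2.1 (a := a)
      (1 / 15) (29 / 100) [44 / 100]
      (by norm_num [windowsBelow, tailBound, oneSided, Nat.choose])
      ((hpq.1.2.2 a).1.trans (by norm_num)) (by norm_num at ha ⊢; exact ha)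

lemma phi_le_capped_eleven {ι : Type*} [Fintype ι] [DecidableEq ι] (hn : Fintype.card ι = 11)
    {p q : ι → ℝ} (hpq : (p, q) ∈ cappedPairs fun _ : ι => (10 / 11 : ℝ)) :
    phi univ 8 p q ≤ 2 * 45 / 11 ^ 8 := by
  have h := phi_le_of_capped (n := 9) (k := 6) (cap := (56, 100)) (target := (2 * 45, 11 ^ 8)) hn
    (by norm_num) (by norm_num) (by norm_num) (by norm_num) (by norm_num) (by decide +kernel)
    (by norm_num [Nat.choose]) (by norm_num [oneSided, Nat.choose]) (fun p q hpq a ha => ?_) hpq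
  · exact_mod_cast h
  · exact phi_le_of_windowsBelow (k := 7) hn (by norm_num) (by norm_num) hpq.1.1 hpq.1.2.1 (a := a)
      (1 / 11) (32 / 100) [44 / 100]
      (by norm_num [windowsBelow, tailBound, oneSided, Nat.choose])
      ((hpq.1.2.2 a).1.trans (by norm_num)) (by norm_num at ha ⊢; exact ha)

lemma phi_le_capped_six {ι : Type*} [Fintype ι] [DecidableEq ι] (hn : Fintype.card ι = 6)
    {p q : ι → ℝ} (hpq : (p, q) ∈ cappedPairs fun _ : ι => (9 / 10 : ℝ)) :
    phi univ 4 p q ≤ 2 * 5 / 6 ^ 4 := by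
  have h := phi_le_of_capped (n := 4) (k := 2) (cap := (65, 100)) (target := (2 * 5, 6 ^ 4)) hn
    (by norm_num) (by norm_num) (by norm_num) (by norm_num) (by norm_num) (by decide +kernel)
    (by norm_num [Nat.choose]) (by norm_num [oneSided, Nat.choose]) (fun p q hpq a ha => ?_) hpq
  · exact_mod_cast h
  · exact phi_le_of_windowsBelow (k := 3) hn (by norm_num) (by norm_num) hpq.1.1 hpq.1.2.1 (a := a)
      (1 / 10) (183 / 1000) [256 / 1000, 303 / 1000, 330 / 1000, 346 / 1000, 350 / 1000]
      (by norm_num [windowsBelow, tailBound, oneSided, Nat.choose])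
      ((hpq.1.2.2 a).1.trans (by norm_num)) (by norm_num at ha ⊢; exact ha)

end Windows

/-! ### Extremal pairs with one large entry, and the case of eight symbols -/

section TwoBlocks

variable {ι : Type*} [DecidableEq ι]

lemma IsBlocks.dsym_insert_eq {s A B C : Finset ι} {p q : ι → ℝ} {a β a' γ : ℝ}
    (h : IsBlocks s A B C p q a β a' γ) {l : ι} (hl : l ∉ s) (k : ℕ) :
    dsym (insert l s) (k + 1) p q = bdsym A.card B.card C.card (k + 1) a β a' γ +
      p l * bdsym A.card B.card C.card k a β a' γ + q l * bsym B.card A.card (k + 1) β a := by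
  rw [dsym_insert hl, h.dsym_eq, h.dsym_eq, h.esym_eq]

variable [Fintype ι]

/-- At an extremal pair such that `p` has an entry larger than `1 / 2` and `q` has not, every other
symbol has a larger entry in `q` than the large symbol. Hence there is no block of symbols with
entries `(β, 0)`. -/
lemma IsExtremal.exists_two_blocks {n k : ℕ} (hn : Fintype.card ι = n + 2) {u : ℝ} {p q : ι → ℝ}
    (hext : IsExtremal (k + 2) (cappedPairs fun _ => u) p q) (hu : 1 / 2 ≤ u) {c : ι}
    (hc : 1 / 2 < p c) (hc1 : p c < 1) (hq : ∀ i, q i < 1 / 2) :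
    ∃ (n₁ n₃ : ℕ) (a a' γ : ℝ), n₁ + n₃ = n + 1 ∧ 0 ≤ a ∧ q c ≤ a' ∧ 0 ≤ a' ∧ 0 ≤ γ ∧ γ < 1 / 2 ∧
      n₁ * a = 1 - p c ∧ n₁ * a' + n₃ * γ = 1 - q c ∧
      dsym univ (k + 2) p q = bdsym n₁ 0 n₃ (k + 2) a 0 a' γ +
        p c * bdsym n₁ 0 n₃ (k + 1) a 0 a' γ + q c * bsym 0 n₁ (k + 2) 0 a ∧
      dsym univ (k + 2) q p = bdsym n₁ n₃ 0 (k + 2) a' γ a 0 +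
        q c * bdsym n₁ n₃ 0 (k + 1) a' γ a 0 + p c * bsym n₃ n₁ (k + 2) γ a' := by
  obtain ⟨⟨hp0, hp1⟩, ⟨hq0, hq1⟩, hcap⟩ := hext.1
  simp only at hp0 hp1 hq0 hq1 hcap
  have hle : ∀ i, i ≠ c → p i ≤ 1 - p c := by
    intro i hi
    have : p i + p c ≤ 1 := by
      rw [← hp1, ← sum_pair hi]
      exact sum_le_univ_sum_of_nonneg hp0
    linarith
  have hqc : ∀ i, i ≠ c → q c < q i := by
    intro i hi
    by_contra! h
    have h1 := hle i hi
    have := (hext.opposite (i := i) (h := c) rfl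
      (mul_nonneg_of_nonpos_of_nonpos (by linarith) (by linarith))).1
    linarith
  have hs : insert c (univ.erase c) = (univ : Finset ι) := insert_erase (mem_univ c)
  obtain ⟨d, hd⟩ : ∃ d, d ≠ c := by
    have : Nontrivial ι := Fintype.one_lt_card_iff_nontrivial.1 (by omega)
    exact exists_ne c
  obtain ⟨A, B, C, a, β, a', γ, ha, hβ, ha', hγ, hA0, hB0, hC0, hbl⟩ :=
    hext.exists_isBlocks (s := univ.erase c) (fun _ _ => rfl)
      (fun i hi => ⟨by linarith [hle i (mem_erase.1 hi).1], (hq i).trans_le hu⟩)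
      ⟨d, mem_erase.2 ⟨hd, mem_univ d⟩, Or.inr ((hq0 c).trans_lt (hqc d hd))⟩
  have hmem : ∀ {i}, i ∈ A ∪ B ∪ C → i ≠ c := by
    intro i hi
    rw [← hbl.union] at hi
    exact (mem_erase.1 hi).1
  have hB : B = ∅ := by
    rw [eq_empty_iff_forall_notMem]
    intro i hi
    have := hqc i (hmem (by simp [hi]))
    rw [hbl.qB i hi] at this
    linarith [hq0 c]
  have hβ0 := hB0 hB
  have hcard := hbl.card_eq
  rw [card_erase_of_mem (mem_univ c), card_univ, hn, hB, card_empty] at hcard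
  have hpsum := hbl.sum_left
  have hqsum := hbl.symm.sum_left
  rw [← add_sum_erase univ _ (mem_univ c)] at hp1 hq1
  have e1 := hbl.dsym_insert_eq (notMem_erase c univ) (k + 1)
  have e2 := hbl.symm.dsym_insert_eq (notMem_erase c univ) (k + 1)
  rw [hs] at e1 e2
  simp only [hB, hβ0, card_empty] at hpsum e1 e2
  have hγ2 : γ < 1 / 2 := by
    rcases C.eq_empty_or_nonempty with h | ⟨i, hi⟩
    · rw [hC0 h]; norm_num
    · rw [← hbl.qC i hi]; exact hq i
  have hA : q c ≤ a' ∧ A ≠ ∅ ∨ A = ∅ := by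
    rcases A.eq_empty_or_nonempty with h | ⟨i, hi⟩
    · exact Or.inr h
    · refine Or.inl ⟨?_, ne_empty_of_mem hi⟩
      rw [← hbl.qA i hi]
      exact (hqc i (hmem (by simp [hi]))).le
  refine ⟨A.card, C.card, a, a', γ, by omega, ha, ?_, ha', hγ, hγ2, ?_, ?_, e1, e2⟩
  · rcases hA with h | h
    · exact h.1
    rw [h, card_empty, Nat.cast_zero] at hpsum
    linarith
  · linarith
  · linarith

/-- The bound for `phi` if both distributions have a large entry. -/
lemma phi_le_of_half_le {n k : ℕ} (hn : Fintype.card ι = n + 2) {p q : ι → ℝ}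
    (hp : p ∈ stdSimplex ℝ ι) (hq : q ∈ stdSimplex ℝ ι) {a c : ι} {δ δ' : ℝ} (ha : 1 - δ ≤ p a)
    (hc : 1 - δ' ≤ q c) (hδ : δ ≤ 1 / 2) (hδ' : δ' ≤ 1 / 2) :
    phi univ (k + 1) p q ≤ tailBound n k 1 δ + tailBound n k 1 δ' := by
  have h1 := le_one_of_mem_stdSimplex hp a
  have h2 := le_one_of_mem_stdSimplex hq c
  exact add_le_add
    ((dsym_le_tailBound hn k hp hq (a := a) (by linarith)).trans
      (tailBound_mono n k (by linarith) (by linarith) h1 (by linarith)))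
    ((dsym_le_tailBound hn k hq hp (a := c) (by linarith)).trans
      (tailBound_mono n k (by linarith) (by linarith) h2 (by linarith)))

/-- The bound of `phi_le_of_window` does not suffice if an entry of `p` is close to the cap. There
the extremal pair has two blocks, and the summand `dsym univ 6 p q` is small enough in each case. -/
lemma phi_le_capped_eight (hn : Fintype.card ι = 8)
    {p q : ι → ℝ} (hpq : (p, q) ∈ cappedPairs fun _ : ι => (22 / 25 : ℝ)) :
    phi univ 6 p q ≤ 2 * 7 / 8 ^ 6 := by
  have h := phi_le_of_capped (n := 6) (k := 4) (cap := (56, 100)) (target := (2 * 7, 8 ^ 6)) hn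
    (by norm_num) (by norm_num) (by norm_num) (by norm_num) (by norm_num) (by decide +kernel)
    (by norm_num [Nat.choose]) (by norm_num [oneSided, Nat.choose]) (fun p q hpq c hc => ?_) hpq
  · exact_mod_cast h
  have hpc := (hpq.1.2.2 c).1
  rcases le_or_gt (p c) (1 - 241 / 2000) with h1 | h1
  · exact phi_le_of_windowsBelow (k := 5) hn (by norm_num) (by norm_num) hpq.1.1 hpq.1.2.1 (a := c)
      (241 / 2000) (142 / 1000) [279 / 1000, 427 / 1000, 44 / 100]
      (by norm_num [windowsBelow, tailBound, oneSided, Nat.choose]) h1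
      (by norm_num at hc ⊢; exact hc)
  by_cases h2 : ∃ i, 1 / 2 ≤ q i
  · obtain ⟨i, hi⟩ := h2
    refine (phi_le_of_half_le (k := 5) hn hpq.1.1 hpq.1.2.1 h1.le (c := i) (δ' := 1 / 2)
      (by simp only; linarith) (by norm_num) le_rfl).trans ?_
    norm_num [tailBound, Nat.choose]
  push Not at h2
  simp only at hpc
  have hone := dsym_le_oneSided (k := 5) hn (by norm_num) (by norm_num) hpq.1.1 hpq.1.2.1
    (δ := 3 / 25) (by norm_num) (fun i => by
      have := (hpq.1.2.2 i).1
      simp only at this ⊢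
      linarith) (by norm_num [Nat.choose])
  refine (add_le_add le_rfl hone).trans ?_
  clear hone
  have hqc := hpq.1.2.1.1 c
  simp only at hqc ⊢
  obtain ⟨n₁, n₃, a, a', γ, hsum, ha, -, ha', hγ, hγ2, hpa, hqa, hT, -⟩ :=
    hpq.exists_two_blocks hn (by norm_num) (c := c) (by linarith) (by linarith) h2
  rw [hT]
  clear hT hpq h2
  have hq1 : 0 ≤ 1 - q c := by rw [← hqa]; positivity
  have hn₃ : n₃ = 0 ∨ n₃ = 1 ∨ n₃ = 2 ∨ 3 ≤ n₃ := by omega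
  rcases hn₃ with rfl | rfl | rfl | hn₃
  · obtain rfl : n₁ = 7 := by omega
    push_cast at hpa hqa
    have ha2 : a ≤ 241 / 14000 := by linarith
    have e : bdsym 7 0 0 6 a 0 a' γ + p c * bdsym 7 0 0 5 a 0 a' γ + q c * bsym 0 7 6 0 a =
        (1 - q c) * (a ^ 6 + p c * (6 * a ^ 5)) + q c * (7 * a ^ 6) := by
      norm_num [bdsym, bsym, Nat.choose]
      rw [← hqa]
      ring
    rw [e]
    have h5 : p c * (6 * a ^ 5) ≤ 22 / 25 * (6 * (241 / 14000) ^ 5) := by gcongr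
    have h6 : a ^ 6 ≤ (241 / 14000) ^ 6 := by gcongr
    have hb : (1 - q c) * (a ^ 6 + p c * (6 * a ^ 5)) + q c * (7 * a ^ 6) ≤
        7 * (241 / 14000) ^ 6 + 22 / 25 * (6 * (241 / 14000) ^ 5) := by
      nlinarith [mul_nonneg hqc (sub_nonneg.2 h6), mul_nonneg hq1 (sub_nonneg.2 h5),
        mul_nonneg hq1 (sub_nonneg.2 h6)]
    exact (add_le_add hb le_rfl).trans (by norm_num [oneSided, Nat.choose])
  · obtain rfl : n₁ = 6 := by omega
    push_cast at hpa hqa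
    have ha2 : a ≤ 241 / 12000 := by linarith
    have e : bdsym 6 0 1 6 a 0 a' γ + p c * bdsym 6 0 1 5 a 0 a' γ + q c * bsym 0 6 6 0 a =
        p c * (1 - q c + 5 * γ) * a ^ 5 + (γ + q c) * a ^ 6 := by
      norm_num [bdsym, bsym, Nat.choose]
      rw [← hqa]
      ring
    rw [e]
    have hb : p c * (1 - q c + 5 * γ) * a ^ 5 + (γ + q c) * a ^ 6 ≤
        22 / 25 * (1 - 0 + 5 * (1 / 2)) * (241 / 12000) ^ 5 + 1 * (241 / 12000) ^ 6 := by
      gcongr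
      linarith
    exact (add_le_add hb le_rfl).trans (by norm_num [oneSided, Nat.choose])
  · obtain rfl : n₁ = 5 := by omega
    push_cast at hpa hqa
    have ha2 : a ≤ 241 / 10000 := by linarith
    have e : bdsym 5 0 2 6 a 0 a' γ + p c * bdsym 5 0 2 5 a 0 a' γ + q c * bsym 0 5 6 0 a =
        p c * (2 * γ) * a ^ 5 := by
      norm_num [bdsym, bsym, Nat.choose]
      ring
    rw [e]
    have hb : p c * (2 * γ) * a ^ 5 ≤ 22 / 25 * (2 * (1 / 2)) * (241 / 10000) ^ 5 := by gcongr
    exact (add_le_add hb le_rfl).trans (by norm_num [oneSided, Nat.choose])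
  · rw [bdsym_eq_zero (by omega), bdsym_eq_zero (by omega), bsym_eq_zero (by omega)]
    norm_num [oneSided, Nat.choose]

end TwoBlocks

/-! ### The case of seven symbols -/

section Seven

variable {ι : Type*} [DecidableEq ι] [Fintype ι]

set_option maxHeartbeats 1000000 in
/-- Close to the cap the extremal pair has two blocks. The bound `oneSided` for the second summand
of `phi` is used if the third block has at least three symbols, and exact expressions otherwise. -/
lemma phi_le_capped_seven (hn : Fintype.card ι = 7)
    {p q : ι → ℝ} (hpq : (p, q) ∈ cappedPairs fun _ : ι => (91 / 100 : ℝ)) :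
    phi univ 5 p q ≤ 2 * 6 / 7 ^ 5 := by
  have h := phi_le_of_capped (n := 5) (k := 3) (cap := (56, 100)) (target := (2 * 6, 7 ^ 5)) hn
    (by norm_num) (by norm_num) (by norm_num) (by norm_num) (by norm_num) (by decide +kernel)
    (by norm_num [Nat.choose]) (by norm_num [oneSided, Nat.choose]) (fun p q hpq c hc => ?_) hpq
  · exact_mod_cast h
  have hpc := (hpq.1.2.2 c).1
  rcases le_or_gt (p c) (1 - 91 / 1000) with h1 | h1
  · exact phi_le_of_windowsBelow (k := 4) hn (by norm_num) (by norm_num) hpq.1.1 hpq.1.2.1 (a := c)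
      (91 / 1000) (101 / 1000) [177 / 1000, 302 / 1000, 391 / 1000, 44 / 100]
      (by norm_num [windowsBelow, tailBound, oneSided, Nat.choose]) h1
      (by norm_num at hc ⊢; exact hc)
  by_cases h2 : ∃ i, 1 / 2 ≤ q i
  · obtain ⟨i, hi⟩ := h2
    refine (phi_le_of_half_le (k := 4) hn hpq.1.1 hpq.1.2.1 h1.le (c := i) (δ' := 1 / 2)
      (by simp only; linarith) (by norm_num) le_rfl).trans ?_
    norm_num [tailBound, Nat.choose]
  push Not at h2
  simp only at hpc
  have hone := dsym_le_oneSided (k := 4) hn (by norm_num) (by norm_num) hpq.1.1 hpq.1.2.1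
    (δ := 9 / 100) (by norm_num) (fun i => by
      have := (hpq.1.2.2 i).1
      simp only at this ⊢
      linarith) (by norm_num [Nat.choose])
  have hqc := hpq.1.2.1.1 c
  simp only at hqc hone ⊢
  obtain ⟨n₁, n₃, a, a', γ, hsum, ha, hqa', ha', hγ, hγ2, hpa, hqa, hT2, hT1⟩ :=
    hpq.exists_two_blocks hn (by norm_num) (c := c) (by linarith) (by linarith) h2
  have hq1 : 0 ≤ 1 - q c := by rw [← hqa]; positivity
  have hp0 : 0 ≤ p c := by linarith
  have hn₃ : n₃ = 0 ∨ n₃ = 1 ∨ n₃ = 2 ∨ 3 ≤ n₃ := by omega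
  rcases hn₃ with rfl | rfl | rfl | hn₃
  · obtain rfl : n₁ = 6 := by omega
    push_cast at hpa hqa
    have ha2 : a ≤ 91 / 6000 := by linarith
    have e2 : dsym univ 5 p q =
        (1 - q c) * (a ^ 5 + p c * (5 * a ^ 4)) + q c * (6 * a ^ 5) := by
      rw [hT2, ← hqa]
      norm_num [bdsym, bsym, Nat.choose]
      ring
    have hs : q c = 1 - 6 * a' := by linarith
    have e1 : dsym univ 5 q p = a' ^ 4 * (5 * (1 - p c) + a' * (35 * p c - 29)) := by
      have : a = (1 - p c) / 6 := by linarith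
      rw [hT1, hs, this]
      norm_num [bdsym, bsym, Nat.choose]
      ring
    have h5 : p c * (5 * a ^ 4) ≤ 91 / 100 * (5 * (91 / 6000) ^ 4) := by gcongr
    have h6 : a ^ 5 ≤ (91 / 6000) ^ 5 := by gcongr
    have b2 : dsym univ 5 p q ≤ 6 * (91 / 6000) ^ 5 + 91 / 100 * (5 * (91 / 6000) ^ 4) := by
      rw [e2]
      nlinarith [mul_nonneg hqc (sub_nonneg.2 h6), mul_nonneg hq1 (sub_nonneg.2 h5),
        mul_nonneg hq1 (sub_nonneg.2 h6)]
    have b1 : dsym univ 5 q p ≤ (1 / 6) ^ 4 * (37 / 40) := by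
      rw [e1]
      have h7 : 1 ≤ 7 * a' := by linarith
      have h8 : a' ≤ 1 / 6 := by linarith
      gcongr
      · nlinarith
      · nlinarith [mul_nonneg (sub_nonneg.2 h7) (sub_nonneg.2 hpc)]
    exact (add_le_add b2 b1).trans (by norm_num)
  · obtain rfl : n₁ = 5 := by omega
    push_cast at hpa hqa
    have ha2 : a ≤ 91 / 5000 := by linarith
    have e2 : dsym univ 5 p q = p c * (1 - q c + 4 * γ) * a ^ 4 + (γ + q c) * a ^ 5 := by
      rw [hT2, ← hqa]
      norm_num [bdsym, bsym, Nat.choose]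
      ring
    have e1 : dsym univ 5 q p = a' ^ 4 * (p c * a' + (1 + 4 * p c) * γ) +
        q c * ((1 - p c) * (a' ^ 4 + 4 * γ * a' ^ 3)) := by
      have : a = (1 - p c) / 5 := by linarith
      rw [hT1, this]
      norm_num [bdsym, bsym, Nat.choose]
      ring
    -- Moving the mass `q c` to the symbol of the third block increases the second summand of `phi`.
    have b1 : dsym univ 5 q p ≤ (116 / 25 - 2229 / 100 * a') * a' ^ 4 := by
      have h3 : 0 ≤ 5 * p c * a' - 4 * (1 - p c) * γ := by nlinarith
      have h4 : 0 ≤ q c * a' ^ 3 * (5 * p c * a' - 4 * (1 - p c) * γ) := by positivity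
      have h5 : 0 ≤ a' ^ 4 * ((91 / 100 - p c) * (4 - 19 * a')) :=
        mul_nonneg (by positivity) (mul_nonneg (by linarith) (by linarith))
      have hs : q c = 1 - 5 * a' - γ := by linarith
      rw [e1]
      rw [hs] at h4 ⊢
      linarith
    have b2 : ∀ g, γ ≤ g → dsym univ 5 p q ≤
        91 / 100 * (1 - 0 + 4 * g) * (91 / 5000) ^ 4 + 1 * (91 / 5000) ^ 5 := by
      intro g hg
      rw [e2]
      gcongr <;> linarith
    rcases le_total a' (7 / 50) with h3 | h3
    · have h4 := pow_mul_sub_le 4 ha' (w₀ := 7 / 50) (by norm_num)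
      have h5 : a' ^ 4 ≤ (7 / 50) ^ 4 := by gcongr
      have b3 : (116 / 25 - 2229 / 100 * a') * a' ^ 4 ≤
          2229 / 400 * (7 / 50) ^ 5 + 74 / 100 * (7 / 50) ^ 4 := by
        push_cast at h4
        linarith [pow_nonneg ha' 4]
      exact (add_le_add (b2 _ hγ2.le) (b1.trans b3)).trans (by norm_num)
    · have b3 := sub_mul_pow_le 4 (by norm_num) (A := 116 / 25) (B := 2229 / 100) (by norm_num)
        (by norm_num) ha'
      exact (add_le_add (b2 (3 / 10) (by linarith)) (b1.trans b3)).trans (by norm_num)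
  · obtain rfl : n₁ = 4 := by omega
    push_cast at hpa hqa
    have ha2 : a ≤ 91 / 4000 := by linarith
    have e2 : dsym univ 5 p q = p c * (2 * γ) * a ^ 4 := by
      rw [hT2]
      norm_num [bdsym, bsym, Nat.choose]
      ring
    have b2 : ∀ g, γ ≤ g → dsym univ 5 p q ≤ 91 / 100 * (2 * g) * (91 / 4000) ^ 4 := by
      intro g hg
      rw [e2]
      have := hγ.trans hg
      gcongr
    rcases le_total γ (1 / 4) with h3 | h3
    · exact (add_le_add (b2 _ h3) hone).trans (by norm_num [oneSided, Nat.choose])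
    · have e1 : dsym univ 5 q p = (1 - p c) * ((a' * γ) ^ 2 * a' +
          q c * (2 * (a' * γ) * a' ^ 2 + 3 * (a' * γ) ^ 2)) +
          p c * (2 * (a' * γ) * a' ^ 3 + 4 * (a' * γ) ^ 2 * a') := by
        have : a = (1 - p c) / 4 := by linarith
        rw [hT1, this]
        norm_num [bdsym, bsym, Nat.choose]
        ring
      have h4 : a' ≤ 1 / 8 := by linarith
      have h5 : a' * γ ≤ 1 / 32 := by nlinarith [sq_nonneg (γ - 1 / 4)]
      have h6 : q c ≤ 1 / 8 := hqa'.trans h4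
      have h7 : 1 - p c ≤ 91 / 1000 := by linarith
      have h8 : 0 ≤ 1 - p c := by linarith
      have b1 : dsym univ 5 q p ≤ 91 / 1000 * ((1 / 32) ^ 2 * (1 / 8) +
          1 / 8 * (2 * (1 / 32) * (1 / 8) ^ 2 + 3 * (1 / 32) ^ 2)) +
          91 / 100 * (2 * (1 / 32) * (1 / 8) ^ 3 + 4 * (1 / 32) ^ 2 * (1 / 8)) := by
        rw [e1]
        gcongr
      exact (add_le_add (b2 _ hγ2.le) b1).trans (by norm_num)
  · have e2 : dsym univ 5 p q = 0 := by
      rw [hT2, bdsym_eq_zero (by omega), bdsym_eq_zero (by omega), bsym_eq_zero (by omega)]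
      ring
    exact (add_le_add e2.le hone).trans (by norm_num [oneSided, Nat.choose])

end Seven

/-! ### Suprema of `Ψ` over clusters -/

section Suprema

variable {b j : ℕ}

lemma Psi_comp_perm (b j : ℕ) (τ : Equiv.Perm (Fin b)) (p q : Fin b → ℝ) :
    Psi b j (p ∘ τ) (q ∘ τ) = Psi b j p q := by
  rw [Psi, Psi]
  congr 1
  exact Fintype.sum_equiv (Equiv.mulLeft τ) _ _ fun σ => rfl

lemma continuous_Psi (b j : ℕ) :
    Continuous fun z : (Fin b → ℝ) × (Fin b → ℝ) => Psi b j z.1 z.2 := by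
  unfold Psi
  fun_prop

lemma Psi_nonneg {p q : Fin b → ℝ} (hp : p ∈ ProbDist b) (hq : q ∈ ProbDist b) :
    0 ≤ Psi b j p q := by
  have := hp.1
  have := hq.1
  unfold Psi
  exact mul_nonneg (by positivity) (sum_nonneg fun σ _ => add_nonneg
    (mul_nonneg (prod_nonneg fun _ _ => hp.1 _) (prod_nonneg fun _ _ => hq.1 _))
    (mul_nonneg (prod_nonneg fun _ _ => hq.1 _) (prod_nonneg fun _ _ => hp.1 _)))

lemma supPsi_le {A B : Set (Fin b → ℝ)} {c : ℝ} (hc : 0 ≤ c)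
    (h : ∀ p ∈ A, ∀ q ∈ B, Psi b j p q ≤ c) : supPsi b j A B ≤ c := by
  refine Real.sSup_le ?_ hc
  rintro x ⟨p, hp, q, hq, rfl⟩
  exact h p hp q hq

lemma le_supPsi {A B : Set (Fin b → ℝ)} (hA : A ⊆ ProbDist b) (hB : B ⊆ ProbDist b)
    {p q : Fin b → ℝ} (hp : p ∈ A) (hq : q ∈ B) : Psi b j p q ≤ supPsi b j A B := by
  refine le_csSup ?_ ⟨p, hp, q, hq, rfl⟩
  have hS := isCompact_stdSimplex (𝕜 := ℝ) (Fin b)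
  have hK := (hS.prod hS).image (continuous_Psi b j)
  refine hK.bddAbove.mono ?_
  rintro x ⟨p, hp, q, hq, rfl⟩
  exact ⟨(p, q), ⟨hA hp, hB hq⟩, rfl⟩

lemma supPsi_nonneg {A B : Set (Fin b → ℝ)} (hA : A ⊆ ProbDist b) (hB : B ⊆ ProbDist b) :
    0 ≤ supPsi b j A B := by
  refine Real.sSup_nonneg ?_
  rintro x ⟨p, hp, q, hq, rfl⟩
  exact Psi_nonneg (hA hp) (hB hq)

/-- By continuity, the supremum of `Ψ` does not change when the sets are enlarged within their
closures. -/
lemma supPsi_eq_of_closure {A B A' B' : Set (Fin b → ℝ)} (hA : A ⊆ A') (hB : B ⊆ B')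
    (hA' : A' ⊆ closure A) (hB' : B' ⊆ closure B) (hA1 : A' ⊆ ProbDist b)
    (hB1 : B' ⊆ ProbDist b) : supPsi b j A B = supPsi b j A' B' := by
  apply le_antisymm
  · exact supPsi_le (supPsi_nonneg hA1 hB1) fun p hp q hq => le_supPsi hA1 hB1 (hA hp) (hB hq)
  · refine supPsi_le (supPsi_nonneg (hA.trans hA1) (hB.trans hB1)) fun p hp q hq => ?_
    have hcl : IsClosed {z : (Fin b → ℝ) × (Fin b → ℝ) | Psi b j z.1 z.2 ≤ supPsi b j A B} :=
      isClosed_le (continuous_Psi b j) continuous_const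
    have hsub : closure (A ×ˢ B) ⊆
        {z : (Fin b → ℝ) × (Fin b → ℝ) | Psi b j z.1 z.2 ≤ supPsi b j A B} :=
      hcl.closure_subset_iff.2 fun z hz => le_supPsi (hA.trans hA1) (hB.trans hB1) hz.1 hz.2
    rw [closure_prod_eq] at hsub
    exact hsub (show (p, q) ∈ closure A ×ˢ closure B from ⟨hA' hp, hB' hq⟩)

lemma supPsi_comp_perm (τ : Equiv.Perm (Fin b)) {A B A' B' : Set (Fin b → ℝ)}
    (hA : ∀ p, p ∘ τ ∈ A ↔ p ∈ A') (hB : ∀ p, p ∘ τ ∈ B ↔ p ∈ B') :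
    supPsi b j A' B' = supPsi b j A B := by
  unfold supPsi
  congr 1
  ext x
  have hτ : ∀ p : Fin b → ℝ, (p ∘ τ.symm) ∘ τ = p := fun p => by ext; simp
  constructor
  · rintro ⟨p, hp, q, hq, rfl⟩
    exact ⟨p ∘ τ, (hA p).2 hp, q ∘ τ, (hB q).2 hq, (Psi_comp_perm b j τ p q).symm⟩
  · rintro ⟨p, hp, q, hq, rfl⟩
    refine ⟨p ∘ τ.symm, (hA _).1 (by rwa [hτ]), q ∘ τ.symm, (hB _).1 (by rwa [hτ]),
      (Psi_comp_perm b j τ.symm p q).symm⟩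

lemma exists_perm_apply {i₀ h₀ i h : Fin b} (h₀' : i₀ ≠ h₀) (hih : i ≠ h) :
    ∃ τ : Equiv.Perm (Fin b), τ i₀ = i ∧ τ h₀ = h := by
  refine ⟨Equiv.swap i₀ i * Equiv.swap h₀ (Equiv.swap i₀ i h), ?_, ?_⟩
  · rw [Equiv.Perm.mul_apply, Equiv.swap_apply_of_ne_of_ne h₀', Equiv.swap_apply_left]
    intro h1
    have h2 := congrArg (Equiv.swap i₀ i) h1
    rw [Equiv.swap_apply_left, Equiv.swap_apply_self] at h2
    exact hih h2
  · rw [Equiv.Perm.mul_apply, Equiv.swap_apply_left, Equiv.swap_apply_self]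

lemma comp_mem_probDist (τ : Equiv.Perm (Fin b)) (p : Fin b → ℝ) :
    p ∘ τ ∈ ProbDist b ↔ p ∈ ProbDist b := by
  simp only [ProbDist, stdSimplex, Set.mem_ofPred_eq, Function.comp_apply, Equiv.sum_comp τ p]
  rw [τ.forall_congr_left (p := fun i => 0 ≤ p (τ i))]
  simp

/-- By symmetry it suffices to consider one pair of symbols. -/
lemma isPartitionMax_of {B : Set (Fin b → ℝ)} {U : Fin b → Set (Fin b → ℝ)} {M : ℝ}
    (hB : ∀ (τ : Equiv.Perm (Fin b)) p, p ∘ τ ∈ B ↔ p ∈ B)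
    (hU : ∀ (τ : Equiv.Perm (Fin b)) i p, p ∘ τ ∈ U i ↔ p ∈ U (τ i)) {i₀ h₀ : Fin b}
    (hih : i₀ ≠ h₀)
    (h : IsClusterMax b (supPsi b j B B) (supPsi b j B (U i₀)) (supPsi b j (U i₀) (U i₀))
      (supPsi b j (U i₀) (U h₀)) M) : IsPartitionMax b j B U M := by
  intro i h' hih'
  obtain ⟨τ, rfl, rfl⟩ := exists_perm_apply hih hih'
  rwa [supPsi_comp_perm τ (hB τ) (hU τ i₀), supPsi_comp_perm τ (hU τ i₀) (hU τ i₀),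
    supPsi_comp_perm τ (hU τ i₀) (hU τ h₀)]

lemma isPartitionMax_max {ε M : ℝ} {i₀ h₀ : Fin b} (hih : i₀ ≠ h₀)
    (h : IsClusterMax b (supPsi b j (maxBalanced b ε) (maxBalanced b ε))
      (supPsi b j (maxBalanced b ε) (maxUnbalanced b ε i₀))
      (supPsi b j (maxUnbalanced b ε i₀) (maxUnbalanced b ε i₀))
      (supPsi b j (maxUnbalanced b ε i₀) (maxUnbalanced b ε h₀)) M) :
    IsPartitionMax b j (maxBalanced b ε) (maxUnbalanced b ε) M := by
  refine isPartitionMax_of (fun τ p => ?_) (fun τ i p => ?_) hih h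
  · simp only [maxBalanced, Set.mem_ofPred_eq, comp_mem_probDist, Function.comp_apply]
    rw [τ.forall_congr_left (p := fun i => p (τ i) ≤ 1 - ε)]
    simp
  · simp only [maxUnbalanced, Set.mem_ofPred_eq, comp_mem_probDist, Function.comp_apply]

/-- The distributions whose smallest entry is at most `ε` and is attained at `i`: the closure of
the unbalanced cluster `minUnbalanced b ε i`. -/
def minClosed (b : ℕ) (ε : ℝ) (i : Fin b) : Set (Fin b → ℝ) :=
  {p | p ∈ ProbDist b ∧ p i ≤ ε ∧ ∀ h, p i ≤ p h}

lemma minUnbalanced_subset (ε : ℝ) (i : Fin b) : minUnbalanced b ε i ⊆ minClosed b ε i :=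
  fun _ hp => ⟨hp.1, hp.2.1.le, hp.2.2.1⟩

lemma minClosed_subset (ε : ℝ) (i : Fin b) : minClosed b ε i ⊆ ProbDist b := fun _ hp => hp.1

/-- Moving a little towards the uniform distribution on the symbols other than `i` makes the
smallest entry unique. -/
lemma minClosed_subset_closure (hb : 2 ≤ b) {ε : ℝ} (hε : 0 < ε) (i : Fin b) :
    minClosed b ε i ⊆ closure (minUnbalanced b ε i) := by
  rintro p ⟨⟨hp0, hp1⟩, hpε, hpi⟩
  have hb' : (0 : ℝ) < b - 1 := by
    have : (2 : ℝ) ≤ b := by exact_mod_cast hb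
    linarith
  set v : Fin b → ℝ := fun h => if h = i then 0 else 1 / (b - 1) with hv
  have hv1 : ∑ h, v h = 1 := by
    rw [hv, sum_ite]
    simp only [sum_const_zero, sum_const, nsmul_eq_mul, zero_add]
    rw [filter_ne', card_erase_of_mem (mem_univ i), card_univ, Fintype.card_fin,
      Nat.cast_sub (by omega)]
    push_cast
    field_simp
  set f : ℝ → Fin b → ℝ := fun t h => (1 - t) * p h + t * v h with hf
  have hcont : Continuous f := by rw [hf]; fun_prop
  have hlim : Filter.Tendsto f (nhdsWithin 0 (Set.Ioo 0 1)) (nhds (f 0)) :=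
    (hcont.tendsto 0).mono_left nhdsWithin_le_nhds
  have h0 : f 0 = p := by ext h; simp [hf]
  rw [h0] at hlim
  have hne : (nhdsWithin (0 : ℝ) (Set.Ioo 0 1)).NeBot := by
    rw [← mem_closure_iff_nhdsWithin_neBot, closure_Ioo zero_ne_one]
    exact ⟨le_rfl, zero_le_one⟩
  refine mem_closure_of_tendsto hlim (Filter.eventually_of_mem self_mem_nhdsWithin ?_)
  rintro t ⟨ht0, ht1⟩
  have hvi : v i = 0 := by simp [hv]
  have hvh : ∀ h, h ≠ i → 0 < v h := by
    intro h hh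
    simp only [hv, if_neg hh]
    positivity
  have hv0 : ∀ h, 0 ≤ v h := by
    intro h
    rcases eq_or_ne h i with rfl | hh
    exacts [hvi.ge, (hvh h hh).le]
  have hle : ∀ h, f t i ≤ f t h := by
    intro h
    simp only [hf, hvi]
    linarith [mul_nonneg (sub_nonneg.2 ht1.le) (sub_nonneg.2 (hpi h)), mul_nonneg ht0.le (hv0 h)]
  refine ⟨⟨fun h => ?_, ?_⟩, ?_, hle, fun h hh => ?_⟩
  · exact add_nonneg (mul_nonneg (by linarith) (hp0 h)) (mul_nonneg ht0.le (hv0 h))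
  · simp only [hf]
    rw [sum_add_distrib, ← mul_sum, ← mul_sum, hp1, hv1]
    ring
  · simp only [hf, hvi]
    nlinarith [hp0 i]
  · simp only [hf, hvi]
    linarith [mul_nonneg (sub_nonneg.2 ht1.le) (sub_nonneg.2 (hpi h)),
      mul_pos ht0 (hvh h hh.ne)]

lemma minBalanced_subset (b : ℕ) (ε : ℝ) : minBalanced b ε ⊆ ProbDist b := fun _ hp => hp.1

lemma maxBalanced_subset (b : ℕ) (ε : ℝ) : maxBalanced b ε ⊆ ProbDist b := fun _ hp => hp.1

lemma maxUnbalanced_subset (ε : ℝ) (i : Fin b) : maxUnbalanced b ε i ⊆ ProbDist b :=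
  fun _ hp => hp.1

lemma minBalanced_comp {ε : ℝ} (τ : Equiv.Perm (Fin b)) (p : Fin b → ℝ) :
    p ∘ τ ∈ minBalanced b ε ↔ p ∈ minBalanced b ε := by
  simp only [minBalanced, Set.mem_ofPred_eq, comp_mem_probDist, Function.comp_apply]
  rw [τ.forall_congr_left (p := fun i => ε ≤ p (τ i))]
  simp

lemma minClosed_comp {ε : ℝ} (τ : Equiv.Perm (Fin b)) (i : Fin b) (p : Fin b → ℝ) :
    p ∘ τ ∈ minClosed b ε i ↔ p ∈ minClosed b ε (τ i) := by
  simp only [minClosed, Set.mem_ofPred_eq, comp_mem_probDist, Function.comp_apply]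
  rw [τ.forall_congr_left (p := fun h => p (τ i) ≤ p (τ h))]
  simp

/-- The coefficients of the cluster form for the minimum-based partition are those for the closed
clusters of any two symbols. -/
lemma supPsi_min_eq (hb : 2 ≤ b) {ε : ℝ} (hε : 0 < ε) {i₀ h₀ i h : Fin b} (h₀' : i₀ ≠ h₀)
    (hih : i ≠ h) :
    supPsi b j (minBalanced b ε) (minUnbalanced b ε i) =
      supPsi b j (minBalanced b ε) (minClosed b ε i₀) ∧
    supPsi b j (minUnbalanced b ε i) (minUnbalanced b ε i) =
      supPsi b j (minClosed b ε i₀) (minClosed b ε i₀) ∧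
    supPsi b j (minUnbalanced b ε i) (minUnbalanced b ε h) =
      supPsi b j (minClosed b ε i₀) (minClosed b ε h₀) := by
  obtain ⟨τ, rfl, rfl⟩ := exists_perm_apply h₀' hih
  have hcl : ∀ l, minClosed b ε l ⊆ closure (minUnbalanced b ε l) :=
    minClosed_subset_closure hb hε
  rw [supPsi_eq_of_closure subset_rfl (minUnbalanced_subset ε (τ i₀)) subset_closure (hcl _)
      (minBalanced_subset b ε) (minClosed_subset ε _),
    supPsi_eq_of_closure (minUnbalanced_subset ε (τ i₀)) (minUnbalanced_subset ε (τ i₀)) (hcl _)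
      (hcl _) (minClosed_subset ε _) (minClosed_subset ε _),
    supPsi_eq_of_closure (minUnbalanced_subset ε (τ i₀)) (minUnbalanced_subset ε (τ h₀)) (hcl _)
      (hcl _) (minClosed_subset ε _) (minClosed_subset ε _)]
  exact ⟨supPsi_comp_perm τ (minBalanced_comp τ) (minClosed_comp τ i₀),
    supPsi_comp_perm τ (minClosed_comp τ i₀) (minClosed_comp τ i₀),
    supPsi_comp_perm τ (minClosed_comp τ i₀) (minClosed_comp τ h₀)⟩

lemma isPartitionMax_min (hb : 2 ≤ b) {ε M : ℝ} (hε : 0 < ε) {i₀ h₀ : Fin b} (hih : i₀ ≠ h₀)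
    (h : IsClusterMax b (supPsi b j (minBalanced b ε) (minBalanced b ε))
      (supPsi b j (minBalanced b ε) (minClosed b ε i₀))
      (supPsi b j (minClosed b ε i₀) (minClosed b ε i₀))
      (supPsi b j (minClosed b ε i₀) (minClosed b ε h₀)) M) :
    IsPartitionMax b j (minBalanced b ε) (minUnbalanced b ε) M := by
  intro i h' hih'
  obtain ⟨h1, h2, h3⟩ := supPsi_min_eq (j := j) hb hε hih hih'
  rwa [h1, h2, h3]

end Suprema

/-! ### The maximum of the cluster form -/

section Clusters

variable {b : ℕ} {M₁ M₂ M₃ M₄ M : ℝ}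

lemma sum_sq_add_two_mul_sum_lt (x : Fin b → ℝ) :
    ∑ i, x i ^ 2 + 2 * ∑ i, ∑ h with i < h, x i * x h = (∑ i, x i) ^ 2 := by
  have h1 : ∑ i, ∑ h with h < i, x i * x h = ∑ i, ∑ h with i < h, x i * x h := by
    simp only [sum_filter]
    rw [sum_comm]
    refine sum_congr rfl fun i _ => sum_congr rfl fun h _ => ?_
    rw [mul_comm]
  have h2 : ∀ i, x i * ∑ h, x h =
      x i ^ 2 + ∑ h with i < h, x i * x h + ∑ h with h < i, x i * x h := by
    intro i
    rw [mul_sum, ← sum_filter_add_sum_filter_not univ (fun h => i < h)]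
    have h3 : (univ.filter fun h => ¬ i < h) = insert i (univ.filter fun h => h < i) := by
      ext h
      simp [le_iff_lt_or_eq, or_comm]
    rw [h3, sum_insert (by simp)]
    ring
  rw [sq, sum_mul, sum_congr rfl fun i _ => h2 i, sum_add_distrib, sum_add_distrib, h1]
  ring

lemma clusterForm_eq (η : Fin (b + 1) → ℝ) :
    clusterForm b M₁ M₂ M₃ M₄ η = η 0 ^ 2 * M₁ + 2 * η 0 * (∑ i : Fin b, η i.succ) * M₂ +
      (∑ i : Fin b, η i.succ ^ 2) * M₃ +
      ((∑ i : Fin b, η i.succ) ^ 2 - ∑ i : Fin b, η i.succ ^ 2) * M₄ := by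
  rw [← sum_sq_add_two_mul_sum_lt fun i : Fin b => η i.succ]
  simp only [clusterForm, ← sum_mul]
  ring

lemma exists_isClusterMax (b : ℕ) (M₁ M₂ M₃ M₄ : ℝ) : ∃ M, IsClusterMax b M₁ M₂ M₃ M₄ M := by
  have hcont : Continuous (clusterForm b M₁ M₂ M₃ M₄) := by
    unfold clusterForm
    fun_prop
  have hne : (stdSimplex ℝ (Fin (b + 1))).Nonempty := ⟨_, single_mem_stdSimplex ℝ 0⟩
  obtain ⟨M, hM⟩ := (((isCompact_stdSimplex (𝕜 := ℝ) (Fin (b + 1))).image hcont)).exists_isGreatest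
    (hne.image _)
  exact ⟨M, hM⟩

/-- A lower bound for the maximum of the cluster form: the weight `x` is spread evenly over the
unbalanced clusters. -/
lemma IsClusterMax.le (h : IsClusterMax b M₁ M₂ M₃ M₄ M) (hb : 0 < b) {x m₁ m₂ m₃ m₄ : ℝ}
    (hx0 : 0 ≤ x) (hx1 : x ≤ 1) (h₁ : m₁ ≤ M₁) (h₂ : m₂ ≤ M₂) (h₃ : m₃ ≤ M₃) (h₄ : m₄ ≤ M₄) :
    (1 - x) ^ 2 * m₁ + 2 * (1 - x) * x * m₂ + x ^ 2 * ((m₃ + (b - 1) * m₄) / b) ≤ M := by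
  have hb' : (1 : ℝ) ≤ b := by exact_mod_cast hb
  have hb0 : (b : ℝ) ≠ 0 := by positivity
  set η : Fin (b + 1) → ℝ := Fin.cons (1 - x) fun _ => x / b with hη
  have hmem : η ∈ stdSimplex ℝ (Fin (b + 1)) := by
    constructor
    · intro i
      refine Fin.cases ?_ (fun i => ?_) i
      · simpa [hη] using hx1
      · simp only [hη, Fin.cons_succ]
        positivity
    · rw [Fin.sum_univ_succ]
      simp only [hη, Fin.cons_zero, Fin.cons_succ, sum_const, card_univ, Fintype.card_fin,
        nsmul_eq_mul]
      field_simp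
      ring
  refine le_trans ?_ (h.2 ⟨η, hmem, rfl⟩)
  rw [clusterForm_eq]
  simp only [hη, Fin.cons_zero, Fin.cons_succ, sum_const, card_univ, Fintype.card_fin,
    nsmul_eq_mul]
  have e : (1 - x) ^ 2 * M₁ + 2 * (1 - x) * (b * (x / b)) * M₂ + b * (x / b) ^ 2 * M₃ +
      ((b * (x / b)) ^ 2 - b * (x / b) ^ 2) * M₄ =
      (1 - x) ^ 2 * M₁ + 2 * (1 - x) * x * M₂ + x ^ 2 * ((M₃ + (b - 1) * M₄) / b) := by
    field_simp
    ring
  rw [e]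
  have := sub_nonneg.2 hx1
  have := sub_nonneg.2 hb'
  gcongr

/-- An upper bound `T` for the maximum of the cluster form. For a given total weight `x` of the
unbalanced clusters an even distribution is best, because `m₃ ≤ m₄`; the remaining quadratic form in
`1 - x` and `x` is compared with `T * ((1 - x) + x) ^ 2`. -/
lemma IsClusterMax.le_of_le (h : IsClusterMax b M₁ M₂ M₃ M₄ M) (hb : 0 < b)
    {m₁ m₂ m₃ m₄ T : ℝ} (h₁ : M₁ ≤ m₁) (h₂ : M₂ ≤ m₂) (h₃ : M₃ ≤ m₃) (h₄ : M₄ ≤ m₄)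
    (h₃₄ : m₃ ≤ m₄) (hT₁ : m₁ ≤ T) (hT₂ : (m₃ + (b - 1) * m₄) / b ≤ T)
    (hT : m₂ ≤ T ∨ (m₂ - T) ^ 2 ≤ (T - m₁) * (T - (m₃ + (b - 1) * m₄) / b)) : M ≤ T := by
  obtain ⟨⟨η, ⟨hη0, hη1⟩, rfl⟩, -⟩ := h
  have hb' : (0 : ℝ) < b := by exact_mod_cast hb
  rw [clusterForm_eq]
  rw [Fin.sum_univ_succ] at hη1
  set x := ∑ i : Fin b, η i.succ with hx
  set y := ∑ i : Fin b, η i.succ ^ 2 with hy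
  have hx0 : 0 ≤ x := sum_nonneg fun i _ => hη0 _
  have hy0 : 0 ≤ y := sum_nonneg fun i _ => sq_nonneg _
  have hxy : x ^ 2 ≤ b * y := by
    have := sq_sum_le_card_mul_sum_sq (s := univ) (f := fun i : Fin b => η i.succ)
    simpa using this
  have hyx : y ≤ x ^ 2 := sum_sq_le_sq_sum_of_nonneg fun i _ => hη0 _
  have e0 : η 0 = 1 - x := by linarith
  have hx1 : 0 ≤ 1 - x := e0 ▸ hη0 0
  rw [e0]
  set L := (m₃ + (b - 1) * m₄) / b with hL
  have step : (1 - x) ^ 2 * M₁ + 2 * (1 - x) * x * M₂ + y * M₃ + (x ^ 2 - y) * M₄ ≤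
      (1 - x) ^ 2 * m₁ + 2 * (1 - x) * x * m₂ + x ^ 2 * L := by
    have h5 : y * M₃ + (x ^ 2 - y) * M₄ ≤ y * m₃ + (x ^ 2 - y) * m₄ :=
      add_le_add (mul_le_mul_of_nonneg_left h₃ hy0) (mul_le_mul_of_nonneg_left h₄ (by linarith))
    have h6 : y * m₃ + (x ^ 2 - y) * m₄ ≤ x ^ 2 * L := by
      have h7 : x ^ 2 / b ≤ y := by rw [div_le_iff₀ hb']; linarith
      have h8 : x ^ 2 * L = x ^ 2 * m₄ - x ^ 2 / b * (m₄ - m₃) := by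
        rw [hL]; field_simp; ring
      nlinarith
    have h9 : (1 - x) ^ 2 * M₁ ≤ (1 - x) ^ 2 * m₁ := by gcongr
    have h10 : 2 * (1 - x) * x * M₂ ≤ 2 * (1 - x) * x * m₂ := by gcongr
    linarith
  refine step.trans ?_
  rcases hT with hT | hT
  · nlinarith [mul_nonneg hx0 hx1, mul_nonneg (mul_nonneg hx0 hx1) (sub_nonneg.2 hT),
      mul_nonneg (sq_nonneg (1 - x)) (sub_nonneg.2 hT₁),
      mul_nonneg (sq_nonneg x) (sub_nonneg.2 hT₂)]
  · have hα := sub_nonneg.2 hT₁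
    have hγ := sub_nonneg.2 hT₂
    have key : |2 * (1 - x) * x * (m₂ - T)| ≤ (1 - x) ^ 2 * (T - m₁) + x ^ 2 * (T - L) := by
      apply abs_le_of_sq_le_sq
      · nlinarith [sq_nonneg ((1 - x) ^ 2 * (T - m₁) - x ^ 2 * (T - L)),
          mul_le_mul_of_nonneg_left hT (sq_nonneg ((1 - x) * x))]
      · positivity
    have := (abs_le.1 key).2
    nlinarith

end Clusters

/-! ### The value of `Ψ` at vectors with at most three different entries -/

section Witnesses

/-- A vector whose entries are `y` at the first symbol, `z` at the second one, and `w` at the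
others. -/
def vec (n : ℕ) (y z w : ℝ) : Fin (n + 2) → ℝ := Fin.cons y (Fin.cons z fun _ => w)

lemma vec_mem {n : ℕ} {y z w : ℝ} (hy : 0 ≤ y) (hz : 0 ≤ z) (hw : 0 ≤ w) (h : y + z + n * w = 1) :
    vec n y z w ∈ ProbDist (n + 2) := by
  constructor
  · intro i
    refine Fin.cases hy (fun i => Fin.cases hz (fun i => hw) i) i
  · rw [Fin.sum_univ_succ, Fin.sum_univ_succ]
    simp [vec]
    linarith

lemma forall_vec {n : ℕ} {y z w : ℝ} {P : ℝ → Prop} (hy : P y) (hz : P z) (hw : P w)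
    (i : Fin (n + 2)) : P (vec n y z w i) :=
  Fin.cases hy (fun i => Fin.cases hz (fun _ => hw) i) i

lemma Psi_vec {n k : ℕ} (hk : k < n) (y z w y' z' w' : ℝ) :
    Psi (n + 2) (k + 2) (vec n y z w) (vec n y' z' w') = (k + 2).factorial *
      (n * w' * ((n - 1).choose (k + 2) * w ^ (k + 2)) +
        n * w * ((n - 1).choose (k + 2) * w' ^ (k + 2)) +
      (y + z) *
        (n * w' * ((n - 1).choose (k + 1) * w ^ (k + 1)) + n.choose (k + 2) * w' ^ (k + 2)) +
      (y' + z') *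
        (n * w * ((n - 1).choose (k + 1) * w' ^ (k + 1)) + n.choose (k + 2) * w ^ (k + 2)) +
      y * z * (n * w' * ((n - 1).choose k * w ^ k)) +
      y' * z' * (n * w * ((n - 1).choose k * w' ^ k)) +
      (y * z' + z * y') *
        (n.choose (k + 1) * w ^ (k + 1) + n.choose (k + 1) * w' ^ (k + 1))) := by
  rw [Psi_eq (by omega)]
  congr 1
  set s : Finset (Fin (n + 2)) := (univ.erase 0).erase 1 with hs
  have h01 : (0 : Fin (n + 2)) ≠ 1 := by
    simp
  have hcard : s.card = n := card_erase_erase (by simp) h01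
  have hu : insert 0 (insert 1 s) = (univ : Finset (Fin (n + 2))) := by
    rw [hs, insert_erase (mem_erase.2 ⟨h01.symm, mem_univ _⟩), insert_erase (mem_univ _)]
  have hv : ∀ (y z w : ℝ), ∀ i ∈ s, vec n y z w i = w := by
    intro y z w i hi
    rw [hs, mem_erase, mem_erase] at hi
    revert hi
    refine Fin.cases (fun h => absurd rfl h.2.1)
      (fun i => Fin.cases (fun h => ?_) (fun _ _ => rfl) i) i
    exact absurd rfl h.1
  have he : ∀ (y z w : ℝ) (l : ℕ), esym s l (vec n y z w) = n.choose l * w ^ l := by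
    intro y z w l
    rw [esym_const l (hv y z w), hcard]
  have hd : ∀ (y z w y' z' w' : ℝ) (l : ℕ), dsym s l (vec n y z w) (vec n y' z' w') =
      n * w' * ((n - 1).choose l * w ^ l) := by
    intro y z w y' z' w' l
    have h1 : ∀ i ∈ s, vec n y' z' w' i * esym (s.erase i) l (vec n y z w) =
        w' * ((n - 1).choose l * w ^ l) := by
      intro i hi
      rw [hv _ _ _ i hi, esym_const l fun h hh => hv y z w h (mem_of_mem_erase hh),
        card_erase_of_mem hi, hcard]
    rw [dsym, sum_congr rfl h1, sum_const, hcard, nsmul_eq_mul]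
    ring
  rw [← hu, phi_insert_insert h01 (by simp [hs]) (by simp [hs]), phi]
  simp only [he, hd]
  have e0 : ∀ y z w : ℝ, vec n y z w 0 = y := fun _ _ _ => rfl
  have e1 : ∀ y z w : ℝ, vec n y z w 1 = z := fun _ _ _ => rfl
  simp only [e0, e1]

end Witnesses

/-! ### The maximum-based partitions -/

section MaxPartition

/-- The bound `tailBound` is monotone in the mass outside of the largest entry. -/
lemma tailBound_le_tailBound (n : ℕ) {k : ℕ} (hk : 0 < k) {δ ε : ℝ} (hδ : 0 ≤ δ) (hδε : δ ≤ ε)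
    (hε : ε ≤ 1 / 2) : tailBound n k (1 - δ) δ ≤ tailBound n k (1 - ε) ε := by
  obtain ⟨k, rfl⟩ : ∃ l, k = l + 1 := ⟨k - 1, by omega⟩
  have h1 : (1 - δ) * δ ≤ (1 - ε) * ε := by
    nlinarith [mul_nonneg (sub_nonneg.2 hδε) (by linarith : 0 ≤ 1 - ε - δ)]
  have h2 : (1 - δ) * δ * δ ^ k ≤ (1 - ε) * ε * ε ^ k :=
    mul_le_mul h1 (pow_le_pow_left₀ hδ hδε k) (pow_nonneg hδ k)
      (mul_nonneg (by linarith) (by linarith))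
  have e : ∀ x : ℝ, (1 - x) * (n.choose (k + 1) * (x / n) ^ (k + 1)) =
      (1 - x) * x * x ^ k * (n.choose (k + 1) / n ^ (k + 1)) := by
    intro x
    rw [div_pow]
    ring
  unfold tailBound
  rw [e, e]
  gcongr

/-- The maximum `M` for a maximum-based partition. The largest value of `Ψ` on the balanced cluster
is attained at a pair of uniform distributions, by the hypothesis `hG`. The coefficient `M₂` is
attained at a vertex and the uniform distribution on the other symbols, and `M₃`, `M₄` are
small; a witness with entries `P` gives the lower bound for `M₄`. The weight `x` of the unbalanced
clusters is close to the optimal one. -/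
lemma exists_isPartitionMax_max {n k : ℕ} (hk : k < n) {ε P x t e : ℝ} (hε : 0 < ε)
    (hε2 : ε ≤ 1 / 2) (hεn : (n + 2) * ε ≤ n + 1)
    (hG : ∀ p q, (p, q) ∈ cappedPairs (fun _ : Fin (n + 2) => 1 - ε) →
      phi univ (k + 2) p q ≤ 2 * (n + 1).choose (k + 2) / (n + 2) ^ (k + 2))
    (hB : (n.choose (k + 2) : ℝ) < (1 - ε) * n * n.choose (k + 1))
    (hle : oneSided n (k + 1) ε + tailBound n (k + 1) 1 ε ≤ oneSided n (k + 1) 0)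
    (hP : 1 - ε < P) (hP1 : P ≤ 1) (hx0 : 0 ≤ x) (hx1 : x ≤ 1) {m₁ m₂ m₃ m₄ m₄' : ℝ}
    (hm₁ : m₁ = (k + 2).factorial * (2 * (n + 1).choose (k + 2) / (n + 2) ^ (k + 2)))
    (hm₂ : m₂ = (k + 2).factorial * oneSided n (k + 1) 0)
    (hm₃ : (k + 2).factorial * (2 * ((n + 1).choose (k + 2) * (ε / (n + 1)) ^ (k + 2) +
      ε * tailBound n (k + 1) 1 ε)) ≤ m₃)
    (hm₄ : (k + 2).factorial * (2 * tailBound n (k + 1) (1 - ε) ε) ≤ m₄)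
    (hu : Psi (n + 2) (k + 2) (vec n (1 / (n + 2)) (1 / (n + 2)) (1 / (n + 2)))
      (vec n (1 / (n + 2)) (1 / (n + 2)) (1 / (n + 2))) = m₁)
    (hv : Psi (n + 2) (k + 2) (vec n 0 (1 / (n + 1)) (1 / (n + 1))) (vec n 1 0 0) = m₂)
    (hw : m₄' ≤ Psi (n + 2) (k + 2) (vec n P 0 ((1 - P) / n)) (vec n 0 P ((1 - P) / n)))
    (h₃₄ : m₃ ≤ m₄) (hT₁ : m₁ ≤ t + e)
    (hT₂ : (m₃ + ((n + 2 : ℕ) - 1) * m₄) / (n + 2 : ℕ) ≤ t + e)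
    (hT : (m₂ - (t + e)) ^ 2 ≤
      (t + e - m₁) * (t + e - (m₃ + ((n + 2 : ℕ) - 1) * m₄) / (n + 2 : ℕ)))
    (hlow : t - e ≤ (1 - x) ^ 2 * m₁ + 2 * (1 - x) * x * m₂ +
      x ^ 2 * ((0 + ((n + 2 : ℕ) - 1) * m₄') / (n + 2 : ℕ))) :
    ∃ M, IsPartitionMax (n + 2) (k + 2) (maxBalanced (n + 2) ε) (maxUnbalanced (n + 2) ε) M ∧
      |M - t| ≤ e := by
  have hn0 : 0 < n := by omega
  have hn0' : (0 : ℝ) < n := by exact_mod_cast hn0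
  have hj : k + 2 < n + 2 := by omega
  have hcard : Fintype.card (Fin (n + 2)) = n + 2 := Fintype.card_fin _
  have h01 : (0 : Fin (n + 2)) ≠ 1 := by simp
  obtain ⟨M, hM⟩ := exists_isClusterMax (n + 2)
    (supPsi (n + 2) (k + 2) (maxBalanced (n + 2) ε) (maxBalanced (n + 2) ε))
    (supPsi (n + 2) (k + 2) (maxBalanced (n + 2) ε) (maxUnbalanced (n + 2) ε 0))
    (supPsi (n + 2) (k + 2) (maxUnbalanced (n + 2) ε 0) (maxUnbalanced (n + 2) ε 0))
    (supPsi (n + 2) (k + 2) (maxUnbalanced (n + 2) ε 0) (maxUnbalanced (n + 2) ε 1))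
  refine ⟨M, isPartitionMax_max h01 hM, ?_⟩
  have hnear : ∀ {p : Fin (n + 2) → ℝ} {i : Fin (n + 2)}, p ∈ maxUnbalanced (n + 2) ε i →
      tailBound n (k + 1) (p i) (1 - p i) ≤ tailBound n (k + 1) (1 - ε) ε := by
    intro p i hp
    have h1 := le_one_of_mem_stdSimplex hp.1 i
    have h2 := hp.2
    have := tailBound_le_tailBound n k.succ_pos (δ := 1 - p i) (by linarith) (by linarith) hε2
    rwa [sub_sub_cancel] at this
  have U₁ : supPsi (n + 2) (k + 2) (maxBalanced (n + 2) ε) (maxBalanced (n + 2) ε) ≤ m₁ := by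
    refine supPsi_le (by rw [hm₁]; positivity) fun p hp q hq => ?_
    rw [Psi_eq hj, hm₁]
    gcongr
    exact hG p q ⟨hp.1, hq.1, fun i => ⟨hp.2 i, hq.2 i⟩⟩
  have U₂ : supPsi (n + 2) (k + 2) (maxBalanced (n + 2) ε) (maxUnbalanced (n + 2) ε 0) ≤ m₂ := by
    have h0 : 0 ≤ oneSided n (k + 1) 0 := by
      have h1 := le_oneSided k.succ_pos (by linarith) hB le_rfl
      rw [Nat.succ_eq_add_one, zero_pow (by omega), zero_pow (by omega)] at h1
      linarith [tailBound_nonneg n (k + 1) zero_le_one hε.le]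
    refine supPsi_le (by rw [hm₂]; positivity) fun p hp q hq => ?_
    rw [Psi_eq hj, hm₂, phi_comm]
    gcongr
    exact phi_le_of_near_vertex hcard hn0 k.succ_pos hq.1 hp.1 hε hε2 hq.2.le hB hle
  have U₃ : supPsi (n + 2) (k + 2) (maxUnbalanced (n + 2) ε 0) (maxUnbalanced (n + 2) ε 0) ≤
      m₃ := by
    have key : ∀ p ∈ maxUnbalanced (n + 2) ε 0, ∀ q ∈ maxUnbalanced (n + 2) ε 0,
        dsym univ (k + 2) p q ≤ (n + 1).choose (k + 2) * (ε / (n + 1)) ^ (k + 2) +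
          ε * tailBound n (k + 1) 1 ε := by
      intro p hp q hq
      have hq1 := le_one_of_mem_stdSimplex hq.1 0
      have hp1 := le_one_of_mem_stdSimplex hp.1 0
      have hp2 := hp.2
      have hq2 := hq.2
      have t0 := tailBound_nonneg n (k + 1) zero_le_one hε.le
      have b0 : esym (univ.erase 0) (k + 2) p ≤
          (n + 1).choose (k + 2) * (ε / (n + 1)) ^ (k + 2) := by
        have h := esym_le (univ.erase 0) (k + 2) (fun i _ => hp.1.1 i)
        have hs : ∑ i ∈ univ.erase 0, p i = 1 - p 0 := by
          rw [← hp.1.2, ← add_sum_erase univ p (mem_univ 0)]; ring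
        rw [hs, card_erase_of_mem (mem_univ _), card_univ, hcard] at h
        refine h.trans ?_
        push_cast
        gcongr
        linarith
      rw [dsym, ← add_sum_erase univ _ (mem_univ 0)]
      refine add_le_add ?_ ?_
      · calc q 0 * esym (univ.erase 0) (k + 2) p ≤ 1 * esym (univ.erase 0) (k + 2) p := by
              gcongr
              exact esym_nonneg _ fun i _ => hp.1.1 i
          _ ≤ _ := by rw [one_mul]; exact b0
      · calc ∑ i ∈ univ.erase 0, q i * esym (univ.erase i) (k + 2) p
            ≤ ∑ i ∈ univ.erase 0, q i * tailBound n (k + 1) 1 ε := by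
              refine sum_le_sum fun i _ => mul_le_mul_of_nonneg_left ?_ (hq.1.1 i)
              exact (esym_erase_le_tailBound hcard (k + 1) hp.1 (a := 0) (by linarith) i).trans
                (tailBound_mono n (k + 1) (by linarith) (by linarith) hp1 (by linarith))
          _ = (1 - q 0) * tailBound n (k + 1) 1 ε := by
              rw [← sum_mul, ← hq.1.2, ← add_sum_erase univ q (mem_univ 0)]; ring
          _ ≤ _ := by gcongr; linarith
    have t0 := tailBound_nonneg n (k + 1) zero_le_one hε.le
    refine supPsi_le (le_trans (by positivity) hm₃) fun p hp q hq => ?_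
    rw [Psi_eq hj]
    refine le_trans ?_ hm₃
    gcongr
    rw [phi, two_mul]
    exact add_le_add (key p hp q hq) (key q hq p hp)
  have U₄ : supPsi (n + 2) (k + 2) (maxUnbalanced (n + 2) ε 0) (maxUnbalanced (n + 2) ε 1) ≤
      m₄ := by
    have t0 := tailBound_nonneg n (k + 1) (by linarith : 0 ≤ 1 - ε) hε.le
    refine supPsi_le (le_trans (by positivity) hm₄) fun p hp q hq => ?_
    rw [Psi_eq hj]
    refine le_trans ?_ hm₄
    gcongr
    rw [phi, two_mul]
    have hp2 := hp.2
    have hq2 := hq.2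
    exact add_le_add
      ((dsym_le_tailBound hcard (k + 1) hp.1 hq.1 (a := 0) (by linarith)).trans (hnear hp))
      ((dsym_le_tailBound hcard (k + 1) hq.1 hp.1 (a := 1) (by linarith)).trans (hnear hq))
  have hunif : vec n (1 / (n + 2)) (1 / (n + 2)) (1 / (n + 2)) ∈ maxBalanced (n + 2) ε := by
    refine ⟨vec_mem (by positivity) (by positivity) (by positivity) (by field_simp; ring), ?_⟩
    have : 1 / ((n : ℝ) + 2) ≤ 1 - ε := by
      rw [div_le_iff₀ (by positivity)]; linarith
    exact forall_vec (P := fun v => v ≤ 1 - ε) this this this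
  have hunif' : vec n 0 (1 / (n + 1)) (1 / (n + 1)) ∈ maxBalanced (n + 2) ε := by
    refine ⟨vec_mem le_rfl (by positivity) (by positivity) (by field_simp; ring), ?_⟩
    have : 1 / ((n : ℝ) + 1) ≤ 1 - ε := by
      have h1 : (1 : ℝ) ≤ n := by exact_mod_cast hn0
      have : 1 / ((n : ℝ) + 1) ≤ 1 / 2 := by gcongr; linarith
      linarith
    exact forall_vec (P := fun v => v ≤ 1 - ε) (by linarith) this this
  have hvert : vec n 1 0 0 ∈ maxUnbalanced (n + 2) ε 0 :=
    ⟨vec_mem zero_le_one le_rfl le_rfl (by ring), by change 1 - ε < 1; linarith⟩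
  have hr : 0 ≤ (1 - P) / n := div_nonneg (by linarith) hn0'.le
  have hw0 : vec n P 0 ((1 - P) / n) ∈ maxUnbalanced (n + 2) ε 0 :=
    ⟨vec_mem (by linarith) le_rfl hr (by field_simp; ring), hP⟩
  have hw1 : vec n 0 P ((1 - P) / n) ∈ maxUnbalanced (n + 2) ε 1 :=
    ⟨vec_mem le_rfl (by linarith) hr (by field_simp; ring), hP⟩
  have L₁ := le_supPsi (j := k + 2) (maxBalanced_subset _ ε) (maxBalanced_subset _ ε) hunif hunif
  have L₂ := le_supPsi (j := k + 2) (maxBalanced_subset _ ε) (maxUnbalanced_subset ε 0) hunif' hvert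
  have L₃ := supPsi_nonneg (j := k + 2) (maxUnbalanced_subset ε (0 : Fin (n + 2)))
    (maxUnbalanced_subset ε 0)
  have L₄ := le_supPsi (j := k + 2) (maxUnbalanced_subset ε 0) (maxUnbalanced_subset ε 1) hw0 hw1
  rw [hu] at L₁
  rw [hv] at L₂
  have upper := hM.le_of_le (by omega) U₁ U₂ U₃ U₄ h₃₄ hT₁ hT₂ (Or.inr hT)
  have lower := hM.le (by omega) hx0 hx1 L₁ L₂ L₃ (hw.trans L₄)
  rw [abs_le]
  constructor <;> linarith

lemma exists_isMaxPartitionM_seven :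
    ∃ M : ℝ, IsMaxPartitionM 7 7 (9 / 100) M ∧ |M - 0.0861594| ≤ 1 / 10 ^ 7 := by
  refine exists_isPartitionMax_max (n := 5) (k := 3) (P := 0.910001) (x := 0.06948) (by norm_num)
    (by norm_num) (by norm_num) (by norm_num) ?_ ?_ ?_ (by norm_num) (by norm_num) (by norm_num)
    (by norm_num) (m₁ := 1440 / 16807) (m₂ := 5 / 54) (m₃ := 1.25e-5) (m₄ := 1.151e-4)
    (m₄' := 1.0678e-4) ?_ ?_ ?_ ?_ ?_ ?_ ?_ (by norm_num) (by norm_num) (by norm_num) (by norm_num)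
    (by norm_num)
  · intro p q h
    have := phi_le_capped_seven (Fintype.card_fin 7) (by norm_num at h; exact h)
    norm_num [Nat.choose] at this ⊢
    exact this
  all_goals norm_num [oneSided, tailBound, Psi_vec, Nat.choose, Nat.factorial]

lemma exists_isMaxPartitionM_eight :
    ∃ M : ℝ, IsMaxPartitionM 8 8 (3 / 25) M ∧ |M - 0.0388599| ≤ 1 / 10 ^ 7 := by
  refine exists_isPartitionMax_max (n := 6) (k := 4) (P := 0.880001) (x := 0.0929) (by norm_num)
    (by norm_num) (by norm_num) (by norm_num) ?_ ?_ ?_ (by norm_num) (by norm_num) (by norm_num)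
    (by norm_num) (m₁ := 315 / 8192) (m₂ := 720 / 16807) (m₃ := 3.6e-6) (m₄ := 2.443e-5)
    (m₄' := 2.19e-5) ?_ ?_ ?_ ?_ ?_ ?_ ?_ (by norm_num) (by norm_num) (by norm_num) (by norm_num)
    (by norm_num)
  · intro p q h
    have := phi_le_capped_eight (Fintype.card_fin 8) (by norm_num at h; exact h)
    norm_num [Nat.choose] at this ⊢
    exact this
  all_goals norm_num [oneSided, tailBound, Psi_vec, Nat.choose, Nat.factorial]

lemma exists_isMaxPartitionM_nine :
    ∃ M : ℝ, IsMaxPartitionM 9 8 (1 / 10) M ∧ |M - 0.0758830| ≤ 1 / 10 ^ 7 := by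
  refine exists_isPartitionMax_max (n := 7) (k := 4) (P := 0.91) (x := 0.01328) (by norm_num)
    (by norm_num) (by norm_num) (by norm_num) ?_ ?_ ?_ (by norm_num) (by norm_num) (by norm_num)
    (by norm_num) (m₁ := 4480 / 59049) (m₂ := 315 / 4096) (m₃ := 2e-6) (m₄ := 1.63e-5)
    (m₄' := 0) ?_ ?_ ?_ ?_ ?_ ?_ ?_ (by norm_num) (by norm_num) (by norm_num) (by norm_num)
    (by norm_num)
  · intro p q h
    have := phi_le_capped_nine (Fintype.card_fin 9) (by norm_num at h; exact h)
    norm_num [Nat.choose] at this ⊢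
    exact this
  all_goals norm_num [oneSided, tailBound, Psi_vec, Nat.choose, Nat.factorial]

lemma exists_isMaxPartitionM_ten :
    ∃ M : ℝ, IsMaxPartitionM 10 9 (1 / 15) M ∧ |M - 0.0363565| ≤ 1 / 10 ^ 7 := by
  refine exists_isPartitionMax_max (n := 8) (k := 5) (P := 0.94) (x := 0.0416) (by norm_num)
    (by norm_num) (by norm_num) (by norm_num) ?_ ?_ ?_ (by norm_num) (by norm_num) (by norm_num)
    (by norm_num) (m₁ := 567 / 15625) (m₂ := 2240 / 59049) (m₃ := 7e-9) (m₄ := 9e-8)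
    (m₄' := 0) ?_ ?_ ?_ ?_ ?_ ?_ ?_ (by norm_num) (by norm_num) (by norm_num) (by norm_num)
    (by norm_num)
  · intro p q h
    have := phi_le_capped_ten (Fintype.card_fin 10) (by norm_num at h; exact h)
    norm_num [Nat.choose] at this ⊢
    exact this
  all_goals norm_num [oneSided, tailBound, Psi_vec, Nat.choose, Nat.factorial]

lemma exists_isMaxPartitionM_eleven :
    ∃ M : ℝ, IsMaxPartitionM 11 10 (1 / 11) M ∧ |M - 0.0170049| ≤ 1 / 10 ^ 7 := by
  refine exists_isPartitionMax_max (n := 9) (k := 6) (P := 0.91) (x := 0.06278) (by norm_num)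
    (by norm_num) (by norm_num) (by norm_num) ?_ ?_ ?_ (by norm_num) (by norm_num) (by norm_num)
    (by norm_num) (m₁ := 3628800 / 214358881) (m₂ := 567 / 31250) (m₃ := 3.1e-9) (m₄ := 2.9e-8)
    (m₄' := 0) ?_ ?_ ?_ ?_ ?_ ?_ ?_ (by norm_num) (by norm_num) (by norm_num) (by norm_num)
    (by norm_num)
  · intro p q h
    have := phi_le_capped_eleven (Fintype.card_fin 11) (by norm_num at h; exact h)
    norm_num [Nat.choose] at this ⊢
    exact this
  all_goals norm_num [oneSided, tailBound, Psi_vec, Nat.choose, Nat.factorial]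

end MaxPartition

/-! ### The minimum-based partition on six symbols, `j = 4` -/

section SixSix

/-- The branch and bound check for pairs of distributions on six symbols with entries at most
`1 / 20` at one of them; on the grid with denominator `1280` this is the interval `[0, 64]`. -/
lemma blocks_covered : ∀ n₂ ∈ List.range 6, ∀ n₃ ∈ List.range (6 - n₂),
    covers (BlockBound.test ⟨5 - n₂ - n₃, n₂, n₃, 3, 1280, (1, 1), (6296, 1000000)⟩) 40
      [(0, 64), (0, 64),
        if n₂ = 0 then (1280, 0) else if 5 - n₂ - n₃ = 0 then (0, 0) else (0, 1280),
        if n₃ = 0 then (1280, 0) else if 5 - n₂ - n₃ = 0 then (0, 0) else (0, 1280)] = true := by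
  decide +kernel

/-- The bound for `phi` if one of the distributions is a vertex. -/
lemma phi_le_of_vertex_six {p q : Fin 6 → ℝ} (hp : p ∈ stdSimplex ℝ (Fin 6))
    (hq : q ∈ stdSimplex ℝ (Fin 6)) (hq0 : q 0 ≤ 1 / 20) {i : Fin 6} (hi0 : i ≠ 0)
    (hi : 1 ≤ p i) : phi univ 4 p q ≤ 6296 / 1000000 := by
  have hpi : p i = 1 := le_antisymm (le_one_of_mem_stdSimplex hp i) hi
  have h1 : dsym univ 4 p q ≤ 0 := by
    refine (dsym_le_tailBound (n := 4) (k := 3) (Fintype.card_fin 6) hp hq (a := i)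
      (by linarith)).trans ?_
    rw [hpi]
    norm_num [tailBound]
  have hz : ∀ l, l ≠ i → p l = 0 := by
    intro l hl
    have : p l + p i ≤ 1 := by
      rw [← hp.2, ← sum_pair hl]
      exact sum_le_univ_sum_of_nonneg hp.1
    linarith [hp.1 l]
  have h2 : dsym univ 4 q p = esym (univ.erase i) 4 q := by
    rw [dsym, sum_eq_single i (fun l _ hl => by rw [hz l hl, zero_mul]) (by simp), hpi, one_mul]
  have h3 := esym_le_of_mem (s := univ.erase i) (i := 0) (mem_erase.2 ⟨hi0.symm, mem_univ 0⟩) 3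
    (fun l _ => hq.1 l) (n := 4) (by rw [card_erase_of_mem (mem_univ i)]; rfl) le_rfl
  have h4 : ∑ l ∈ univ.erase i, q l ≤ 1 := by
    rw [← hq.2]
    exact sum_le_univ_sum_of_nonneg hq.1
  have h5 : q 0 ≤ ∑ l ∈ univ.erase i, q l :=
    single_le_sum (fun l _ => hq.1 l) (mem_erase.2 ⟨hi0.symm, mem_univ 0⟩)
  have hq00 := hq.1 0
  set y := q 0
  set S := ∑ l ∈ univ.erase i, q l
  have h6 : esym (univ.erase i) 4 q ≤ ((1 - y) / 4) ^ 4 + y * (4 * ((1 - y) / 4) ^ 3) := by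
    refine h3.trans ?_
    norm_num [Nat.choose]
    have : 0 ≤ S - y := by linarith
    gcongr
  rw [phi, h2]
  nlinarith [mul_nonneg hq00 (sub_nonneg.2 hq0), pow_nonneg hq00 3, pow_nonneg hq00 4, sq_nonneg y]

set_option maxHeartbeats 1000000 in
/-- The bound for `phi` if both distributions on six symbols have an entry at most `1 / 20` at the
same symbol, by branch and bound over the extremal pairs. -/
lemma phi_le_of_small_six {p q : Fin 6 → ℝ} (hp : p ∈ stdSimplex ℝ (Fin 6))
    (hq : q ∈ stdSimplex ℝ (Fin 6)) (hp0 : p 0 ≤ 1 / 20) (hq0 : q 0 ≤ 1 / 20) :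
    phi univ 4 p q ≤ 6296 / 1000000 := by
  set u : Fin 6 → ℝ := fun i => if i = 0 then 1 / 20 else 1 with hu
  have hmem : (p, q) ∈ cappedPairs u := by
    refine ⟨hp, hq, fun i => ?_⟩
    by_cases hi : i = 0
    · subst hi
      simp only [hu, if_true]
      exact ⟨hp0, hq0⟩
    · simpa [hu, hi] using ⟨le_one_of_mem_stdSimplex hp i, le_one_of_mem_stdSimplex hq i⟩
  obtain ⟨p', q', hext⟩ := exists_isExtremal 4 (isCompact_cappedPairs u) ⟨_, hmem⟩
  refine ((hext.2 _ hmem).1).trans ?_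
  clear hmem hp hq hp0 hq0 p q
  rename' p' => p, q' => q
  obtain ⟨hp, hq, hcap⟩ := hext.1
  have hp0 := (hcap 0).1
  have hq0 := (hcap 0).2
  simp only [hu, if_true] at hp hq hp0 hq0
  by_cases hp1 : ∃ i, i ≠ 0 ∧ 1 ≤ p i
  · obtain ⟨i, hi0, hi⟩ := hp1
    exact phi_le_of_vertex_six hp hq hq0 hi0 hi
  by_cases hq1 : ∃ i, i ≠ 0 ∧ 1 ≤ q i
  · obtain ⟨i, hi0, hi⟩ := hq1
    rw [phi_comm]
    exact phi_le_of_vertex_six hq hp hp0 hi0 hi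
  push Not at hp1 hq1
  have sp : ∑ i ∈ univ.erase 0, p i = 1 - p 0 := by
    rw [← hp.2, ← add_sum_erase univ p (mem_univ 0)]; ring
  have sq : ∑ i ∈ univ.erase 0, q i = 1 - q 0 := by
    rw [← hq.2, ← add_sum_erase univ q (mem_univ 0)]; ring
  have hpos : ∃ i ∈ univ.erase 0, 0 < p i ∨ 0 < q i := by
    by_contra! h
    have := sum_nonpos fun i hi => (h i hi).1
    linarith
  obtain ⟨A, B, C, a, β, a', γ, ha, hβ, ha', hγ, hA0, hB0, hC0, hbl⟩ :=
    hext.exists_isBlocks (s := univ.erase 0) (v := 1) (fun i hi => by simp [hu, (mem_erase.1 hi).1])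
      (fun i hi => ⟨hp1 i (mem_erase.1 hi).1, hq1 i (mem_erase.1 hi).1⟩) hpos
  have hcard := hbl.card_eq
  rw [card_erase_of_mem (mem_univ 0), card_univ, Fintype.card_fin] at hcard
  have hcov := blocks_covered B.card (List.mem_range.2 (by omega)) C.card
    (List.mem_range.2 (by omega))
  have hn1 : 5 - B.card - C.card = A.card := by omega
  rw [hn1] at hcov
  have hpsum := hbl.sum_left
  rw [sp] at hpsum
  have hqsum := hbl.symm.sum_left
  rw [sq] at hqsum
  have hp00 := hp.1 0
  have hq00 := hq.1 0
  set z := p 0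
  set z' := q 0
  have hz : 0 < 1 - z := by linarith
  have hz' : 0 < 1 - z' := by linarith
  have hx0 : 0 ≤ (A.card : ℝ) * a := by positivity
  have hy0 : 0 ≤ (A.card : ℝ) * a' := by positivity
  have hB0' : 0 ≤ (B.card : ℝ) * β := by positivity
  have hC0' : 0 ≤ (C.card : ℝ) * γ := by positivity
  set x := A.card * a / (1 - z) with hx
  set y := A.card * a' / (1 - z') with hy
  have ex : (1 - z) * x = A.card * a := by rw [hx]; field_simp
  have ey : (1 - z') * y = A.card * a' := by rw [hy]; field_simp
  have hx1 : x ≤ 1 := by rw [hx, div_le_one hz]; linarith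
  have hy1 : y ≤ 1 := by rw [hy, div_le_one hz']; linarith
  have hx0' : 0 ≤ x := div_nonneg hx0 hz.le
  have hy0' : 0 ≤ y := div_nonneg hy0 hz'.le
  have hβ1 : β ≤ 1 := by
    rcases B.eq_empty_or_nonempty with h | ⟨i, hi⟩
    · rw [hB0 h]; exact zero_le_one
    · rw [← hbl.pB i hi]; exact le_one_of_mem_stdSimplex hp i
  have hγ1 : γ ≤ 1 := by
    rcases C.eq_empty_or_nonempty with h | ⟨i, hi⟩
    · rw [hC0 h]; exact zero_le_one
    · rw [← hbl.qC i hi]; exact le_one_of_mem_stdSimplex hq i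
  have hrange : ∀ (m : ℕ) (c t v : ℝ), 0 < v → v * t = A.card * c → 0 ≤ t → t ≤ 1 →
      (m = 0 → v = A.card * c) →
      let c : ℕ × ℕ := if m = 0 then (1280, 0) else if A.card = 0 then (0, 0) else (0, 1280)
      (c.1 : ℝ) ≤ ((1280 : ℕ) : ℝ) * t ∧ ((1280 : ℕ) : ℝ) * t ≤ (c.1 : ℝ) + c.2 := by
    intro m c t v hv h1 h2 h3 h4
    simp only
    split_ifs with hm hA
    · have : t = 1 := by
        have := h4 hm
        rw [← h1] at this
        nlinarith
      rw [this]; norm_num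
    · have : t = 0 := by
        rw [hA, Nat.cast_zero, zero_mul] at h1
        exact (mul_eq_zero.1 h1).resolve_left hv.ne'
      rw [this]; norm_num
    · constructor <;> push_cast <;> linarith
  have hbox : InBox [((0 : ℕ), (64 : ℕ)), (0, 64),
      if B.card = 0 then (1280, 0) else if A.card = 0 then (0, 0) else (0, 1280),
      if C.card = 0 then (1280, 0) else if A.card = 0 then (0, 0) else (0, 1280)]
      [((1280 : ℕ) : ℝ) * z, ((1280 : ℕ) : ℝ) * z', ((1280 : ℕ) : ℝ) * x,
        ((1280 : ℕ) : ℝ) * y] := by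
    refine List.Forall₂.cons ?_ (List.Forall₂.cons ?_ (List.Forall₂.cons ?_
      (List.Forall₂.cons ?_ List.Forall₂.nil)))
    · constructor <;> push_cast <;> linarith
    · constructor <;> push_cast <;> linarith
    · refine hrange B.card a x (1 - z) hz ex hx0' hx1 fun h => ?_
      rw [h] at hpsum
      push_cast at hpsum
      linarith
    · refine hrange C.card a' y (1 - z') hz' ey hy0' hy1 fun h => ?_
      rw [h] at hqsum
      push_cast at hqsum
      linarith
  have key := covers_sound (BlockBound.test_sound
    ⟨A.card, B.card, C.card, 3, 1280, (1, 1), (6296, 1000000)⟩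
    (by norm_num) (z := z) (z' := z') (x := x) (y := y) hp00 (by linarith) hq00
    (by linarith) hx0' hx1 hy0' hy1 ha hβ ha' hγ (fun h => hA0 (card_eq_zero.1 h))
    (fun h => hB0 (card_eq_zero.1 h)) (fun h => hC0 (card_eq_zero.1 h)) ex.symm
    (by simp only; linarith) ey.symm (by simp only; linarith)
    (by simpa using hβ1) (by simpa using hγ1)) 40 hcov hbox rfl
  simp only at key
  have hphi := hbl.phi_insert_eq (notMem_erase 0 univ) 3
  rw [insert_erase (mem_univ 0)] at hphi
  rw [hphi]
  push_cast at key
  linarith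

lemma phi_le_of_entries_le_six {p q : Fin 6 → ℝ} (hp : p ∈ stdSimplex ℝ (Fin 6))
    (hq : q ∈ stdSimplex ℝ (Fin 6)) (hp1 : ∀ i, p i ≤ 9 / 10) (hq1 : ∀ i, q i ≤ 9 / 10) :
    phi univ 4 p q ≤ 10 / 1296 :=
  (phi_le_capped_six (Fintype.card_fin 6) ⟨hp, hq, fun i => ⟨hp1 i, hq1 i⟩⟩).trans (by norm_num)

theorem isMinPartitionM_six_six : IsMinPartitionM 6 6 (1 / 20) (5 / 27) := by
  obtain ⟨M, hM⟩ := exists_isClusterMax 6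
    (supPsi 6 4 (minBalanced 6 (1 / 20)) (minBalanced 6 (1 / 20)))
    (supPsi 6 4 (minBalanced 6 (1 / 20)) (minClosed 6 (1 / 20) 0))
    (supPsi 6 4 (minClosed 6 (1 / 20) 0) (minClosed 6 (1 / 20) 0))
    (supPsi 6 4 (minClosed 6 (1 / 20) 0) (minClosed 6 (1 / 20) 1))
  have hfact : ((Nat.factorial 4 : ℕ) : ℝ) = 24 := by norm_num [Nat.factorial]
  have hbal : ∀ {p : Fin 6 → ℝ}, p ∈ minBalanced 6 (1 / 20) → ∀ i, p i ≤ 9 / 10 := by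
    intro p hp i
    have h1 := card_nsmul_le_sum (univ.erase i) p (1 / 20) fun l _ => hp.2 l
    have h2 := add_sum_erase univ p (mem_univ i)
    rw [card_erase_of_mem (mem_univ i), card_univ, Fintype.card_fin, nsmul_eq_mul] at h1
    rw [hp.1.2] at h2
    push_cast at h1
    linarith
  have U₁ : supPsi 6 4 (minBalanced 6 (1 / 20)) (minBalanced 6 (1 / 20)) ≤ 5 / 27 := by
    refine supPsi_le (by norm_num) fun p hp q hq => ?_
    rw [Psi_eq (by norm_num), hfact]
    linarith [phi_le_of_entries_le_six hp.1 hq.1 (hbal hp) (hbal hq)]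
  have U₂ : supPsi 6 4 (minBalanced 6 (1 / 20)) (minClosed 6 (1 / 20) 0) ≤ 5 / 27 := by
    refine supPsi_le (by norm_num) fun p hp q hq => ?_
    rw [Psi_eq (by norm_num), hfact]
    by_cases h : ∃ i, 9 / 10 < q i
    · obtain ⟨c, hc⟩ := h
      have h1 : dsym univ 4 q p ≤ tailBound 4 3 1 (1 / 10) :=
        (dsym_le_tailBound (k := 3) (Fintype.card_fin 6) hq.1 hp.1 (a := c) (by linarith)).trans
          (tailBound_mono 4 3 (by linarith) (by linarith [le_one_of_mem_stdSimplex hq.1 c])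
            (le_one_of_mem_stdSimplex hq.1 c) (by linarith))
      have h2 : dsym univ 4 p q ≤ 5 * (19 / 100) ^ 4 := by
        have h3 : ∀ i ∈ univ, q i * esym (univ.erase i) 4 p ≤ q i * (5 * (19 / 100) ^ 4) := by
          intro i _
          refine mul_le_mul_of_nonneg_left ?_ (hq.1.1 i)
          refine (esym_le (univ.erase i) 4 fun l _ => hp.1.1 l).trans ?_
          have hs : ∑ l ∈ univ.erase i, p l = 1 - p i := by
            rw [← hp.1.2, ← add_sum_erase univ p (mem_univ i)]; ring
          have := hp.2 i
          have := le_one_of_mem_stdSimplex hp.1 i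
          rw [hs, card_erase_of_mem (mem_univ i), card_univ, Fintype.card_fin]
          norm_num [Nat.choose]
          have h4 : (1 - p i) / 5 ≤ 19 / 100 := by linarith
          have := pow_le_pow_left₀ (by linarith : 0 ≤ (1 - p i) / 5) h4 4
          norm_num at this ⊢
          linarith
        refine (sum_le_sum h3).trans ?_
        rw [← sum_mul, hq.1.2, one_mul]
      rw [phi]
      norm_num [tailBound, Nat.choose] at h1
      linarith
    · push Not at h
      linarith [phi_le_of_entries_le_six hp.1 hq.1 (hbal hp) h]
  have U₃ : supPsi 6 4 (minClosed 6 (1 / 20) 0) (minClosed 6 (1 / 20) 0) ≤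
      24 * (6296 / 1000000) := by
    refine supPsi_le (by norm_num) fun p hp q hq => ?_
    rw [Psi_eq (by norm_num), hfact]
    linarith [phi_le_of_small_six hp.1 hq.1 hp.2.1 hq.2.1]
  have U₄ : supPsi 6 4 (minClosed 6 (1 / 20) 0) (minClosed 6 (1 / 20) 1) ≤ 24 / 125 := by
    refine supPsi_le (by norm_num) fun p hp q hq => ?_
    rw [Psi_eq (by norm_num), hfact]
    have hone : oneSided 4 3 0 = 1 / 125 := by norm_num [oneSided, Nat.choose]
    have hnear : ∀ p q : Fin 6 → ℝ, p ∈ ProbDist 6 → q ∈ ProbDist 6 → ∀ i, 9 / 10 < p i →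
        phi univ 4 p q ≤ 1 / 125 := by
      intro p q hp hq i hi
      rw [← hone]
      exact phi_le_of_near_vertex (k := 3) (Fintype.card_fin 6) (by norm_num) (by norm_num) hp hq
        (ε := 1 / 10) (by norm_num) (by norm_num) (a := i) (by linarith) (by norm_num [Nat.choose])
        (by norm_num [oneSided, tailBound, Nat.choose])
    by_cases h : ∃ i, 9 / 10 < p i
    · obtain ⟨i, hi⟩ := h
      linarith [hnear p q hp.1 hq.1 i hi]
    by_cases h' : ∃ i, 9 / 10 < q i
    · obtain ⟨i, hi⟩ := h'
      have := hnear q p hq.1 hp.1 i hi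
      rw [phi_comm] at this
      linarith
    push Not at h h'
    linarith [phi_le_of_entries_le_six hp.1 hq.1 h h']
  have hunif : vec 4 (1 / 6) (1 / 6) (1 / 6) ∈ minBalanced 6 (1 / 20) :=
    ⟨vec_mem (by norm_num) (by norm_num) (by norm_num) (by norm_num),
      forall_vec (P := fun v => 1 / 20 ≤ v) (by norm_num) (by norm_num) (by norm_num)⟩
  have L₁ := le_supPsi (j := 4) (minBalanced_subset 6 _) (minBalanced_subset 6 _) hunif hunif
  rw [Psi_vec (n := 4) (k := 2) (by norm_num)] at L₁
  norm_num [Nat.choose, Nat.factorial] at L₁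
  have upper := hM.le_of_le (by norm_num) U₁ U₂ U₃ U₄ (by norm_num) le_rfl (by norm_num)
    (Or.inl le_rfl)
  have lower := hM.le (by norm_num) le_rfl zero_le_one L₁ le_rfl le_rfl le_rfl
  norm_num at lower
  rw [← le_antisymm upper lower]
  exact isPartitionMax_min (by norm_num) (by norm_num) (by decide) hM

end SixSix

/-! ### The identity for `j = 3` -/

section DegreeFour

variable {ι : Type*} [DecidableEq ι]

/-- In degree four, `phi` of the pair `c + r`, `c - r` splits into a part in `c` and a part in `r`.
The sums of lower degree that occur when a symbol is added split in the same way. -/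
lemma phi_add_sub (s : Finset ι) (c r : ι → ℝ) :
    phi s 3 (c + r) (c - r) = 8 * (esym s 4 c - esym s 4 r) := by
  have key : dsym s 1 (c + r) (c - r) = dsym s 1 (c - r) (c + r) ∧
      dsym s 1 (c + r) (c - r) + esym s 2 (c + r) + esym s 2 (c - r) = 4 * esym s 2 c ∧
      dsym s 1 (c + r) (c - r) - esym s 2 (c + r) - esym s 2 (c - r) = -(4 * esym s 2 r) ∧
      dsym s 2 (c + r) (c - r) + dsym s 2 (c - r) (c + r) + esym s 3 (c + r) + esym s 3 (c - r) =
        8 * esym s 3 c ∧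
      dsym s 2 (c + r) (c - r) - dsym s 2 (c - r) (c + r) + esym s 3 (c - r) - esym s 3 (c + r) =
        -(8 * esym s 3 r) ∧
      phi s 3 (c + r) (c - r) = 8 * (esym s 4 c - esym s 4 r) := by
    induction s using Finset.induction_on with
    | empty => simp [phi, dsym_empty, esym_empty_succ]
    | insert i s hi ih =>
      obtain ⟨h1, h2, h3, h4, h5, h6⟩ := ih
      rw [phi] at h6
      rw [phi]
      have ec : ∑ l ∈ s, (c + r) l = ∑ l ∈ s, c l + ∑ l ∈ s, r l := by
        simp only [Pi.add_apply, sum_add_distrib]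
      have er : ∑ l ∈ s, (c - r) l = ∑ l ∈ s, c l - ∑ l ∈ s, r l := by
        simp only [Pi.sub_apply, sum_sub_distrib]
      simp only [dsym_insert hi, esym_insert hi, dsym_zero, zero_add, esym_one, ec, er, h1]
      simp only [Pi.add_apply, Pi.sub_apply]
      rw [h1] at h2 h3
      refine ⟨by ring, ?_, ?_, ?_, ?_, ?_⟩
      · linear_combination h2
      · linear_combination h3
      · linear_combination h4 + c i * 2 * h2
      · linear_combination h5 + r i * 2 * h3
      · linear_combination h6 + c i * h4 + r i * h5
  exact key.2.2.2.2.2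

lemma esym_four_eq (s : Finset ι) (r : ι → ℝ) (h : ∑ i ∈ s, r i = 0) :
    8 * esym s 4 r = (∑ i ∈ s, r i ^ 2) ^ 2 - 2 * ∑ i ∈ s, r i ^ 4 := by
  have key : 2 * esym s 2 r = (∑ i ∈ s, r i) ^ 2 - ∑ i ∈ s, r i ^ 2 ∧
      6 * esym s 3 r = (∑ i ∈ s, r i) ^ 3 - 3 * (∑ i ∈ s, r i) * ∑ i ∈ s, r i ^ 2 +
        2 * ∑ i ∈ s, r i ^ 3 ∧
      24 * esym s 4 r = (∑ i ∈ s, r i) ^ 4 - 6 * (∑ i ∈ s, r i) ^ 2 * (∑ i ∈ s, r i ^ 2) +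
        3 * (∑ i ∈ s, r i ^ 2) ^ 2 + 8 * (∑ i ∈ s, r i) * (∑ i ∈ s, r i ^ 3) -
        6 * ∑ i ∈ s, r i ^ 4 := by
    clear h
    induction s using Finset.induction_on with
    | empty => simp [esym_empty_succ]
    | insert i s hi ih =>
      obtain ⟨h1, h2, h3⟩ := ih
      simp only [esym_insert hi, sum_insert hi, esym_one]
      refine ⟨?_, ?_, ?_⟩
      · linear_combination h1
      · linear_combination h2 + 3 * r i * h1
      · linear_combination h3 + 4 * r i * h2
  have h3 := key.2.2
  rw [h] at h3
  linarith

/-- The polynomial of the deviations from the mean that occurs in `sum_pow_four_add_le`. -/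
noncomputable def devPoly (m z : ℝ) : ℝ :=
  (2 + 2 / m - 12 / m ^ 2) * z ^ 2 + 8 / m * z ^ 3 - (m - 2) / (m - 1) * z ^ 4

/-- If the numbers `1` and `x i`, `i ∈ s`, have sum `0`, the quantity
`2 ∑ x⁴ - (∑ x²)²` is bounded by its value for equal `x i`, with a correction for
the deviations from the mean. -/
lemma sum_pow_four_add_le {s : Finset ι} {m : ℕ} (hs : s.card = m) (hm : 2 ≤ m) {x : ι → ℝ}
    (hx : ∑ i ∈ s, x i = -1) :
    2 * (1 + ∑ i ∈ s, x i ^ 4) - (1 + ∑ i ∈ s, x i ^ 2) ^ 2 + ∑ i ∈ s, devPoly m (x i + 1 / m) ≤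
      2 + 2 / (m : ℝ) ^ 3 - (1 + 1 / (m : ℝ)) ^ 2 := by
  have hm0 : (2 : ℝ) ≤ m := by exact_mod_cast hm
  have hm1 : (0 : ℝ) < m - 1 := by linarith
  have hm2 : (m : ℝ) ≠ 0 := by positivity
  set z : ι → ℝ := fun i => x i + 1 / m with hz
  have hxz : ∀ i, x i = z i - 1 / m := fun i => by simp [hz]
  have hz0 : ∑ i ∈ s, z i = 0 := by
    simp only [hz, sum_add_distrib, hx, sum_const, hs, nsmul_eq_mul]
    field_simp
    ring
  have e2 : ∑ i ∈ s, x i ^ 2 = ∑ i ∈ s, z i ^ 2 + 1 / m := by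
    have h1 : ∀ i ∈ s, x i ^ 2 = z i ^ 2 - 2 / m * z i + 1 / m ^ 2 := fun i _ => by
      rw [hxz]; ring
    rw [sum_congr rfl h1, sum_add_distrib, sum_sub_distrib, ← mul_sum, hz0, sum_const, hs,
      nsmul_eq_mul]
    field_simp
    ring
  have e4 : ∑ i ∈ s, x i ^ 4 = ∑ i ∈ s, z i ^ 4 - 4 / m * ∑ i ∈ s, z i ^ 3 +
      6 / m ^ 2 * ∑ i ∈ s, z i ^ 2 + 1 / m ^ 3 := by
    have h1 : ∀ i ∈ s, x i ^ 4 = z i ^ 4 - 4 / m * z i ^ 3 + 6 / m ^ 2 * z i ^ 2 -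
        4 / m ^ 3 * z i + 1 / m ^ 4 := fun i _ => by
      rw [hxz]; ring
    rw [sum_congr rfl h1, sum_add_distrib, sum_sub_distrib, sum_add_distrib, sum_sub_distrib,
      ← mul_sum, ← mul_sum, ← mul_sum, hz0, sum_const, hs, nsmul_eq_mul]
    field_simp
    ring
  have ed : ∑ i ∈ s, devPoly m (z i) = (2 + 2 / m - 12 / m ^ 2) * ∑ i ∈ s, z i ^ 2 +
      8 / m * ∑ i ∈ s, z i ^ 3 - (m - 2) / (m - 1) * ∑ i ∈ s, z i ^ 4 := by
    simp only [devPoly, sum_sub_distrib, sum_add_distrib, ← mul_sum]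
  have hdev : ∀ i ∈ s, m / (m - 1) * z i ^ 2 ≤ ∑ l ∈ s, z l ^ 2 := by
    intro i hi
    have h1 := add_sum_erase s z hi
    have h2 := add_sum_erase s (fun l => z l ^ 2) hi
    have h3 := sq_sum_le_card_mul_sum_sq (s := s.erase i) (f := z)
    have h4 : ∑ l ∈ s.erase i, z l = -z i := by linarith
    rw [h4, card_erase_of_mem hi, hs, Nat.cast_sub (by omega)] at h3
    have h5 : z i ^ 2 / (m - 1) ≤ ∑ l ∈ s.erase i, z l ^ 2 := by
      rw [div_le_iff₀ hm1]
      push_cast at h3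
      linarith
    rw [← h2]
    calc _ = z i ^ 2 + z i ^ 2 / (m - 1) := by field_simp; ring
      _ ≤ _ := by gcongr
  have h4 : m / (m - 1) * ∑ i ∈ s, z i ^ 4 ≤ (∑ i ∈ s, z i ^ 2) ^ 2 := by
    rw [sq, mul_sum, mul_sum]
    refine sum_le_sum fun i hi => ?_
    calc _ = m / (m - 1) * z i ^ 2 * z i ^ 2 := by ring
      _ ≤ _ := mul_le_mul_of_nonneg_right (hdev i hi) (sq_nonneg _)
  have e5 : (m - 2) / (m - 1) = 2 - m / ((m : ℝ) - 1) := by field_simp; ring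
  change 2 * (1 + ∑ i ∈ s, x i ^ 4) - (1 + ∑ i ∈ s, x i ^ 2) ^ 2 + ∑ i ∈ s, devPoly m (z i) ≤ _
  rw [ed, e2, e4, e5]
  set a := ∑ i ∈ s, z i ^ 2
  set b := ∑ i ∈ s, z i ^ 3
  set d := ∑ i ∈ s, z i ^ 4
  have : 2 + 2 / (m : ℝ) ^ 3 - (1 + 1 / (m : ℝ)) ^ 2 -
      (2 * (1 + (d - 4 / m * b + 6 / m ^ 2 * a + 1 / m ^ 3)) - (1 + (a + 1 / m)) ^ 2 +
      ((2 + 2 / m - 12 / m ^ 2) * a + 8 / m * b - (2 - m / (m - 1)) * d)) =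
      a ^ 2 - m / (m - 1) * d := by
    field_simp
    ring
  linarith

lemma devPoly_five_nonneg {z : ℝ} (h0 : -(4 / 5) ≤ z) (h1 : z ≤ 6 / 5) : 0 ≤ devPoly 5 z := by
  have : devPoly 5 z = z ^ 2 * (4 / 25 + (z + 4 / 5) * (11 / 5 - 3 / 4 * z)) := by
    rw [devPoly]; ring
  rw [this]
  have : 0 ≤ (z + 4 / 5) * (11 / 5 - 3 / 4 * z) := mul_nonneg (by linarith) (by linarith)
  positivity

lemma sum_devPoly_four_nonneg {s : Finset ι} (hs : s.card = 4) {z : ι → ℝ} (h0 : ∑ i ∈ s, z i = 0)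
    (hz : ∀ i ∈ s, -(3 / 4) ≤ z i ∧ z i ≤ 5 / 4) : 0 ≤ ∑ i ∈ s, devPoly 4 (z i) := by
  have e : ∀ z : ℝ, devPoly 4 z = z ^ 2 * (7 / 4 + 2 * z - 2 / 3 * z ^ 2) := by
    intro z
    rw [devPoly]; ring
  by_cases h : ∀ i ∈ s, -(7 / 10) ≤ z i
  · refine sum_nonneg fun i hi => ?_
    rw [e]
    have h1 := h i hi
    have h2 := (hz i hi).2
    have : 0 ≤ 7 / 4 + 2 * z i - 2 / 3 * z i ^ 2 := by
      nlinarith [mul_nonneg (sub_nonneg.2 h1) (sub_nonneg.2 h2)]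
    positivity
  · -- An entry close to the lower end makes its own term negative, but the other ones large.
    push Not at h
    obtain ⟨i, hi, hlt⟩ := h
    rw [← add_sum_erase s _ hi]
    rw [← add_sum_erase s _ hi] at h0
    have h1 : -(2 / 25) ≤ devPoly 4 (z i) := by
      rw [e]
      obtain ⟨h2, h3⟩ := hz i hi
      nlinarith [mul_nonneg (sub_nonneg.2 h2) (sub_nonneg.2 hlt.le), sq_nonneg (z i)]
    have h2 : ∀ l ∈ s.erase i, 4 / 5 * z l - 13 / 100 ≤ devPoly 4 (z l) := by
      intro l hl
      obtain ⟨h2, h3⟩ := hz l (mem_of_mem_erase hl)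
      rw [e]
      nlinarith [mul_nonneg (sub_nonneg.2 h2) (sub_nonneg.2 h3),
        mul_nonneg (sq_nonneg (z l)) (mul_nonneg (sub_nonneg.2 h2) (sub_nonneg.2 h3)),
        sq_nonneg (z l), sq_nonneg (z l - 1 / 4), mul_nonneg (sq_nonneg (z l)) (sub_nonneg.2 h2)]
    have h3 := sum_le_sum h2
    rw [sum_sub_distrib, ← mul_sum, sum_const, card_erase_of_mem hi, hs, nsmul_eq_mul] at h3
    norm_num at h3
    linarith

end DegreeFour

/-! ### Bounds by the mean and the largest difference -/

section DegreeThree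

variable {ι : Type*}

/-- The constant in the bound for the part of `phi` that depends on the difference of the two
distributions. -/
noncomputable def diffConst (m : ℝ) : ℝ := 2 + 2 / m ^ 3 - (1 + 1 / m) ^ 2

/-- The mean of two vectors. -/
noncomputable def mean (p q : ι → ℝ) : ι → ℝ := fun i => (p i + q i) / 2

lemma mean_mem [Fintype ι] {p q : ι → ℝ} (hp : p ∈ stdSimplex ℝ ι) (hq : q ∈ stdSimplex ℝ ι) :
    mean p q ∈ stdSimplex ℝ ι := by
  refine ⟨fun i => ?_, ?_⟩
  · have := hp.1 i
    have := hq.1 i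
    unfold mean
    positivity
  · simp only [mean]
    rw [← sum_div, sum_add_distrib, hp.2, hq.2]
    norm_num

/-- The normalized differences lie in `[-1, 1]`. -/
lemma abs_quotient_le {p q : ι → ℝ} {k : ι} (hk : ∀ h, |p h - q h| ≤ |p k - q k|) (h : ι) :
    |(p h - q h) / (p k - q k)| ≤ 1 := by
  rw [abs_div]
  exact div_le_one_of_le₀ (hk h) (abs_nonneg _)

variable [DecidableEq ι] [Fintype ι]

/-- The bound for `phi` in degree three, for the symbol `k` with the largest difference. -/
lemma phi_three_add_le {m : ℕ} (hcard : Fintype.card ι = m + 1) (hm : 2 ≤ m) {p q : ι → ℝ}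
    (hp : p ∈ stdSimplex ℝ ι) (hq : q ∈ stdSimplex ℝ ι) {k : ι}
    (hk : ∀ h, |p h - q h| ≤ |p k - q k|) :
    phi univ 3 p q + ((p k - q k) / 2) ^ 4 *
        ∑ h ∈ univ.erase k, devPoly m ((p h - q h) / (p k - q k) + 1 / m) ≤
      8 * esym univ 4 (mean p q) + diffConst m * ((p k - q k) / 2) ^ 4 := by
  set r : ι → ℝ := fun i => (p i - q i) / 2 with hr
  have ep : mean p q + r = p := by
    ext i
    simp only [mean, hr, Pi.add_apply]
    ring
  have eq : mean p q - r = q := by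
    ext i
    simp only [mean, hr, Pi.sub_apply]
    ring
  have h1 := phi_add_sub univ (mean p q) r
  rw [ep, eq] at h1
  have hr0 : ∑ i, r i = 0 := by
    simp only [hr]
    rw [← sum_div, sum_sub_distrib, hp.2, hq.2]
    norm_num
  have h2 := esym_four_eq univ r hr0
  have hk' : (p k - q k) / 2 = r k := rfl
  rw [h1, hk']
  have hquot : ∀ h, (p h - q h) / (p k - q k) = r h / r k := by
    intro h
    simp only [hr]
    rw [div_div_div_cancel_right₀ two_ne_zero]
  simp only [hquot]
  suffices h : r k ^ 4 * ∑ h ∈ univ.erase k, devPoly m (r h / r k + 1 / m) +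
      (2 * ∑ i, r i ^ 4 - (∑ i, r i ^ 2) ^ 2) ≤ diffConst m * r k ^ 4 by linarith
  rcases eq_or_ne (r k) 0 with h0 | h0
  · have hz : ∀ i, r i = 0 := by
      intro i
      have h3 := hk i
      have h4 : p k - q k = 2 * r k := by simp only [hr]; ring
      rw [h4, h0, mul_zero, abs_zero] at h3
      have := abs_nonpos_iff.1 h3
      simp [hr, this]
    simp [hz]
  · set x : ι → ℝ := fun i => r i / r k with hx
    have hrx : ∀ i, r i = r k * x i := fun i => by simp only [hx]; field_simp
    have hxk : x k = 1 := div_self h0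
    have hxs : ∑ i ∈ univ.erase k, x i = -1 := by
      have : ∑ i, x i = 0 := by simp only [hx]; rw [← sum_div, hr0, zero_div]
      rw [← add_sum_erase univ x (mem_univ k), hxk] at this
      linarith
    have key := sum_pow_four_add_le (s := univ.erase k) (m := m)
      (by rw [card_erase_of_mem (mem_univ k), card_univ, hcard]; rfl) hm hxs
    have e4 : ∑ i, r i ^ 4 = r k ^ 4 * (1 + ∑ i ∈ univ.erase k, x i ^ 4) := by
      rw [sum_congr rfl fun i _ => by rw [hrx i, mul_pow], ← mul_sum,
        ← add_sum_erase univ _ (mem_univ k), hxk, one_pow]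
    have e2 : ∑ i, r i ^ 2 = r k ^ 2 * (1 + ∑ i ∈ univ.erase k, x i ^ 2) := by
      rw [sum_congr rfl fun i _ => by rw [hrx i, mul_pow], ← mul_sum,
        ← add_sum_erase univ _ (mem_univ k), hxk, one_pow]
    rw [e4, e2, diffConst]
    have h4 : 0 ≤ r k ^ 4 := by positivity
    linarith [mul_le_mul_of_nonneg_left key h4]

lemma sum_devPoly_arg {m : ℕ} (hcard : Fintype.card ι = m + 1) (hm : 0 < m) {p q : ι → ℝ}
    (hp : p ∈ stdSimplex ℝ ι) (hq : q ∈ stdSimplex ℝ ι) {k : ι} (h0 : p k - q k ≠ 0) :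
    ∑ h ∈ univ.erase k, ((p h - q h) / (p k - q k) + 1 / (m : ℝ)) = 0 := by
  have hm' : (m : ℝ) ≠ 0 := by positivity
  rw [sum_add_distrib, ← sum_div, sum_const, card_erase_of_mem (mem_univ k), card_univ, hcard]
  have : ∑ h ∈ univ.erase k, (p h - q h) = -(p k - q k) := by
    have : ∑ h, (p h - q h) = 0 := by rw [sum_sub_distrib, hp.2, hq.2, sub_self]
    rw [← add_sum_erase univ _ (mem_univ k)] at this
    linarith
  rw [this, neg_div, div_self h0]
  simp only [add_tsub_cancel_right, nsmul_eq_mul]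
  field_simp
  ring

lemma phi_three_le_five (hcard : Fintype.card ι = 5) {p q : ι → ℝ}
    (hp : p ∈ stdSimplex ℝ ι) (hq : q ∈ stdSimplex ℝ ι) {k : ι}
    (hk : ∀ h, |p h - q h| ≤ |p k - q k|) :
    phi univ 3 p q ≤ 8 * esym univ 4 (mean p q) + 15 / 32 * ((p k - q k) / 2) ^ 4 := by
  have h := phi_three_add_le (m := 4) hcard (by norm_num) hp hq hk
  have hc : diffConst (4 : ℕ) = 15 / 32 := by norm_num [diffConst]
  rw [hc] at h
  have hd : 0 ≤ ((p k - q k) / 2) ^ 4 *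
      ∑ h ∈ univ.erase k, devPoly (4 : ℕ) ((p h - q h) / (p k - q k) + 1 / (4 : ℕ)) := by
    rcases eq_or_ne (p k - q k) 0 with h0 | h0
    · rw [h0]; norm_num
    refine mul_nonneg (by positivity) ?_
    have := sum_devPoly_four_nonneg (s := univ.erase k)
      (by rw [card_erase_of_mem (mem_univ k), card_univ, hcard])
      (sum_devPoly_arg (m := 4) hcard (by norm_num) hp hq h0) (fun i _ => ?_)
    · exact_mod_cast this
    · have := abs_le.1 (abs_quotient_le hk i)
      push_cast
      constructor <;> linarith
  linarith

lemma phi_three_le_six (hcard : Fintype.card ι = 6) {p q : ι → ℝ}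
    (hp : p ∈ stdSimplex ℝ ι) (hq : q ∈ stdSimplex ℝ ι) {k : ι}
    (hk : ∀ h, |p h - q h| ≤ |p k - q k|) :
    phi univ 3 p q ≤ 8 * esym univ 4 (mean p q) + 72 / 125 * ((p k - q k) / 2) ^ 4 := by
  have h := phi_three_add_le (m := 5) hcard (by norm_num) hp hq hk
  have hc : diffConst (5 : ℕ) = 72 / 125 := by norm_num [diffConst]
  rw [hc] at h
  have hd : 0 ≤ ((p k - q k) / 2) ^ 4 *
      ∑ h ∈ univ.erase k, devPoly (5 : ℕ) ((p h - q h) / (p k - q k) + 1 / (5 : ℕ)) := by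
    refine mul_nonneg (by positivity) (sum_nonneg fun i _ => ?_)
    have := abs_le.1 (abs_quotient_le hk i)
    have := devPoly_five_nonneg (z := (p i - q i) / (p k - q k) + 1 / 5) (by linarith) (by linarith)
    exact_mod_cast this
  linarith

lemma esym_four_le_one {m : ℕ} (hcard : Fintype.card ι = m + 1) {x : ι → ℝ}
    (hx : x ∈ stdSimplex ℝ ι) (i : ι) : esym univ 4 x ≤
      m.choose 4 * ((1 - x i) / m) ^ 4 + x i * (m.choose 3 * ((1 - x i) / m) ^ 3) := by
  have := esym_le_of_mem (mem_univ i) 3 (fun l _ => hx.1 l) (by rw [card_univ, hcard]) le_rfl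
  rwa [hx.2] at this

/-- Maclaurin's inequality in degree four for all entries except two. -/
lemma esym_four_le_two {n : ℕ} (hcard : Fintype.card ι = n + 2) {x : ι → ℝ}
    (hx : x ∈ stdSimplex ℝ ι) {i h : ι} (hih : i ≠ h) {w : ℝ} (hw : n * w = 1 - x i - x h) :
    esym univ 4 x ≤ n.choose 4 * w ^ 4 + (x i + x h) * (n.choose 3 * w ^ 3) +
      x i * x h * (n.choose 2 * w ^ 2) := by
  rcases Nat.eq_zero_or_pos n with rfl | hn
  · have : esym univ 4 x = 0 := esym_eq_zero (by rw [card_univ, hcard]; norm_num) x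
    rw [this]
    simp
  set s := (univ.erase i).erase h with hs
  have hcs : s.card = n := card_erase_erase hcard hih
  have hn' : (0 : ℝ) < n := by exact_mod_cast hn
  have hw' : w = (∑ l ∈ s, x l) / s.card := by
    rw [hs, sum_erase_erase hih, hx.2, ← hs, hcs, ← hw]
    field_simp
  have b : ∀ d, esym s d x ≤ n.choose d * w ^ d := by
    intro d
    have := esym_le s d fun l _ => hx.1 l
    rwa [← hw', hcs] at this
  have e : esym univ 4 x = esym s 4 x + (x i + x h) * esym s 3 x + x i * x h * esym s 2 x := by
    have hu : (univ : Finset ι) = insert i (insert h s) := by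
      rw [hs, insert_erase (mem_erase.2 ⟨hih.symm, mem_univ _⟩), insert_erase (mem_univ _)]
    rw [hu, esym_insert (by simp [hs, hih]), esym_insert (by simp [hs]), esym_insert (by simp [hs])]
    ring
  rw [e]
  have hi := hx.1 i
  have hh := hx.1 h
  have b4 := b 4
  have b3 := b 3
  have b2 := b 2
  gcongr

end DegreeThree

/-! ### The minimum-based partition on five symbols, `j = 3` -/

section Five

/-- The elementary symmetric polynomial of degree four of the distribution on five symbols with one
entry `y` and four equal ones. -/
noncomputable def gFive (y : ℝ) : ℝ := 4 * ((1 - y) / 4) ^ 3 - 15 * ((1 - y) / 4) ^ 4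

lemma gFive_mono {x y : ℝ} (hxy : x ≤ y) (hy : y ≤ 1 / 5) : gFive x ≤ gFive y := by
  unfold gFive
  set a := (1 - x) / 4 with ha
  set b := (1 - y) / 4 with hb
  have hb1 : 1 / 5 ≤ b := by rw [hb]; linarith
  have hab : b ≤ a := by rw [ha, hb]; linarith
  have h1 : 0 ≤ 15 * (a + b) * (a ^ 2 + b ^ 2) - 4 * (a ^ 2 + a * b + b ^ 2) := by
    nlinarith [sq_nonneg (a - b), mul_nonneg (by linarith : 0 ≤ a + b - 2 / 5)
      (by positivity : 0 ≤ a ^ 2 + b ^ 2)]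
  nlinarith [mul_nonneg (sub_nonneg.2 hab) h1]

lemma gFive_anti {x y : ℝ} (hx : 1 / 5 ≤ x) (hxy : x ≤ y) (hy : y ≤ 1) : gFive y ≤ gFive x := by
  unfold gFive
  set a := (1 - x) / 4 with ha
  set b := (1 - y) / 4 with hb
  have ha1 : a ≤ 1 / 5 := by rw [ha]; linarith
  have hab : b ≤ a := by rw [ha, hb]; linarith
  have hb0 : 0 ≤ b := by rw [hb]; linarith
  have h1 : 0 ≤ 4 * (a ^ 2 + a * b + b ^ 2) - 15 * (a + b) * (a ^ 2 + b ^ 2) := by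
    nlinarith [sq_nonneg (a - b), mul_nonneg (sub_nonneg.2 ha1) (sq_nonneg a),
      mul_nonneg (sub_nonneg.2 (hab.trans ha1)) (sq_nonneg b),
      mul_nonneg (mul_nonneg (hb0.trans hab) hb0) (sub_nonneg.2 ha1),
      mul_nonneg (mul_nonneg (hb0.trans hab) hb0) (sub_nonneg.2 (hab.trans ha1))]
  nlinarith [mul_nonneg (sub_nonneg.2 hab) h1]

lemma esym_four_le_gFive {x : Fin 5 → ℝ} (hx : x ∈ stdSimplex ℝ (Fin 5)) (i : Fin 5) :
    esym univ 4 x ≤ gFive (x i) := by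
  refine (esym_four_le_one (m := 4) (Fintype.card_fin 5) hx i).trans (le_of_eq ?_)
  norm_num [gFive, Nat.choose]
  ring

lemma exists_max_diff {b : ℕ} (p q : Fin (b + 1) → ℝ) : ∃ k, ∀ h, |p h - q h| ≤ |p k - q k| := by
  obtain ⟨k, -, hk⟩ := exists_max_image univ (fun h => |p h - q h|) univ_nonempty
  exact ⟨k, fun h => hk h (mem_univ h)⟩

/-- The bounds for half the difference `ρ` of two entries in terms of their mean. -/
lemma diff_bounds {ι : Type*} [Fintype ι] {p q : ι → ℝ} (hp : p ∈ stdSimplex ℝ ι)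
    (hq : q ∈ stdSimplex ℝ ι) (k : ι) {ε : ℝ} (hpε : ε ≤ p k) (hqε : ε ≤ q k) :
    |p k - q k| / 2 ≤ mean p q k - ε ∧ |p k - q k| / 2 ≤ 1 - mean p q k := by
  classical
  have h1 := le_one_of_mem_stdSimplex hp k
  have h2 := le_one_of_mem_stdSimplex hq k
  unfold mean
  rcases abs_cases (p k - q k) with ⟨h, _⟩ | ⟨h, _⟩ <;> rw [h] <;> constructor <;> linarith

lemma Psi_le_five {p q : Fin 5 → ℝ} (hp : p ∈ stdSimplex ℝ (Fin 5))
    (hq : q ∈ stdSimplex ℝ (Fin 5)) {k : Fin 5} (hk : ∀ h, |p h - q h| ≤ |p k - q k|)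
    (i : Fin 5) : Psi 5 3 p q ≤ 48 * gFive (mean p q i) + 45 / 16 * (|p k - q k| / 2) ^ 4 := by
  have h1 := phi_three_le_five (Fintype.card_fin 5) hp hq hk
  have h2 := esym_four_le_gFive (mean_mem hp hq) i
  have h3 : (|p k - q k| / 2) ^ 4 = ((p k - q k) / 2) ^ 4 := by
    rw [div_pow, div_pow, ← abs_pow, abs_of_nonneg (by positivity)]
  rw [Psi_eq (by norm_num), h3]
  norm_num [Nat.factorial]
  linarith

/-- The part of the bound of `Psi_le_five` that concerns means larger than `1 / 2`. -/
lemma gFive_add_le_of_half_le {y ρ : ℝ} (hy : 1 / 2 ≤ y) (hρ : 0 ≤ ρ) (hρy : ρ ≤ 1 - y) :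
    48 * gFive y + 45 / 16 * ρ ^ 4 ≤ 3 / 8 := by
  have h1 : 0 ≤ 1 - y := hρ.trans hρy
  have h2 : ρ ^ 4 ≤ (1 - y) ^ 4 := by gcongr
  have h3 : (1 - y) ^ 3 ≤ (1 / 2) ^ 3 := by gcongr; linarith
  unfold gFive
  nlinarith

lemma gFive_add_le {y ρ : ℝ} (hρ : 0 ≤ ρ) (hρy : ρ ≤ y) (hρy' : ρ ≤ 1 - y) :
    48 * gFive y + 45 / 16 * ρ ^ 4 ≤ 0.38922575 := by
  rcases le_total (1 / 2) y with h | h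
  · exact (gFive_add_le_of_half_le h hρ hρy').trans (by norm_num)
  have h2 : ρ ^ 4 ≤ y ^ 4 := by gcongr
  refine (add_le_add le_rfl (mul_le_mul_of_nonneg_left h2 (by norm_num))).trans ?_
  obtain ⟨d, rfl⟩ : ∃ d, y = 1 / 5 + 4 * d := ⟨(y - 1 / 5) / 4, by ring⟩
  -- The constant is close to the local maximum of a cubic polynomial in `d`.
  have h3 : 0 ≤ 528 * ((d - 0.0041355912) ^ 2 * (0.0803 - d)) :=
    mul_nonneg (by norm_num) (mul_nonneg (sq_nonneg _) (by linarith))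
  have h4 : 0 ≤ (d - 0.0041355912) ^ 2 := sq_nonneg _
  unfold gFive
  ring_nf at h3 h4 ⊢
  linarith

lemma gFive_add_le_of_balanced {y ρ : ℝ} (hρ : 0 ≤ ρ) (hρy : ρ ≤ y - 0.141728)
    (hρy' : ρ ≤ 1 - y) : 48 * gFive y + 45 / 16 * ρ ^ 4 ≤ 0.3840328 := by
  rcases le_total (1 / 2) y with h | h
  · exact (gFive_add_le_of_half_le h hρ hρy').trans (by norm_num)
  have h2 : ρ ^ 4 ≤ (y - 0.141728) ^ 4 := by gcongr
  refine (add_le_add le_rfl (mul_le_mul_of_nonneg_left h2 (by norm_num))).trans ?_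
  obtain ⟨d, rfl⟩ : ∃ d, y = 1 / 5 + 4 * d := ⟨(y - 1 / 5) / 4, by ring⟩
  have h3 : 0 ≤ 425.95584 * ((d - 0.00007861271) ^ 2 * (0.1329 - d)) :=
    mul_nonneg (by norm_num) (mul_nonneg (sq_nonneg _) (by linarith))
  have h4 : 0 ≤ (d - 0.00007861271) ^ 2 := sq_nonneg _
  unfold gFive
  ring_nf at h3 h4 ⊢
  linarith

lemma mem_minClosed_diff {b : ℕ} {ε : ℝ} {i k : Fin b} {p q : Fin b → ℝ}
    (hp : p ∈ minClosed b ε i) (hq : q ∈ minClosed b ε i) :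
    |p k - q k| / 2 ≤ mean p q k - (2 * mean p q i - ε) := by
  have h1 := hp.2.1
  have h2 := hq.2.1
  have h3 := hp.2.2 k
  have h4 := hq.2.2 k
  unfold mean
  rcases abs_cases (p k - q k) with ⟨h, _⟩ | ⟨h, _⟩ <;> rw [h] <;> linarith

lemma Psi_le_five_of_minClosed {ε : ℝ} (hε : ε ≤ 0.141729) {p q : Fin 5 → ℝ}
    (hp : p ∈ minClosed 5 ε 0) (hq : q ∈ minClosed 5 ε 0) : Psi 5 3 p q ≤ 0.3747 := by
  obtain ⟨k, hk⟩ := exists_max_diff p q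
  have hP0 := Psi_le_five hp.1 hq.1 hk 0
  have hPk := Psi_le_five hp.1 hq.1 hk k
  obtain ⟨b1, b2⟩ := diff_bounds hp.1 hq.1 k (ε := 0) (hp.1.1 k) (hq.1.1 k)
  have b3 := mem_minClosed_diff (k := k) hp hq
  have b0 := (diff_bounds hp.1 hq.1 0 (ε := 0) (hp.1.1 0) (hq.1.1 0)).1
  have hx1 : mean p q 0 ≤ 0.141729 := by
    have := hp.2.1
    have := hq.2.1
    unfold mean
    linarith
  have hx0 := (mean_mem hp.1 hq.1).1 0
  have hρ : 0 ≤ |p k - q k| / 2 := by positivity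
  -- If one entry of a distribution is close to `1`, its smallest entry is close to `0`.
  have hxρ : mean p q 0 ≤ 1 / 2 - |p k - q k| / 2 ∨ k = 0 := by
    by_cases hk0 : k = 0
    · exact Or.inr hk0
    · left
      have h1 : p 0 + p k ≤ 1 := by
        rw [← hp.1.2, ← sum_pair (Ne.symm hk0)]
        exact sum_le_univ_sum_of_nonneg hp.1.1
      have h2 : q 0 + q k ≤ 1 := by
        rw [← hq.1.2, ← sum_pair (Ne.symm hk0)]
        exact sum_le_univ_sum_of_nonneg hq.1.1
      have h3 := hp.2.2 k
      have h4 := hq.2.2 k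
      unfold mean
      rcases abs_cases (p k - q k) with ⟨h, _⟩ | ⟨h, _⟩ <;> rw [h] <;> linarith
  set ρ := |p k - q k| / 2 with hρdef
  set x := mean p q 0 with hx
  set y := mean p q k with hy
  clear_value ρ x y
  have bound {z a r : ℝ} (h : gFive z ≤ gFive a) (hr : ρ ≤ r)
      (ha : 48 * gFive a + 45 / 16 * r ^ 4 ≤ 0.3747) : 48 * gFive z + 45 / 16 * ρ ^ 4 ≤ 0.3747 := by
    have : ρ ^ 4 ≤ r ^ 4 := by gcongr
    linarith
  by_cases h1 : ρ ≤ 0.19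
  · exact hP0.trans (bound (gFive_mono hx1 (by norm_num)) h1 (by norm_num [gFive]))
  push Not at h1
  have hxρ' : x ≤ 1 / 2 - ρ := by
    rcases hxρ with h | h
    · exact h
    · have : y = x := by rw [hx, hy, h]
      linarith
  rcases le_or_gt y 0.33 with h2 | h2
  · rcases le_or_gt x 0.09 with h3 | h3
    · exact hP0.trans (bound (gFive_mono h3 (by norm_num)) (by linarith : ρ ≤ 0.33)
        (by norm_num [gFive]))
    rcases le_or_gt x 0.115 with h4 | h4
    · exact hP0.trans (bound (gFive_mono h4 (by norm_num)) (by linarith : ρ ≤ 0.29173)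
        (by norm_num [gFive]))
    · exact hPk.trans (bound (gFive_anti (x := 0.27827) (by norm_num) (by linarith) (by linarith))
        (by linarith : ρ ≤ 0.24174) (by norm_num [gFive]))
  rcases le_or_gt y 0.499 with h3 | h3
  · have h4 : ρ ^ 4 ≤ y ^ 4 := by gcongr; linarith
    have h5 : 0 ≤ (y - 0.33) * (0.499 - y) := mul_nonneg (by linarith) (by linarith)
    have h6 : 0 ≤ (y - 0.33) * (0.499 - y) * (y - 0.33) := mul_nonneg h5 (by linarith)
    have h7 : 48 * gFive y + 45 / 16 * y ^ 4 ≤ 0.3747 := by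
      unfold gFive
      ring_nf at h5 h6 ⊢
      linarith
    linarith
  rcases le_or_gt ρ 0.499 with h4 | h4
  · exact hPk.trans (bound (gFive_anti (by norm_num) h3.le (by linarith)) h4 (by norm_num [gFive]))
  · exact hP0.trans (bound (gFive_mono (by linarith : x ≤ 0.001) (by norm_num))
      (by linarith : ρ ≤ 0.5) (by norm_num [gFive]))

lemma sqrt_five_bounds : 0.141728 ≤ (4 + √5) / 44 ∧ (4 + √5) / 44 ≤ 0.141729 := by
  have h1 : (2.23606 : ℝ) ≤ √5 := Real.le_sqrt_of_sq_le (by norm_num)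
  have h2 : √5 ≤ (2.23607 : ℝ) := Real.sqrt_le_iff.2 ⟨by norm_num, by norm_num⟩
  constructor <;> linarith

lemma Psi_five_le {p q : Fin 5 → ℝ} (hp : p ∈ ProbDist 5) (hq : q ∈ ProbDist 5) :
    Psi 5 3 p q ≤ 0.38922575 := by
  obtain ⟨k, hk⟩ := exists_max_diff p q
  have h1 := Psi_le_five hp hq hk k
  obtain ⟨b1, b2⟩ := diff_bounds hp hq k (ε := 0) (hp.1 k) (hq.1 k)
  exact h1.trans (gFive_add_le (by positivity) (by linarith) b2)

lemma Psi_five_le_of_balanced {ε : ℝ} (hε : 0.141728 ≤ ε) {p q : Fin 5 → ℝ}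
    (hp : p ∈ minBalanced 5 ε) (hq : q ∈ minBalanced 5 ε) : Psi 5 3 p q ≤ 0.3840328 := by
  obtain ⟨k, hk⟩ := exists_max_diff p q
  have h1 := Psi_le_five hp.1 hq.1 hk k
  obtain ⟨b1, b2⟩ := diff_bounds hp.1 hq.1 k (ε := ε) (hp.2 k) (hq.2 k)
  exact h1.trans (gFive_add_le_of_balanced (by positivity) (by linarith) b2)

/-- The coefficients of the cluster form for the minimum-based partition on five symbols. -/
lemma five_coefficients {ε : ℝ} (hε : 0.141728 ≤ ε) (hε' : ε ≤ 0.141729) :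
    (0.38403276 ≤ supPsi 5 3 (minBalanced 5 ε) (minBalanced 5 ε) ∧
      supPsi 5 3 (minBalanced 5 ε) (minBalanced 5 ε) ≤ 0.3840328) ∧
    (0.38922572 ≤ supPsi 5 3 (minBalanced 5 ε) (minClosed 5 ε 0) ∧
      supPsi 5 3 (minBalanced 5 ε) (minClosed 5 ε 0) ≤ 0.38922575) ∧
    (0.3705 ≤ supPsi 5 3 (minClosed 5 ε 0) (minClosed 5 ε 0) ∧
      supPsi 5 3 (minClosed 5 ε 0) (minClosed 5 ε 0) ≤ 0.3747) ∧
    (0.38922572 ≤ supPsi 5 3 (minClosed 5 ε 0) (minClosed 5 ε 1) ∧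
      supPsi 5 3 (minClosed 5 ε 0) (minClosed 5 ε 1) ≤ 0.38922575) := by
  have hB := minBalanced_subset 5 ε
  have hC := minClosed_subset ε (0 : Fin 5)
  have hC' := minClosed_subset ε (1 : Fin 5)
  refine ⟨⟨?_, ?_⟩, ⟨?_, ?_⟩, ⟨?_, ?_⟩, ?_, ?_⟩
  · have hp : vec 3 0.141729 (0.858271 / 4) (0.858271 / 4) ∈ minBalanced 5 ε :=
      ⟨vec_mem (by norm_num) (by norm_num) (by norm_num) (by norm_num),
        forall_vec (P := fun v => ε ≤ v) hε' (by linarith) (by linarith)⟩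
    have hq : vec 3 0.2589 (0.7411 / 4) (0.7411 / 4) ∈ minBalanced 5 ε :=
      ⟨vec_mem (by norm_num) (by norm_num) (by norm_num) (by norm_num),
        forall_vec (P := fun v => ε ≤ v) (by linarith) (by linarith) (by linarith)⟩
    refine le_trans ?_ (le_supPsi (j := 3) hB hB hp hq)
    rw [Psi_vec (n := 3) (k := 1) (by norm_num)]
    norm_num [Nat.choose, Nat.factorial]
  · exact supPsi_le (by norm_num) fun p hp q hq => Psi_five_le_of_balanced hε hp hq
  · have hp : vec 3 0.433084 0.141729 (0.425187 / 3) ∈ minBalanced 5 ε :=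
      ⟨vec_mem (by norm_num) (by norm_num) (by norm_num) (by norm_num),
        forall_vec (P := fun v => ε ≤ v) (by linarith) (by linarith) (by linarith)⟩
    have hq : vec 3 0 (1 / 4) (1 / 4) ∈ minClosed 5 ε 0 :=
      ⟨vec_mem (by norm_num) (by norm_num) (by norm_num) (by norm_num),
        by change (0 : ℝ) ≤ ε; linarith,
        forall_vec (P := fun v => (0 : ℝ) ≤ v) (by norm_num) (by norm_num) (by norm_num)⟩
    refine le_trans ?_ (le_supPsi (j := 3) hB hC hp hq)
    rw [Psi_vec (n := 3) (k := 1) (by norm_num)]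
    norm_num [Nat.choose, Nat.factorial]
  · exact supPsi_le (by norm_num) fun p hp q hq => Psi_five_le hp.1 hq.1
  · have hp : vec 3 0.141728 (0.858272 / 4) (0.858272 / 4) ∈ minClosed 5 ε 0 :=
      ⟨vec_mem (by norm_num) (by norm_num) (by norm_num) (by norm_num), hε,
        forall_vec (P := fun v => (0.141728 : ℝ) ≤ v) (by norm_num) (by norm_num) (by norm_num)⟩
    refine le_trans ?_ (le_supPsi (j := 3) hC hC hp hp)
    rw [Psi_vec (n := 3) (k := 1) (by norm_num)]
    norm_num [Nat.choose, Nat.factorial]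
  · exact supPsi_le (by norm_num) fun p hp q hq => Psi_le_five_of_minClosed hε' hp hq
  · have hp : vec 3 0.1417 0.4332 (0.4251 / 3) ∈ minClosed 5 ε 0 :=
      ⟨vec_mem (by norm_num) (by norm_num) (by norm_num) (by norm_num),
        by change (0.1417 : ℝ) ≤ ε; linarith,
        forall_vec (P := fun v => (0.1417 : ℝ) ≤ v) (by norm_num) (by norm_num) (by norm_num)⟩
    have hq : vec 3 (1 / 4) 0 (1 / 4) ∈ minClosed 5 ε 1 :=
      ⟨vec_mem (by norm_num) (by norm_num) (by norm_num) (by norm_num),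
        by change (0 : ℝ) ≤ ε; linarith,
        forall_vec (P := fun v => (0 : ℝ) ≤ v) (by norm_num) (by norm_num) (by norm_num)⟩
    refine le_trans ?_ (le_supPsi (j := 3) hC hC' hp hq)
    rw [Psi_vec (n := 3) (k := 1) (by norm_num)]
    norm_num [Nat.choose, Nat.factorial]
  · exact supPsi_le (by norm_num) fun p hp q hq => Psi_five_le hp.1 hq.1

theorem exists_isMinPartitionM_five :
    ∃ M : ℝ, IsMinPartitionM 5 5 ((4 + √5) / 44) M ∧
      M ≤ 0.3873676 ∧ 0.3873676 - M ≤ 4 / 10 ^ 4 := by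
  obtain ⟨hε, hε'⟩ := sqrt_five_bounds
  obtain ⟨⟨l₁, u₁⟩, ⟨l₂, u₂⟩, ⟨l₃, u₃⟩, l₄, u₄⟩ := five_coefficients hε hε'
  obtain ⟨M, hM⟩ := exists_isClusterMax 5 _ _ _ _
  refine ⟨M, isPartitionMax_min (by norm_num) (by linarith) (i₀ := 0) (h₀ := 1) (by decide) hM,
    ?_, ?_⟩
  · exact hM.le_of_le (by norm_num) u₁ u₂ u₃ u₄ (by norm_num) (by norm_num) (by norm_num)
      (Or.inr (by norm_num))
  · have := hM.le (x := 0.6) (by norm_num) (by norm_num) (by norm_num) l₁ l₂ l₃ l₄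
    norm_num at this ⊢
    linarith

theorem five_coefficient_bound {i h : Fin 5} (hih : i ≠ h) :
    supPsi 5 3 (minUnbalanced 5 ((4 + √5) / 44) i) (minUnbalanced 5 ((4 + √5) / 44) i)
        ≤ 0.374759 ∧
      ∃ M : ℝ, IsClusterMax 5
        (supPsi 5 3 (minBalanced 5 ((4 + √5) / 44)) (minBalanced 5 ((4 + √5) / 44)))
        (supPsi 5 3 (minBalanced 5 ((4 + √5) / 44)) (minUnbalanced 5 ((4 + √5) / 44) i))
        0.374759
        (supPsi 5 3 (minUnbalanced 5 ((4 + √5) / 44) i) (minUnbalanced 5 ((4 + √5) / 44) h))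
        M ∧ |M - 0.3873676| ≤ 1 / 10 ^ 7 := by
  obtain ⟨hε, hε'⟩ := sqrt_five_bounds
  obtain ⟨⟨l₁, u₁⟩, ⟨l₂, u₂⟩, ⟨l₃, u₃⟩, l₄, u₄⟩ := five_coefficients hε hε'
  obtain ⟨e₂, e₃, e₄⟩ := supPsi_min_eq (j := 3) (by norm_num)
    (by linarith : 0 < (4 + √5) / 44) (i₀ := 0) (h₀ := 1) (by decide) hih
  rw [e₂, e₃, e₄]
  refine ⟨u₃.trans (by norm_num), ?_⟩
  obtain ⟨M, hM⟩ := exists_isClusterMax 5 _ _ _ _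
  refine ⟨M, hM, abs_le.2 ⟨?_, ?_⟩⟩
  · have := hM.le (x := 0.6422) (by norm_num) (by norm_num) (by norm_num) l₁ l₂ le_rfl l₄
    norm_num at this ⊢
    linarith
  · have := hM.le_of_le (T := 0.3873677) (by norm_num) u₁ u₂ le_rfl u₄ (by norm_num) (by norm_num)
      (by norm_num) (Or.inr (by norm_num))
    norm_num at this ⊢
    linarith

end Five

/-! ### The minimum-based partition on six symbols, `j = 3` -/

section SixFive

/-- The elementary symmetric polynomial of degree four of the distribution on six symbols with one
entry `y` and five equal ones. -/
noncomputable def gSix (y : ℝ) : ℝ := 10 * ((1 - y) / 5) ^ 3 - 45 * ((1 - y) / 5) ^ 4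

lemma gSix_mono {x y : ℝ} (hxy : x ≤ y) (hy : y ≤ 1 / 6) : gSix x ≤ gSix y := by
  unfold gSix
  set a := (1 - x) / 5 with ha
  set b := (1 - y) / 5 with hb
  have hb1 : 1 / 6 ≤ b := by rw [hb]; linarith
  have hab : b ≤ a := by rw [ha, hb]; linarith
  have h1 : 0 ≤ 45 * (a + b) * (a ^ 2 + b ^ 2) - 10 * (a ^ 2 + a * b + b ^ 2) := by
    nlinarith [sq_nonneg (a - b), mul_nonneg (by linarith : 0 ≤ a + b - 1 / 3)
      (by positivity : 0 ≤ a ^ 2 + b ^ 2)]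
  nlinarith [mul_nonneg (sub_nonneg.2 hab) h1]

lemma gSix_anti {x y : ℝ} (hx : 1 / 6 ≤ x) (hxy : x ≤ y) (hy : y ≤ 1) : gSix y ≤ gSix x := by
  unfold gSix
  set a := (1 - x) / 5 with ha
  set b := (1 - y) / 5 with hb
  have ha1 : a ≤ 1 / 6 := by rw [ha]; linarith
  have hab : b ≤ a := by rw [ha, hb]; linarith
  have hb0 : 0 ≤ b := by rw [hb]; linarith
  have h1 : 0 ≤ 10 * (a ^ 2 + a * b + b ^ 2) - 45 * (a + b) * (a ^ 2 + b ^ 2) := by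
    nlinarith [sq_nonneg (a - b), mul_nonneg (sub_nonneg.2 ha1) (sq_nonneg a),
      mul_nonneg (sub_nonneg.2 (hab.trans ha1)) (sq_nonneg b),
      mul_nonneg (mul_nonneg (hb0.trans hab) hb0) (sub_nonneg.2 ha1),
      mul_nonneg (mul_nonneg (hb0.trans hab) hb0) (sub_nonneg.2 (hab.trans ha1))]
  nlinarith [mul_nonneg (sub_nonneg.2 hab) h1]

lemma gSix_le (y : ℝ) : gSix y ≤ gSix (1 / 6) := by
  have : gSix (1 / 6) - gSix y =
      ((1 - y) / 5 - 1 / 6) ^ 2 * (45 * ((1 - y) / 5 + 1 / 18) ^ 2 + 5 / 18) := by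
    unfold gSix; ring
  have : 0 ≤ gSix (1 / 6) - gSix y := by rw [this]; positivity
  linarith

lemma esym_four_le_gSix {x : Fin 6 → ℝ} (hx : x ∈ stdSimplex ℝ (Fin 6)) (i : Fin 6) :
    esym univ 4 x ≤ gSix (x i) := by
  refine (esym_four_le_one (m := 5) (Fintype.card_fin 6) hx i).trans (le_of_eq ?_)
  norm_num [gSix, Nat.choose]
  ring

lemma Psi_le_six {p q : Fin 6 → ℝ} (hp : p ∈ stdSimplex ℝ (Fin 6))
    (hq : q ∈ stdSimplex ℝ (Fin 6)) {k : Fin 6} (hk : ∀ h, |p h - q h| ≤ |p k - q k|) :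
    Psi 6 3 p q ≤ 48 * esym univ 4 (mean p q) + 432 / 125 * (|p k - q k| / 2) ^ 4 := by
  have h1 := phi_three_le_six (Fintype.card_fin 6) hp hq hk
  have h3 : (|p k - q k| / 2) ^ 4 = ((p k - q k) / 2) ^ 4 := by
    rw [div_pow, div_pow, ← abs_pow, abs_of_nonneg (by positivity)]
  rw [Psi_eq (by norm_num), h3]
  norm_num [Nat.factorial]
  linarith

/-- The part of the bound of `Psi_le_six` that concerns means larger than `1 / 2`. -/
lemma gSix_add_le_of_half_le {y ρ : ℝ} (hy : 1 / 2 ≤ y) (hρ : 0 ≤ ρ) (hρy : ρ ≤ 1 - y) :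
    48 * gSix y + 432 / 125 * ρ ^ 4 ≤ 12 / 25 := by
  have h1 : 0 ≤ 1 - y := hρ.trans hρy
  have h2 : ρ ^ 4 ≤ (1 - y) ^ 4 := by gcongr
  have h3 : (1 - y) ^ 3 ≤ (1 / 2) ^ 3 := by gcongr; linarith
  unfold gSix
  nlinarith

lemma gSix_add_le {y ρ : ℝ} (hρ : 0 ≤ ρ) (hρy : ρ ≤ y) (hρy' : ρ ≤ 1 - y) :
    48 * gSix y + 432 / 125 * ρ ^ 4 ≤ 0.5584692 := by
  rcases le_total (1 / 2) y with h | h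
  · exact (gSix_add_le_of_half_le h hρ hρy').trans (by norm_num)
  have h2 : ρ ^ 4 ≤ y ^ 4 := by gcongr
  refine (add_le_add le_rfl (mul_le_mul_of_nonneg_left h2 (by norm_num))).trans ?_
  obtain ⟨d, rfl⟩ : ∃ d, y = 1 / 6 + 5 * d := ⟨(y - 1 / 6) / 5, by ring⟩
  -- The constant is close to the local maximum of a cubic polynomial in `d`.
  have h3 : 0 ≤ 1248 * ((d - 0.0015581927) ^ 2 * (0.0814 - d)) :=
    mul_nonneg (by norm_num) (mul_nonneg (sq_nonneg _) (by linarith))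
  have h4 : 0 ≤ (d - 0.0015581927) ^ 2 := sq_nonneg _
  unfold gSix
  ring_nf at h3 h4 ⊢
  linarith

lemma gSix_add_le_of_balanced {y ρ : ℝ} (hρ : 0 ≤ ρ) (hρy : ρ ≤ y - 1 / 10) (hρy' : ρ ≤ 1 - y) :
    48 * gSix y + 432 / 125 * ρ ^ 4 ≤ 0.5556248 := by
  rcases le_total (1 / 2) y with h | h
  · exact (gSix_add_le_of_half_le h hρ hρy').trans (by norm_num)
  have h2 : ρ ^ 4 ≤ (y - 1 / 10) ^ 4 := by gcongr
  refine (add_le_add le_rfl (mul_le_mul_of_nonneg_left h2 (by norm_num))).trans ?_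
  obtain ⟨d, rfl⟩ : ∃ d, y = 1 / 6 + 5 * d := ⟨(y - 1 / 6) / 5, by ring⟩
  have h3 : 0 ≤ 1075.2 * ((d - 0.0000871078) ^ 2 * (0.1092 - d)) :=
    mul_nonneg (by norm_num) (mul_nonneg (sq_nonneg _) (by linarith))
  have h4 : 0 ≤ (d - 0.0000871078) ^ 2 := sq_nonneg _
  unfold gSix
  ring_nf at h3 h4 ⊢
  linarith

/-- The elementary symmetric polynomial of degree four of the distribution on six symbols with
entries `x`, `y` and four equal ones. -/
noncomputable def gSixTwo (x y : ℝ) : ℝ :=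
  ((1 - x - y) / 4) ^ 4 + 4 * (x + y) * ((1 - x - y) / 4) ^ 3 + 6 * x * y * ((1 - x - y) / 4) ^ 2

lemma esym_four_le_gSixTwo {x : Fin 6 → ℝ} (hx : x ∈ stdSimplex ℝ (Fin 6)) {i h : Fin 6}
    (hih : i ≠ h) : esym univ 4 x ≤ gSixTwo (x i) (x h) := by
  refine (esym_four_le_two (n := 4) (w := (1 - x i - x h) / 4) (Fintype.card_fin 6) hx hih
    (by push_cast; ring)).trans (le_of_eq ?_)
  norm_num [gSixTwo, Nat.choose]
  ring

/-- The loss for an entry `y` that differs from the mean of the entries other than `x`. -/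
lemma gSix_sub_gSixTwo (x y : ℝ) : gSix x - gSixTwo x y = (y - (1 - x) / 5) ^ 2 *
    (15 / 8 * x * ((1 - x) / 5) + 15 / 8 * ((1 - x) / 5) ^ 2 - 5 / 16 * x * (y - (1 - x) / 5) -
      5 / 8 * ((1 - x) / 5) * (y - (1 - x) / 5) + 15 / 256 * (y - (1 - x) / 5) ^ 2) := by
  unfold gSix gSixTwo
  ring

/-- The inequality of fourth powers in `gSixTwo_add_le`, where `c - 2.2 * s` is the deviation of
`y` from its optimal value. -/
lemma pow_four_le_of_sq {s c : ℝ} (hs : 0 ≤ s) (hc : 0.001 ≤ c) (hc' : c ≤ 0.22) :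
    432 / 125 * (0.08 + c) ^ 4 ≤ 0.0001516 + 0.7464 * s + 3.2 * (c - 2.2 * s) ^ 2 := by
  rcases le_total c 0.05 with h7 | h7
  · have h8 : 0 ≤ s * (0.05 - c) := mul_nonneg hs (by linarith)
    have h9 : 432 / 125 * (0.08 + c) ^ 4 ≤ 0.0001516 + 3.2 * c ^ 2 := by
      nlinarith [sq_nonneg (c - 0.0011), mul_nonneg (sq_nonneg c) (sub_nonneg.2 h7),
        mul_nonneg (sq_nonneg c) (mul_nonneg (by linarith : 0 ≤ c) (sub_nonneg.2 h7))]
    nlinarith [sq_nonneg s]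
  · have h8 : (0.08 + c) ^ 4 ≤ (0.08 + c) ^ 2 * 0.3 ^ 2 := by
      rw [show (0.08 + c) ^ 4 = (0.08 + c) ^ 2 * (0.08 + c) ^ 2 by ring]
      have : (0.08 + c) ^ 2 ≤ 0.3 ^ 2 := by gcongr; linarith
      gcongr
    have h9 : 0 ≤ (c - 0.05) * (0.22 - c) := mul_nonneg (by linarith) (by linarith)
    have h10 := sq_nonneg (c - 2.2 * s - 0.05)
    ring_nf at h8 h9 h10 ⊢
    linarith

/-- For two distributions with smallest entry at most `1 / 10` at the same symbol, a large difference
`ρ` at another symbol forces the mean `y` there to be large, which costs more than `ρ ^ 4` gains. -/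
lemma gSixTwo_add_le {x y ρ : ℝ} (hx : 0.07 ≤ x) (hx1 : x ≤ 0.1) (hy : y ≤ 0.3)
    (hρ : 0.081 ≤ ρ) (hρy : ρ ≤ y - (2 * x - 1 / 10)) :
    48 * gSixTwo x y + 432 / 125 * ρ ^ 4 ≤ 0.53203 := by
  have h1 := gSix_sub_gSixTwo x y
  obtain ⟨s, rfl⟩ : ∃ s, x = 0.1 - s := ⟨0.1 - x, by ring⟩
  obtain ⟨e, rfl⟩ : ∃ e, y = (1 - (0.1 - s)) / 5 + e := ⟨y - (1 - (0.1 - s)) / 5, by ring⟩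
  rw [add_sub_cancel_left] at h1
  have hs : 0 ≤ s := by linarith
  have he : e ≤ 0.12 := by linarith
  have he' : -0.066 ≤ e := by linarith
  have h2 : 3.2 / 48 ≤ 15 / 8 * (0.1 - s) * ((1 - (0.1 - s)) / 5) +
      15 / 8 * ((1 - (0.1 - s)) / 5) ^ 2 - 5 / 16 * (0.1 - s) * e -
      5 / 8 * ((1 - (0.1 - s)) / 5) * e + 15 / 256 * e ^ 2 := by
    nlinarith [mul_nonneg hs (sub_nonneg.2 he), sq_nonneg (e - 0.12)]
  have h3 := mul_le_mul_of_nonneg_left h2 (sq_nonneg e)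
  have h4 : 48 * gSix (0.1 - s) ≤ 0.5318784 - 0.7464 * s := by
    unfold gSix
    nlinarith [pow_nonneg hs 3, pow_nonneg hs 4, sq_nonneg s,
      mul_nonneg hs (by linarith : 0 ≤ 0.03 - s)]
  have h5 : 432 / 125 * ρ ^ 4 ≤ 0.0001516 + 0.7464 * s + 3.2 * e ^ 2 := by
    have hr : ρ ≤ 0.08 + (e + 2.2 * s) := by linarith
    have h6 : ρ ^ 4 ≤ (0.08 + (e + 2.2 * s)) ^ 4 := by gcongr
    have h7 := pow_four_le_of_sq hs (by linarith : 0.001 ≤ e + 2.2 * s) (by linarith)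
    rw [add_sub_cancel_right] at h7
    linarith
  linarith

lemma Psi_le_six_of_minClosed {p q : Fin 6 → ℝ} (hp : p ∈ minClosed 6 (1 / 10) 0)
    (hq : q ∈ minClosed 6 (1 / 10) 0) : Psi 6 3 p q ≤ 0.53203 := by
  obtain ⟨k, hk⟩ := exists_max_diff p q
  have hP := Psi_le_six hp.1 hq.1 hk
  have hm := mean_mem hp.1 hq.1
  have hg := esym_four_le_gSix hm
  obtain ⟨b1, b2⟩ := diff_bounds hp.1 hq.1 k (ε := 0) (hp.1.1 k) (hq.1.1 k)
  have b3 := mem_minClosed_diff (k := k) hp hq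
  have b0 := (diff_bounds hp.1 hq.1 0 (ε := 0) (hp.1.1 0) (hq.1.1 0)).1
  have hx1 : mean p q 0 ≤ 0.1 := by
    have := hp.2.1
    have := hq.2.1
    unfold mean
    linarith
  have hρ : 0 ≤ |p k - q k| / 2 := by positivity
  have bound {z a r : ℝ} (hz : esym univ 4 (mean p q) ≤ gSix z) (h : gSix z ≤ gSix a)
      (hr : |p k - q k| / 2 ≤ r) (ha : 48 * gSix a + 432 / 125 * r ^ 4 ≤ 0.53203) :
      Psi 6 3 p q ≤ 0.53203 := by
    have : (|p k - q k| / 2) ^ 4 ≤ r ^ 4 := by gcongr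
    linarith
  rcases le_or_gt (|p k - q k| / 2) 0.081 with h1 | h1
  · exact bound (hg 0) (gSix_mono hx1 (by norm_num)) h1 (by norm_num [gSix])
  have hk0 : 0 ≠ k := by
    rintro rfl
    linarith
  rcases le_or_gt (mean p q k) 0.3 with h2 | h2
  · rcases le_or_gt (mean p q 0) 0.07 with h3 | h3
    · exact bound (hg 0) (gSix_mono h3 (by norm_num)) (by linarith : _ ≤ (0.3 : ℝ))
        (by norm_num [gSix])
    · have h4 := esym_four_le_gSixTwo hm hk0
      have h5 := gSixTwo_add_le h3.le hx1 h2 h1.le b3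
      linarith
  · have h3 := hg k
    rcases le_total (1 / 2) (mean p q k) with h4 | h4
    · have h5 := gSix_add_le_of_half_le h4 hρ b2
      linarith
    have h5 : (|p k - q k| / 2) ^ 4 ≤ mean p q k ^ 4 := by gcongr; linarith
    set y := mean p q k
    have h6 : 0 ≤ (y - 0.3) * (0.5 - y) := mul_nonneg (by linarith) (by linarith)
    have h7 : 0 ≤ (y - 0.3) * (0.5 - y) * (y - 0.3) := mul_nonneg h6 (by linarith)
    have h8 : 48 * gSix y + 432 / 125 * y ^ 4 ≤ 0.53203 := by
      unfold gSix
      ring_nf at h6 h7 ⊢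
      linarith
    linarith

/-- The tangent line of the polynomial `devPoly 5` at a point of `[0, 1 / 5]` is a lower bound. -/
lemma devPoly_five_tangent {z t : ℝ} (h0 : -(4 / 5) ≤ z) (h1 : z ≤ 6 / 5) (ht : 0 ≤ t)
    (ht1 : t ≤ 1 / 5) : devPoly 5 t + (96 / 25 * t + 24 / 5 * t ^ 2 - 3 * t ^ 3) * (z - t) ≤
      devPoly 5 z := by
  have h2 : 0 ≤ 48 / 25 + 8 / 5 * (z + 2 * t) - 3 / 4 * (z ^ 2 + 2 * z * t + 3 * t ^ 2) := by
    nlinarith [mul_nonneg (by linarith : 0 ≤ z + 4 / 5) (by linarith : 0 ≤ 6 / 5 - z),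
      mul_nonneg (by linarith : 0 ≤ z + 4 / 5) (by linarith : 0 ≤ 1 / 5 - t),
      mul_nonneg ht (by linarith : 0 ≤ 1 / 5 - t)]
  have h3 := mul_nonneg (sq_nonneg (z - t)) h2
  unfold devPoly
  norm_num
  linarith

/-- The lower bound for a sum of five values of `devPoly 5` at arguments with sum `0`, in terms of
one of the arguments; it is attained if the other four are equal. -/
lemma le_sum_devPoly_five {ι : Type*} [DecidableEq ι] {s : Finset ι} (hs : s.card = 5) {i : ι}
    (hi : i ∈ s) {z : ι → ℝ} (hsum : ∑ h ∈ s, z h = 0)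
    (hz : ∀ h ∈ s, -(4 / 5) ≤ z h ∧ z h ≤ 6 / 5) {t : ℝ} (hzt : z i = -t) (ht : 0 ≤ t) :
    12 / 5 * t ^ 2 - 3 / 2 * t ^ 3 - 195 / 256 * t ^ 4 ≤ ∑ h ∈ s, devPoly 5 (z h) := by
  have ht1 : t ≤ 4 / 5 := by linarith [(hz i hi).1]
  have hcard : (s.erase i).card = 4 := by rw [card_erase_of_mem hi, hs]
  rw [← add_sum_erase s _ hi] at hsum ⊢
  have h1 := sum_le_sum fun h (hh : h ∈ s.erase i) =>
    devPoly_five_tangent (hz h (mem_of_mem_erase hh)).1 (hz h (mem_of_mem_erase hh)).2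
      (by linarith : 0 ≤ t / 4) (by linarith)
  rw [sum_add_distrib, ← mul_sum, sum_sub_distrib, sum_const, sum_const, hcard, nsmul_eq_mul,
    nsmul_eq_mul, show ∑ h ∈ s.erase i, z h = t by linarith] at h1
  have h2 : (t - ((4 : ℕ) : ℝ) * (t / 4)) = 0 := by push_cast; ring
  rw [h2, mul_zero, add_zero] at h1
  refine le_trans (le_of_eq ?_) (add_le_add le_rfl h1)
  rw [hzt]
  unfold devPoly
  push_cast
  ring

/-- The lower bound of `le_sum_devPoly_five` is monotone in the relevant range. -/
lemma pen_mono {s t : ℝ} (hs : 0 ≤ s) (hs1 : s ≤ 0.47) (hst : s ≤ t) (ht : t ≤ 4 / 5) :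
    12 / 5 * s ^ 2 - 3 / 2 * s ^ 3 - 195 / 256 * s ^ 4 ≤
      12 / 5 * t ^ 2 - 3 / 2 * t ^ 3 - 195 / 256 * t ^ 4 := by
  have h1 : 0 ≤ (t + s) * (0.861 - (t ^ 2 + s ^ 2)) := mul_nonneg (by linarith) (by nlinarith)
  have h2 : t ^ 2 + t * s + s ^ 2 ≤ 1.035 * (t + s) := by
    nlinarith [mul_nonneg hs (sub_nonneg.2 hs1), mul_nonneg (hs.trans hst) (sub_nonneg.2 ht),
      mul_nonneg hs (sub_nonneg.2 ht)]
  have h3 : 0 ≤ 12 / 5 * (t + s) - 3 / 2 * (t ^ 2 + t * s + s ^ 2) -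
      195 / 256 * ((t + s) * (t ^ 2 + s ^ 2)) := by linarith
  linarith [mul_nonneg (sub_nonneg.2 hst) h3]

/-- The correction terms are monotone in half the difference `ρ`. -/
lemma corr_mono {a ρ y : ℝ} (ha : 0.04 ≤ a) (ha1 : a ≤ 0.1) (hρ : 0.15 ≤ ρ) (hρy : ρ ≤ y) :
    432 / 125 * ρ ^ 4 - 6 * (12 / 5 * ρ ^ 2 * (a - ρ / 5) ^ 2 - 3 / 2 * ρ * (a - ρ / 5) ^ 3 -
        195 / 256 * (a - ρ / 5) ^ 4) ≤
      432 / 125 * y ^ 4 - 6 * (12 / 5 * y ^ 2 * (a - y / 5) ^ 2 - 3 / 2 * y * (a - y / 5) ^ 3 -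
        195 / 256 * (a - y / 5) ^ 4) := by
  have hS : 0 ≤ y + ρ - 0.3 := by linarith
  have h1 : 0 ≤ 2.81 * ((y + ρ) * (y ^ 2 + ρ ^ 2)) + 6.69 * a * (y ^ 2 + y * ρ + ρ ^ 2) -
      18.71 * a ^ 2 * (y + ρ) := by
    have h2 : 0.045 ≤ y ^ 2 + ρ ^ 2 := by nlinarith
    have h3 : 0.225 * (y + ρ) ≤ y ^ 2 + y * ρ + ρ ^ 2 := by nlinarith [sq_nonneg (y - ρ)]
    have h4 : 0 ≤ (y + ρ) * (y ^ 2 + ρ ^ 2 - 0.045) := mul_nonneg (by linarith) (by linarith)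
    have h5 : 0 ≤ a * (y ^ 2 + y * ρ + ρ ^ 2 - 0.225 * (y + ρ)) :=
      mul_nonneg (by linarith) (by linarith)
    have h6 : 0 ≤ (y + ρ) * (0.12645 + 1.50525 * a - 18.71 * a ^ 2) :=
      mul_nonneg (by linarith) (by nlinarith)
    linarith
  have h7 := mul_nonneg (sub_nonneg.2 hρy) h1
  have h8 : 0 ≤ (y - ρ) * ((y + ρ) * (y ^ 2 + ρ ^ 2)) :=
    mul_nonneg (sub_nonneg.2 hρy) (mul_nonneg (by linarith) (by positivity))
  have h9 : 0 ≤ (y - ρ) * (a * (y ^ 2 + y * ρ + ρ ^ 2)) :=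
    mul_nonneg (sub_nonneg.2 hρy) (mul_nonneg (by linarith) (by nlinarith))
  have h10 : 0 ≤ (y - ρ) * (a ^ 2 * (y + ρ)) :=
    mul_nonneg (sub_nonneg.2 hρy) (mul_nonneg (by positivity) (by linarith))
  have h11 : 0 ≤ (y - ρ) * a ^ 3 := mul_nonneg (sub_nonneg.2 hρy) (by positivity)
  ring_nf at h7 h8 h9 h10 h11 ⊢
  linarith

/-- The bound of `esym_four_le_gSixTwo` with the correction terms. Both sides are close near the
point `(0.16297, 0.17502)`; in coordinates centred there the quadratic part dominates. -/
lemma gSixTwo_add_corr_le {x y : ℝ} (hx : 0.14 ≤ x) (hx1 : x ≤ 0.2) (hy : 0.15 ≤ y)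
    (hy1 : y ≤ 0.2) :
    48 * gSixTwo x y + (432 / 125 * y ^ 4 - 6 * (12 / 5 * y ^ 2 * (x - 1 / 10 - y / 5) ^ 2 -
      3 / 2 * y * (x - 1 / 10 - y / 5) ^ 3 - 195 / 256 * (x - 1 / 10 - y / 5) ^ 4)) ≤
      0.558148 := by
  obtain ⟨s, rfl⟩ : ∃ s, x = 0.16297 + s := ⟨x - 0.16297, by ring⟩
  obtain ⟨t, rfl⟩ : ∃ t, y = 0.17502 + t := ⟨y - 0.17502, by ring⟩
  have s2 := sq_nonneg s
  have t2 := sq_nonneg t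
  have a1 : 0 ≤ t ^ 2 * (0.026 - t) := mul_nonneg t2 (by linarith)
  have a2 : 0 ≤ t ^ 2 * (s + 0.04) := mul_nonneg t2 (by linarith)
  have a3 : 0 ≤ s ^ 2 * (t + 0.026) := mul_nonneg s2 (by linarith)
  have a4 : 0 ≤ s ^ 2 * (0.04 - s) := mul_nonneg s2 (by linarith)
  have hst : s * t ≤ 0.0021 := by nlinarith [sq_nonneg (s - t)]
  have a5 : 0 ≤ t ^ 2 * (0.0021 - s * t) := mul_nonneg t2 (by linarith)
  have a6 : 0 ≤ s ^ 2 * (0.0021 - s * t) := mul_nonneg s2 (by linarith)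
  have ht2 : t ^ 2 ≤ 0.001 := by nlinarith
  have hs2 : s ^ 2 ≤ 0.0016 := by nlinarith
  have a7 : 0 ≤ t ^ 2 * (0.001 - t ^ 2) := mul_nonneg t2 (by linarith)
  have a8 : 0 ≤ s ^ 2 * (0.001 - t ^ 2) := mul_nonneg s2 (by linarith)
  have a9 : 0 ≤ s ^ 2 * (0.0016 - s ^ 2) := mul_nonneg s2 (by linarith)
  have a10 := sq_nonneg (s + t)
  have a11 := sq_nonneg (s + 0.0001)
  have a12 := sq_nonneg (t + 0.0001)
  unfold gSixTwo
  ring_nf at a1 a2 a3 a4 a5 a6 a7 a8 a9 a10 a11 a12 ⊢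
  linarith

/-- The bound for a symbol `k` with the largest difference, if a distribution with an entry at most
`1 / 10` has the larger entry at `k`. -/
lemma Psi_le_six_of_small {p q : Fin 6 → ℝ} (hp : p ∈ stdSimplex ℝ (Fin 6))
    (hq : q ∈ stdSimplex ℝ (Fin 6)) {i k : Fin 6} (hpi : p i ≤ 1 / 10)
    (hk : ∀ h, |p h - q h| ≤ |p k - q k|) (hqp : q k ≤ p k) : Psi 6 3 p q ≤ 0.558148 := by
  have hP := Psi_le_six hp hq hk
  have hm := mean_mem hp hq
  have hg := esym_four_le_gSix hm
  obtain ⟨b1, b2⟩ := diff_bounds hp hq k (ε := 0) (hp.1 k) (hq.1 k)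
  have hD := abs_of_nonneg (sub_nonneg.2 hqp)
  obtain ⟨ρ, hρdef⟩ : ∃ ρ, ρ = |p k - q k| / 2 := ⟨_, rfl⟩
  rw [← hρdef] at hP b1 b2
  have hpq : p k - q k = 2 * ρ := by linarith
  have hρ : 0 ≤ ρ := by linarith
  have bound {z a r : ℝ} (hz : esym univ 4 (mean p q) ≤ gSix z) (h : gSix z ≤ gSix a)
      (hr : ρ ≤ r) (ha : 48 * gSix a + 432 / 125 * r ^ 4 ≤ 0.558148) :
      Psi 6 3 p q ≤ 0.558148 := by
    have : ρ ^ 4 ≤ r ^ 4 := by gcongr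
    linarith
  rcases le_or_gt ρ 0.15 with h1 | h1
  · exact bound (hg k) (gSix_le _) h1 (by norm_num [gSix])
  rcases le_or_gt 0.2 (mean p q k) with h2 | h2
  · have h3 := hg k
    rcases le_total (1 / 2) (mean p q k) with h4 | h4
    · have h5 := gSix_add_le_of_half_le h4 hρ b2
      linarith
    have h5 : ρ ^ 4 ≤ mean p q k ^ 4 := by gcongr; linarith
    set y := mean p q k
    have h6 : 0 ≤ (y - 0.2) * (0.5 - y) := mul_nonneg (by linarith) (by linarith)
    have h7 : 0 ≤ (y - 0.2) * (0.5 - y) * (y - 0.2) := mul_nonneg h6 (by linarith)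
    have h9 : 0 ≤ (y - 0.2) ^ 2 := sq_nonneg _
    have h8 : 48 * gSix y + 432 / 125 * y ^ 4 ≤ 0.558148 := by
      unfold gSix
      ring_nf at h6 h7 h9 ⊢
      linarith
    linarith
  have hρ2 : ρ ≤ 0.2 := by linarith
  rcases le_or_gt (mean p q i) 0.14 with h3 | h3
  · exact bound (hg i) (gSix_mono h3 (by norm_num)) hρ2 (by norm_num [gSix])
  rcases le_or_gt 0.2 (mean p q i) with h4 | h4
  · exact bound (hg i) (gSix_anti (by norm_num) h4 (le_one_of_mem_stdSimplex hm i)) hρ2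
      (by norm_num [gSix])
  have hqi : q i = 2 * mean p q i - p i := by unfold mean; ring
  have hik : i ≠ k := by
    rintro rfl
    linarith
  have h5 := esym_four_le_gSixTwo hm hik
  have h6 := gSixTwo_add_corr_le h3.le h4.le (by linarith : 0.15 ≤ mean p q k) h2.le
  have h7 := corr_mono (a := mean p q i - 1 / 10) (by linarith) (by linarith) h1.le
    (by linarith : ρ ≤ mean p q k)
  have h8 := phi_three_add_le (m := 5) (Fintype.card_fin 6) (by norm_num) hp hq hk
  have hc : diffConst (5 : ℕ) = 72 / 125 := by norm_num [diffConst]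
  rw [hc, hpq, mul_div_cancel_left₀ _ (two_ne_zero)] at h8
  have hne : p k - q k ≠ 0 := by linarith
  have hsum := sum_devPoly_arg (m := 5) (Fintype.card_fin 6) (by norm_num) hp hq hne
  rw [hpq] at hsum
  set x := mean p q i with hx
  set v := (x - 1 / 10 - ρ / 5) / ρ with hv
  have ev : x - 1 / 10 - ρ / 5 = ρ * v := by rw [hv]; field_simp
  have hv0 : 0 ≤ v := div_nonneg (by linarith) hρ
  have hv1 : v ≤ 0.47 := by rw [hv, div_le_iff₀ (by linarith)]; linarith
  have harg : ∀ h, -(4 / 5) ≤ (p h - q h) / (2 * ρ) + 1 / ((5 : ℕ) : ℝ) ∧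
      (p h - q h) / (2 * ρ) + 1 / ((5 : ℕ) : ℝ) ≤ 6 / 5 := by
    intro h
    have := abs_le.1 (abs_quotient_le hk h)
    rw [hpq] at this
    push_cast
    constructor <;> linarith
  have hvt : v ≤ -((p i - q i) / (2 * ρ) + 1 / ((5 : ℕ) : ℝ)) := by
    rw [hv, div_le_iff₀ (by linarith)]
    have : (p i - q i) / (2 * ρ) * ρ = (p i - q i) / 2 := by field_simp
    push_cast
    rw [neg_mul, add_mul, this]
    linarith
  have h9 := le_sum_devPoly_five (s := univ.erase k) (by rw [card_erase_of_mem (mem_univ k)]; rfl)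
    (mem_erase.2 ⟨hik, mem_univ i⟩) hsum (fun h _ => harg h) (neg_neg _).symm (hv0.trans hvt)
  have h10 := pen_mono hv0 hv1 hvt (by linarith [(harg i).1])
  have h11 := mul_le_mul_of_nonneg_left (h10.trans h9) (by positivity : 0 ≤ ρ ^ 4)
  have h12 : ((5 : ℕ) : ℝ) = 5 := by norm_num
  rw [h12] at h8 h11
  rw [ev] at h7
  have e1 : ρ ^ 4 * (12 / 5 * v ^ 2 - 3 / 2 * v ^ 3 - 195 / 256 * v ^ 4) =
      12 / 5 * ρ ^ 2 * (ρ * v) ^ 2 - 3 / 2 * ρ * (ρ * v) ^ 3 - 195 / 256 * (ρ * v) ^ 4 := by ring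
  rw [e1] at h11
  rw [Psi_eq (by norm_num)]
  norm_num [Nat.factorial] at h8 h11 ⊢
  linarith

lemma Psi_comm_six {p q : Fin 6 → ℝ} : Psi 6 3 p q = Psi 6 3 q p := by
  rw [Psi_eq (by norm_num), Psi_eq (by norm_num), phi_comm]

lemma Psi_le_six_of_minClosed_of_minClosed {i h : Fin 6} {p q : Fin 6 → ℝ}
    (hp : p ∈ minClosed 6 (1 / 10) i) (hq : q ∈ minClosed 6 (1 / 10) h) :
    Psi 6 3 p q ≤ 0.558148 := by
  obtain ⟨k, hk⟩ := exists_max_diff p q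
  rcases le_total (q k) (p k) with hqp | hqp
  · exact Psi_le_six_of_small hp.1 hq.1 hp.2.1 hk hqp
  · rw [Psi_comm_six]
    refine Psi_le_six_of_small hq.1 hp.1 hq.2.1 (k := k) (fun l => ?_) hqp
    rw [abs_sub_comm, abs_sub_comm (q k)]
    exact hk l

theorem exists_isMinPartitionM_six_five :
    ∃ M : ℝ, IsMinPartitionM 6 5 (1 / 10) M ∧ M ≤ 0.5567010 ∧ 0.5567010 - M ≤ 5 / 10 ^ 6 := by
  have hB := minBalanced_subset 6 (1 / 10)
  have hC := minClosed_subset (1 / 10) (0 : Fin 6)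
  have hC' := minClosed_subset (1 / 10) (1 : Fin 6)
  have u₁ : supPsi 6 3 (minBalanced 6 (1 / 10)) (minBalanced 6 (1 / 10)) ≤ 0.5556248 := by
    refine supPsi_le (by norm_num) fun p hp q hq => ?_
    obtain ⟨k, hk⟩ := exists_max_diff p q
    have h1 := Psi_le_six hp.1 hq.1 hk
    have h2 := esym_four_le_gSix (mean_mem hp.1 hq.1) k
    obtain ⟨b1, b2⟩ := diff_bounds hp.1 hq.1 k (hp.2 k) (hq.2 k)
    have h3 := gSix_add_le_of_balanced (by positivity) b1 b2
    linarith
  have u₂ : supPsi 6 3 (minBalanced 6 (1 / 10)) (minClosed 6 (1 / 10) 0) ≤ 0.5584692 := by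
    refine supPsi_le (by norm_num) fun p hp q hq => ?_
    obtain ⟨k, hk⟩ := exists_max_diff p q
    have h1 := Psi_le_six hp.1 hq.1 hk
    have h2 := esym_four_le_gSix (mean_mem hp.1 hq.1) k
    obtain ⟨b1, b2⟩ := diff_bounds hp.1 hq.1 k (hp.1.1 k) (hq.1.1 k)
    have h3 := gSix_add_le (by positivity) (by linarith) b2
    linarith
  have u₃ : supPsi 6 3 (minClosed 6 (1 / 10) 0) (minClosed 6 (1 / 10) 0) ≤ 0.53203 :=
    supPsi_le (by norm_num) fun p hp q hq => Psi_le_six_of_minClosed hp hq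
  have u₄ : supPsi 6 3 (minClosed 6 (1 / 10) 0) (minClosed 6 (1 / 10) 1) ≤ 0.558148 :=
    supPsi_le (by norm_num) fun p hp q hq => Psi_le_six_of_minClosed_of_minClosed hp hq
  have l₁ : 0.5556247 ≤ supPsi 6 3 (minBalanced 6 (1 / 10)) (minBalanced 6 (1 / 10)) := by
    have hp : vec 4 0.1 0.18 0.18 ∈ minBalanced 6 (1 / 10) :=
      ⟨vec_mem (by norm_num) (by norm_num) (by norm_num) (by norm_num),
        forall_vec (P := fun v => (1 / 10 : ℝ) ≤ v) (by norm_num) (by norm_num) (by norm_num)⟩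
    have hq : vec 4 0.2342 0.15316 0.15316 ∈ minBalanced 6 (1 / 10) :=
      ⟨vec_mem (by norm_num) (by norm_num) (by norm_num) (by norm_num),
        forall_vec (P := fun v => (1 / 10 : ℝ) ≤ v) (by norm_num) (by norm_num) (by norm_num)⟩
    refine le_trans ?_ (le_supPsi (j := 3) hB hB hp hq)
    rw [Psi_vec (n := 4) (k := 1) (by norm_num)]
    norm_num [Nat.choose, Nat.factorial]
  have l₂ : 0.5584691 ≤ supPsi 6 3 (minBalanced 6 (1 / 10)) (minClosed 6 (1 / 10) 0) := by
    have hp : vec 4 0.3489 0.13022 0.13022 ∈ minBalanced 6 (1 / 10) :=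
      ⟨vec_mem (by norm_num) (by norm_num) (by norm_num) (by norm_num),
        forall_vec (P := fun v => (1 / 10 : ℝ) ≤ v) (by norm_num) (by norm_num) (by norm_num)⟩
    have hq : vec 4 0 0.2 0.2 ∈ minClosed 6 (1 / 10) 0 :=
      ⟨vec_mem (by norm_num) (by norm_num) (by norm_num) (by norm_num),
        by change (0 : ℝ) ≤ 1 / 10; norm_num,
        forall_vec (P := fun v => (0 : ℝ) ≤ v) (by norm_num) (by norm_num) (by norm_num)⟩
    refine le_trans ?_ (le_supPsi (j := 3) hB hC hp hq)
    rw [Psi_vec (n := 4) (k := 1) (by norm_num)]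
    norm_num [Nat.choose, Nat.factorial]
  have l₃ : 0.53199 ≤ supPsi 6 3 (minClosed 6 (1 / 10) 0) (minClosed 6 (1 / 10) 0) := by
    have hp : vec 4 0.1 0.1 0.2 ∈ minClosed 6 (1 / 10) 0 :=
      ⟨vec_mem (by norm_num) (by norm_num) (by norm_num) (by norm_num),
        by change (0.1 : ℝ) ≤ 1 / 10; norm_num,
        forall_vec (P := fun v => (0.1 : ℝ) ≤ v) (by norm_num) (by norm_num) (by norm_num)⟩
    have hq : vec 4 0.1 0.26132 0.15967 ∈ minClosed 6 (1 / 10) 0 :=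
      ⟨vec_mem (by norm_num) (by norm_num) (by norm_num) (by norm_num),
        by change (0.1 : ℝ) ≤ 1 / 10; norm_num,
        forall_vec (P := fun v => (0.1 : ℝ) ≤ v) (by norm_num) (by norm_num) (by norm_num)⟩
    refine le_trans ?_ (le_supPsi (j := 3) hC hC hp hq)
    rw [Psi_vec (n := 4) (k := 1) (by norm_num)]
    norm_num [Nat.choose, Nat.factorial]
  have l₄ : 0.558138 ≤ supPsi 6 3 (minClosed 6 (1 / 10) 0) (minClosed 6 (1 / 10) 1) := by
    have hp : vec 4 0.1 0.35 0.1375 ∈ minClosed 6 (1 / 10) 0 :=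
      ⟨vec_mem (by norm_num) (by norm_num) (by norm_num) (by norm_num),
        by change (0.1 : ℝ) ≤ 1 / 10; norm_num,
        forall_vec (P := fun v => (0.1 : ℝ) ≤ v) (by norm_num) (by norm_num) (by norm_num)⟩
    have hq : vec 4 0.226 0 0.1935 ∈ minClosed 6 (1 / 10) 1 :=
      ⟨vec_mem (by norm_num) (by norm_num) (by norm_num) (by norm_num),
        by change (0 : ℝ) ≤ 1 / 10; norm_num,
        forall_vec (P := fun v => (0 : ℝ) ≤ v) (by norm_num) (by norm_num) (by norm_num)⟩
    refine le_trans ?_ (le_supPsi (j := 3) hC hC' hp hq)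
    rw [Psi_vec (n := 4) (k := 1) (by norm_num)]
    norm_num [Nat.choose, Nat.factorial]
  obtain ⟨M, hM⟩ := exists_isClusterMax 6 _ _ _ _
  refine ⟨M, isPartitionMax_min (by norm_num) (by norm_num) (i₀ := 0) (h₀ := 1) (by decide) hM,
    ?_, ?_⟩
  · exact hM.le_of_le (by norm_num) u₁ u₂ u₃ u₄ (by norm_num) (by norm_num) (by norm_num)
      (Or.inr (by norm_num))
  · have := hM.le (x := 0.3776) (by norm_num) (by norm_num) (by norm_num) l₁ l₂ l₃ l₄
    norm_num at this ⊢
    linarith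

end SixFive

theorem theorem3 :
    -- maximum-based partition
    (∃ M : ℝ, IsMaxPartitionM 7 7 (9 / 100) M ∧ |M - 0.0861594| ≤ 1 / 10 ^ 7) ∧
    (∃ M : ℝ, IsMaxPartitionM 8 8 (3 / 25) M ∧ |M - 0.0388599| ≤ 1 / 10 ^ 7) ∧
    (∃ M : ℝ, IsMaxPartitionM 9 8 (1 / 10) M ∧ |M - 0.0758830| ≤ 1 / 10 ^ 7) ∧
    (∃ M : ℝ, IsMaxPartitionM 10 9 (1 / 15) M ∧ |M - 0.0363565| ≤ 1 / 10 ^ 7) ∧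
    (∃ M : ℝ, IsMaxPartitionM 11 10 (1 / 11) M ∧ |M - 0.0170049| ≤ 1 / 10 ^ 7) ∧
    -- minimum-based partition, (b, k) = (5, 5): the exact maximum, and the maximum obtained
    -- when the third coefficient is replaced by its upper bound 0.374759
    (∃ M : ℝ, IsMinPartitionM 5 5 ((4 + √5) / 44) M ∧
      M ≤ 0.3873676 ∧ 0.3873676 - M ≤ 4 / 10 ^ 4) ∧
    (∀ i h : Fin 5, i ≠ h →
      supPsi 5 3 (minUnbalanced 5 ((4 + √5) / 44) i) (minUnbalanced 5 ((4 + √5) / 44) i)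
        ≤ 0.374759 ∧
      ∃ M : ℝ, IsClusterMax 5
        (supPsi 5 3 (minBalanced 5 ((4 + √5) / 44)) (minBalanced 5 ((4 + √5) / 44)))
        (supPsi 5 3 (minBalanced 5 ((4 + √5) / 44)) (minUnbalanced 5 ((4 + √5) / 44) i))
        0.374759
        (supPsi 5 3 (minUnbalanced 5 ((4 + √5) / 44) i) (minUnbalanced 5 ((4 + √5) / 44) h))
        M ∧ |M - 0.3873676| ≤ 1 / 10 ^ 7) ∧
    -- minimum-based partition, (b, k) = (6, 5) and (6, 6)
    (∃ M : ℝ, IsMinPartitionM 6 5 (1 / 10) M ∧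
      M ≤ 0.5567010 ∧ 0.5567010 - M ≤ 5 / 10 ^ 6) ∧
    IsMinPartitionM 6 6 (1 / 20) (5 / 27) := by
  exact ⟨exists_isMaxPartitionM_seven, exists_isMaxPartitionM_eight, exists_isMaxPartitionM_nine,
    exists_isMaxPartitionM_ten, exists_isMaxPartitionM_eleven, exists_isMinPartitionM_five,
    fun _ _ hih => five_coefficient_bound hih, exists_isMinPartitionM_six_five,
    isMinPartitionM_six_six⟩
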